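/- Let $n\in\mathbb N$ and $1<p\le \frac{2n}{n+2}$ (so that $n\ge 3$ and $p<n$), put $p^*=\frac{np}{n-p}$, and let $$v(x)=\frac{a_0}{\bigl(1+|x|^{\frac p{p-1}}\bigr)^{\frac{n-p}{p}}},\qquad x\in\mathbb R^n,$$ where $a_0>0$ is any constant such that $\frac12\le\|v\|_{L^{p^*}(\mathbb R^n)}\le 2$. Let $\dot W^{1,p}(\mathbb R^n)$ be the closure of $C_c^\infty(\mathbb R^n)$ with respect to the norm $\|Du\|_{L^p(\mathbb R^n)}$ (its elements being regarded, through the Sobolev inequality, as functions in $L^{p^*}(\mathbb R^n)$ with gradient in $L^p(\mathbb R^n;\mathbb R^n)$), and let $L^2(\mathbb R^n;v^{p^*-2})$ be the space of measurable functions $\varphi$ with $\int_{\mathbb R^n}v^{p^*-2}|\varphi|^2\,dx<\infty$. Let $\epsilon_i\in(0,1)$ be a sequence with $\epsilon_i\to0$, and let $\phi_i\in\dot W^{1,p}(\mathbb R^n)$ be a sequence of functions satisfying $$\int_{\mathbb R^n}\bigl(|Dv|+\epsilon_i|D\phi_i|\bigr)^{p-2}|D\phi_i|^2\,dx\le 1\qquad\text{for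 all } i.$$ Then there are a subsequence (not relabelled) and a function $\phi\in\dot W^{1,p}(\mathbb R^n)\cap L^2(\mathbb R^n;v^{p^*-2})$ such that $\phi_i\rightharpoonup\phi$ weakly in $\dot W^{1,p}(\mathbb R^n)$ and, for every constant $C_1\ge0$, along this same subsequence, $$\int_{\mathbb R^n}\frac{(v+C_1\epsilon_i|\phi_i|)^{p^*}}{v^2+|\epsilon_i\phi_i|^2}|\phi_i|^2\,dx\ \longrightarrow\ \int_{\mathbb R^n}v^{p^*-2}|\phi|^2\,dx \quad\text{and}\quad \int_{\mathbb R^n}\frac{|v+C_1\epsilon_i\phi_i|^{p^*}}{v^2+|\epsilon_i\phi_i|^2}|\phi_i|^2\,dx\ \longrightarrow\ \int_{\mathbb R^n}v^{p^*-2}|\phi|^2\,dx\qquad\text{as } i\to\infty.$$ (The two integrands on the left coincide where $\phi_i\ge0$.) -/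

import Mathlib

open MeasureTheory Filter Topology Set
open scoped ENNReal ContDiff Gradient

/-- Euclidean space `ℝⁿ`. -/
abbrev Euc (n : ℕ) : Type := EuclideanSpace ℝ (Fin n)

/-- The critical Sobolev exponent `p* = np / (n - p)`. -/
noncomputable def sobolevExp (n : ℕ) (p : ℝ) : ℝ := n * p / (n - p)

/-- The extremal function `v(x) = a₀ / (1 + |x|^(p/(p-1)))^((n-p)/p)` of the Sobolev inequality. -/
noncomputable def bubble (n : ℕ) (p a₀ : ℝ) (x : Euc n) : ℝ :=
  a₀ / (1 + ‖x‖ ^ (p / (p - 1))) ^ ((n - p) / p)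

/-- `u ∈ C_c^∞(ℝⁿ)`. -/
def IsTest {n : ℕ} (u : Euc n → ℝ) : Prop := ContDiff ℝ ∞ u ∧ HasCompactSupport u

instance fact_one_le_ofReal {p : ℝ} [h : Fact (1 < p)] : Fact (1 ≤ ENNReal.ofReal p) :=
  ⟨ENNReal.one_le_ofReal.2 h.out.le⟩

/-- The linear subspace `{Du : u ∈ C_c^∞(ℝⁿ)}` of `L^p(ℝⁿ; ℝⁿ)`. Its norm is `u ↦ ‖Du‖_{L^p}`, so
it is an isometric copy of `C_c^∞(ℝⁿ)` with the norm of `Ẇ^{1,p}`. -/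
noncomputable def testGradients (n : ℕ) (p : ℝ) :
    Submodule ℝ (Lp (Euc n) (ENNReal.ofReal p) (volume : Measure (Euc n))) where
  carrier := {G | ∃ u : Euc n → ℝ, IsTest u ∧ G =ᵐ[volume] ∇ u}
  zero_mem' := by
    refine ⟨fun _ => 0, ⟨contDiff_const, HasCompactSupport.zero⟩, ?_⟩
    filter_upwards [Lp.coeFn_zero (Euc n) (ENNReal.ofReal p) volume] with x hx
    rw [hx]
    simp [gradient]
  add_mem' := by
    rintro F G ⟨u, ⟨hu, hu'⟩, hF⟩ ⟨w, ⟨hw, hw'⟩, hG⟩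
    refine ⟨fun x => u x + w x, ⟨hu.add hw, hu'.add hw'⟩, ?_⟩
    filter_upwards [Lp.coeFn_add F G, hF, hG] with x hx h1 h2
    rw [hx, Pi.add_apply, h1, h2, gradient, gradient, gradient,
      fderiv_fun_add (hu.differentiable (by simp) x) (hw.differentiable (by simp) x), map_add]
  smul_mem' := by
    rintro c F ⟨u, ⟨hu, hu'⟩, hF⟩
    refine ⟨fun x => c * u x, ⟨contDiff_const.mul hu, hu'.mul_left⟩, ?_⟩
    filter_upwards [Lp.coeFn_smul c F, hF] with x hx h1
    rw [hx, Pi.smul_apply, h1, gradient, gradient,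
      fderiv_const_mul (hu.differentiable (by simp) x), map_smul]

/-- The homogeneous Sobolev space `Ẇ^{1,p}(ℝⁿ)`, the completion of `C_c^∞(ℝⁿ)` in the norm
`‖Du‖_{L^p}`, with each element recorded by its gradient: the closure of `{Du : u ∈ C_c^∞(ℝⁿ)}` in
`L^p(ℝⁿ; ℝⁿ)`. It inherits the norm of `L^p(ℝⁿ; ℝⁿ)`, which is the norm of `Ẇ^{1,p}`. -/
noncomputable abbrev HomSobolev (n : ℕ) (p : ℝ) [Fact (1 < p)] :
    Submodule ℝ (Lp (Euc n) (ENNReal.ofReal p) (volume : Measure (Euc n))) :=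
  (testGradients n p).topologicalClosure

/-- The gradient field `Dφ : ℝⁿ → ℝⁿ` of an element of `Ẇ^{1,p}(ℝⁿ)`. -/
noncomputable def HomSobolev.grad {n : ℕ} {p : ℝ} [Fact (1 < p)] (U : HomSobolev n p) :
    Euc n → Euc n :=
  ((U : Lp (Euc n) (ENNReal.ofReal p) (volume : Measure (Euc n))) : Euc n → Euc n)

/-- The function `φ ∈ L^{p*}(ℝⁿ)` realizes the element `U` of `Ẇ^{1,p}(ℝⁿ)`: some sequence in
`C_c^∞(ℝⁿ)` converges to `U` in the norm of `Ẇ^{1,p}` and to `φ` in `L^{p*}`. For `1 < p < n` the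
Sobolev inequality shows that each `U` is realized by exactly one `φ`, up to null sets. -/
def HomSobolev.Realizes {n : ℕ} {p : ℝ} [Fact (1 < p)] (φ : Euc n → ℝ) (U : HomSobolev n p) :
    Prop :=
  MemLp φ (ENNReal.ofReal (sobolevExp n p)) volume ∧
    ∃ u : ℕ → Euc n → ℝ, (∀ k, IsTest (u k)) ∧
      Tendsto (fun k => eLpNorm (fun x => ∇ (u k) x - HomSobolev.grad U x)
        (ENNReal.ofReal p) volume) atTop (𝓝 0) ∧
      Tendsto (fun k => eLpNorm (fun x => u k x - φ x)
        (ENNReal.ofReal (sobolevExp n p)) volume) atTop (𝓝 0)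

/-- `φ ∈ L^q(ℝⁿ; g)`: `φ` is measurable (up to a null set) and `∫ |φ|^q g dx < ∞`. -/
def MemWeightedLp {n : ℕ} (q : ℝ) (g φ : Euc n → ℝ) : Prop :=
  AEMeasurable φ volume ∧ ∫⁻ x, ENNReal.ofReal (|φ x| ^ q * g x) < ⊤

/-! ### Pointwise inequalities -/

/-! Write `w = |Dv|`, `N = 1 + |x|^(p/(p-1))`, `q = p*` and `M = v² + ε²φ²`. The condition on `p`
amounts to `q ≤ 2` and forces `p < 2 < n`.

Size of the integrands. Where `ε|φ| ≤ v` they are at most a constant times `v^(q-2) φ²`. For this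
particular `v`, `v^(q-2)` is a multiple of `v^(p-2) N^(-p)`, so this piece is controlled by `h / N`,
where `h = φ² M^((p-2)/2) N^(1-p)`. Where `ε|φ| > v` they are at most a constant times `ε^(-2) g^q`,
where `g = (εφ)² M^(-1/2)`. Bounds on `h` in `L¹` and `L^(n/(n-1))` prevent concentration, and the
spare factor `1/N` prevents escape to infinity. A bound `O(ε^(2/p))` on `g` in `L^q` makes `ε^(-2) ∫
g^q = O(ε^(2(q/p-1)))` vanish in the limit.

A priori bounds. All three are proved for test functions in terms of the energy. Integrating the
divergence of `h(x) x` gives a Hardy inequality `∫ h ≤ C E` (`lintegral_hardyDensity_le`). The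
pointwise bound `|Dh| ≤ C (h + e)`, with `e` the energy density, together with the `W^{1,1}` Sobolev
inequality, gives the `L^(n/(n-1))` bound (`eLpNorm_hardyDensity_le`). The bound `|Dg|^p ≤ C ε² (h +
e)` and the `W^{1,p}` Sobolev inequality give the bound on `g` (`eLpNorm_excessDensity_le`). They
pass to the whole space by density and lower semicontinuity (`HomSobolev.Realizes.apriori`).

Compactness. Up to an error tending to zero in `L^p`, the gradients are the fixed function
`w^((2-p)/2)` times a bounded sequence of `L²`; weak compactness in the Hilbert space `L²` therefore
yields weak convergence in `Ẇ^{1,p}` (`HomSobolev.exists_weak_subseq`). Averaging over small balls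
upgrades this to local `L¹` convergence, hence to a.e. convergence along a subsequence
(`HomSobolev.exists_ae_subseq`). The integrals then converge by dominated convergence with a small
remainder (`tendsto_functional`). -/

theorem rpow_le_two_mul_energy {p ε y w : ℝ} (hp1 : 1 < p) (hp2 : p < 2) (hε : 0 < ε) (hy : 0 < y)
    (hw : 0 ≤ w) (h : w ≤ ε * y) : ε ^ (p - 2) * y ^ p ≤ 2 * ((w + ε * y) ^ (p - 2) * y ^ 2) := by
  have hd : 0 < ε * y := mul_pos hε hy
  have h1 : (2 * (ε * y)) ^ (p - 2) ≤ (w + ε * y) ^ (p - 2) :=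
    Real.rpow_le_rpow_of_nonpos (by positivity) (by linarith) (by linarith)
  have h2 : (1 : ℝ) / 2 ≤ 2 ^ (p - 2) := by
    have := Real.rpow_le_rpow_of_exponent_le (x := 2) (by norm_num) (show (-1 : ℝ) ≤ p - 2 by linarith)
    rw [Real.rpow_neg_one] at this
    linarith
  rw [Real.mul_rpow (by norm_num) hd.le, Real.mul_rpow hε.le hy.le] at h1
  have h3 : y ^ p = y ^ (p - 2) * y ^ 2 := by
    rw [← Real.rpow_natCast y 2, ← Real.rpow_add hy]; norm_num
  rw [h3]
  have h4 : 0 ≤ ε ^ (p - 2) * y ^ (p - 2) := by positivity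
  have h5 : ε ^ (p - 2) * y ^ (p - 2) ≤ 2 * (w + ε * y) ^ (p - 2) := by nlinarith
  nlinarith [mul_le_mul_of_nonneg_right h5 (sq_nonneg y)]

/-- Counterpart of the previous bound: the energy density behaves like `w^(p-2) y²` where `ε y ≤ w`
and like `ε^(p-2) y^p` where `ε y ≥ w`. The sum `w + ε y` is at most twice the larger term, and
`2^(p-2) ≥ 1/2` costs the factor `2`. Nearly every later estimate splits along this dichotomy. -/
theorem weight_mul_sq_le_two_mul_energy {p ε y w : ℝ} (hp1 : 1 < p) (hp2 : p < 2) (hε : 0 < ε)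
    (hy : 0 ≤ y) (hw : 0 < w) (h : ε * y ≤ w) :
    w ^ (p - 2) * y ^ 2 ≤ 2 * ((w + ε * y) ^ (p - 2) * y ^ 2) := by
  have h1 : (2 * w) ^ (p - 2) ≤ (w + ε * y) ^ (p - 2) :=
    Real.rpow_le_rpow_of_nonpos (by positivity) (by linarith) (by linarith)
  have h2 : (1 : ℝ) / 2 ≤ 2 ^ (p - 2) := by
    have := Real.rpow_le_rpow_of_exponent_le (x := 2) (by norm_num) (show (-1 : ℝ) ≤ p - 2 by linarith)
    rw [Real.rpow_neg_one] at this
    linarith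
  rw [Real.mul_rpow (by norm_num) hw.le] at h1
  have h4 : 0 ≤ w ^ (p - 2) := by positivity
  have h5 : w ^ (p - 2) ≤ 2 * (w + ε * y) ^ (p - 2) := by nlinarith
  nlinarith [mul_le_mul_of_nonneg_right h5 (sq_nonneg y)]

/-- A Young inequality adapted to the two regimes of the energy; it lets the cross term in the
derivative of the Hardy density be absorbed. Here `v, w, m, T` stand for the bubble, `|Dv|`, `√M`
and `N^(1-p)`, and `ρ` will be `1` or `|x|`. The balance `hb` serves the quadratic regime and `hc`
the `p`-growth regime. -/
theorem cross_term_le {p ε s y v w m T ρ K δ : ℝ} (hp1 : 1 < p) (hp2 : p < 2) (hε : 0 < ε)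
    (hs : 0 ≤ s) (hy : 0 ≤ y) (hv : 0 < v) (hw : 0 ≤ w) (hvm : v ≤ m) (hsm : ε * s ≤ m)
    (hT : 0 < T) (hρ : 0 ≤ ρ) (hδ : 0 < δ) (hK : 0 ≤ K)
    (hb : ρ ^ 2 * v ^ (p - 2) * T * w ^ (2 - p) ≤ K) (hc : ρ ^ p * T ≤ 1) :
    s * m ^ (p - 2) * T * (ρ * y) ≤ δ * (s ^ 2 * m ^ (p - 2) * T)
      + (2 * K / δ + 2 * δ ^ (1 - p)) * ((w + ε * y) ^ (p - 2) * y ^ 2) := by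
  have hm : 0 < m := hv.trans_le hvm
  have hA : 0 ≤ (w + ε * y) ^ (p - 2) * y ^ 2 := by positivity
  have hδp : 0 < δ ^ (1 - p) := by positivity
  have hmp : 0 < m ^ (p - 2) := by positivity
  by_cases h1 : ρ * y ≤ δ * s
  · have : s * m ^ (p - 2) * T * (ρ * y) ≤ s * m ^ (p - 2) * T * (δ * s) := by gcongr
    have h2 : 0 ≤ (2 * K / δ + 2 * δ ^ (1 - p)) * ((w + ε * y) ^ (p - 2) * y ^ 2) := by positivity
    nlinarith
  push Not at h1
  -- From here on `s` is dominated by the gradient, so everything can be charged to the energy term.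
  have hs' : s ≤ ρ * y / δ := by rw [le_div_iff₀ hδ]; linarith
  have hh : 0 ≤ δ * (s ^ 2 * m ^ (p - 2) * T) := by positivity
  rcases hs.eq_or_lt with rfl | hs0
  · have : 0 ≤ (2 * K / δ + 2 * δ ^ (1 - p)) * ((w + ε * y) ^ (p - 2) * y ^ 2) := by positivity
    simp only [zero_mul]; positivity
  have hy0 : 0 < y := by
    rcases hy.eq_or_lt with rfl | h
    · nlinarith [mul_pos hδ hs0]
    · exact h
  by_cases h2 : ε * y ≤ w
  · have hw0 : 0 < w := (mul_pos hε hy0).trans_le h2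
    have e1 := weight_mul_sq_le_two_mul_energy hp1 hp2 hε hy hw0 h2
    have e2 : m ^ (p - 2) ≤ v ^ (p - 2) := Real.rpow_le_rpow_of_nonpos hv hvm (by linarith)
    have e3 : ρ ^ 2 * v ^ (p - 2) * T ≤ K * w ^ (p - 2) := by
      have : w ^ (2 - p) * w ^ (p - 2) = 1 := by
        rw [← Real.rpow_add hw0]; norm_num
      have hwp : 0 < w ^ (p - 2) := by positivity
      calc ρ ^ 2 * v ^ (p - 2) * T = ρ ^ 2 * v ^ (p - 2) * T * (w ^ (2 - p) * w ^ (p - 2)) := by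
            rw [this, mul_one]
        _ = (ρ ^ 2 * v ^ (p - 2) * T * w ^ (2 - p)) * w ^ (p - 2) := by ring
        _ ≤ _ := by gcongr
    calc s * m ^ (p - 2) * T * (ρ * y) ≤ (ρ * y / δ) * v ^ (p - 2) * T * (ρ * y) := by gcongr
      _ = (ρ ^ 2 * v ^ (p - 2) * T) * (y ^ 2 / δ) := by ring
      _ ≤ (K * w ^ (p - 2)) * (y ^ 2 / δ) := by gcongr
      _ = (K / δ) * (w ^ (p - 2) * y ^ 2) := by ring
      _ ≤ (K / δ) * (2 * ((w + ε * y) ^ (p - 2) * y ^ 2)) := by gcongr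
      _ ≤ _ := by
        have : 0 ≤ 2 * δ ^ (1 - p) * ((w + ε * y) ^ (p - 2) * y ^ 2) := by positivity
        have e : (K / δ) * (2 * ((w + ε * y) ^ (p - 2) * y ^ 2))
          = 2 * K / δ * ((w + ε * y) ^ (p - 2) * y ^ 2) := by ring
        rw [e, add_mul]; linarith
  · push Not at h2
    have e1 := rpow_le_two_mul_energy hp1 hp2 hε hy0 hw h2.le
    have e2 : m ^ (p - 2) ≤ (ε * s) ^ (p - 2) :=
      Real.rpow_le_rpow_of_nonpos (by positivity) hsm (by linarith)
    have e3 : s * (ε * s) ^ (p - 2) = ε ^ (p - 2) * s ^ (p - 1) := by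
      rw [Real.mul_rpow hε.le hs, show p - 1 = (p - 2) + 1 by ring, Real.rpow_add_one hs0.ne']; ring
    have hρ0 : 0 < ρ := by
      rcases hρ.eq_or_lt with rfl | h
      · nlinarith [mul_pos hδ hs0]
      · exact h
    have e4 : s ^ (p - 1) ≤ (ρ * y / δ) ^ (p - 1) := Real.rpow_le_rpow hs hs' (by linarith)
    have e5 : (ρ * y / δ) ^ (p - 1) * (ρ * y) = δ ^ (1 - p) * (ρ ^ p * y ^ p) := by
      rw [Real.div_rpow (by positivity) hδ.le, show 1 - p = -(p - 1) by ring, Real.rpow_neg hδ.le,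
        ← Real.mul_rpow hρ hy, show p = (p - 1) + 1 by ring, Real.rpow_add_one (by positivity)]
      ring_nf
    calc s * m ^ (p - 2) * T * (ρ * y) ≤ s * (ε * s) ^ (p - 2) * T * (ρ * y) := by gcongr
      _ = ε ^ (p - 2) * s ^ (p - 1) * T * (ρ * y) := by rw [e3]
      _ ≤ ε ^ (p - 2) * (ρ * y / δ) ^ (p - 1) * T * (ρ * y) := by gcongr
      _ = ε ^ (p - 2) * T * ((ρ * y / δ) ^ (p - 1) * (ρ * y)) := by ring
      _ = δ ^ (1 - p) * (ε ^ (p - 2) * y ^ p) * (ρ ^ p * T) := by rw [e5]; ring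
      _ ≤ δ ^ (1 - p) * (ε ^ (p - 2) * y ^ p) * 1 := by gcongr
      _ ≤ δ ^ (1 - p) * (2 * ((w + ε * y) ^ (p - 2) * y ^ 2)) := by rw [mul_one]; gcongr
      _ ≤ _ := by
        have : 0 ≤ 2 * K / δ * ((w + ε * y) ^ (p - 2) * y ^ 2) := by positivity
        rw [add_mul]; linarith

theorem add_rpow_le_four_mul {p X Y : ℝ} (hp1 : 1 < p) (hp2 : p < 2) (hX : 0 ≤ X) (hY : 0 ≤ Y) :
    (X + Y) ^ p ≤ 4 * (X ^ p + Y ^ p) := by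
  have h2 : (2 : ℝ) ^ p ≤ 4 := by
    have := Real.rpow_le_rpow_of_exponent_le (x := 2) (by norm_num) hp2.le
    norm_num at this ⊢; exact this
  have hXp : 0 ≤ X ^ p := by positivity
  have hYp : 0 ≤ Y ^ p := by positivity
  rcases le_total X Y with h | h
  · calc (X + Y) ^ p ≤ (2 * Y) ^ p := by gcongr; linarith
      _ = 2 ^ p * Y ^ p := Real.mul_rpow (by norm_num) hY
      _ ≤ 4 * Y ^ p := by gcongr
      _ ≤ _ := by linarith
  · calc (X + Y) ^ p ≤ (2 * X) ^ p := by gcongr; linarith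
      _ = 2 ^ p * X ^ p := Real.mul_rpow (by norm_num) hX
      _ ≤ 4 * X ^ p := by gcongr
      _ ≤ _ := by linarith

/-- The energy density is increasing in `s` and at most quadruples when `s` doubles; if `s' > 2s`,
then `s' ≤ 2d`, and the energy is at most `ε^(p-2) s'^p`. This keeps the energy bounded along an
approximation converging in `L^p`. -/
theorem energy_le_four_mul_add {p ε t s s' d : ℝ} (hp1 : 1 < p) (hp2 : p < 2) (hε : 0 < ε)
    (ht : 0 ≤ t) (hs : 0 ≤ s) (hs' : 0 ≤ s') (hd : s' - s ≤ d) (hd0 : 0 ≤ d) :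
    (t + ε * s') ^ (p - 2) * s' ^ 2 ≤
      4 * ((t + ε * s) ^ (p - 2) * s ^ 2) + 4 * (ε ^ (p - 2) * d ^ p) := by
  have hA : 0 ≤ (t + ε * s) ^ (p - 2) * s ^ 2 := by positivity
  have hB : 0 ≤ ε ^ (p - 2) * d ^ p := by positivity
  rcases hs'.eq_or_lt with rfl | hs'0
  · norm_num; positivity
  by_cases h : s' ≤ 2 * s
  · have hs0 : 0 < s := by linarith
    by_cases h1 : s ≤ s'
    · have : (t + ε * s') ^ (p - 2) ≤ (t + ε * s) ^ (p - 2) :=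
        Real.rpow_le_rpow_of_nonpos (by positivity) (by gcongr) (by linarith)
      calc (t + ε * s') ^ (p - 2) * s' ^ 2 ≤ (t + ε * s) ^ (p - 2) * (2 * s) ^ 2 := by gcongr
        _ = 4 * ((t + ε * s) ^ (p - 2) * s ^ 2) := by ring
        _ ≤ _ := by linarith
    · push Not at h1
      have key : (t + ε * s') ^ (p - 2) * s' ^ 2 ≤ (t + ε * s) ^ (p - 2) * s ^ 2 := by
        have a1 : 0 < t + ε * s' := by positivity
        have a2 : 0 < t + ε * s := by positivity
        have e1 : (t + ε * s') ^ (p - 2) = (t + ε * s') ^ p / (t + ε * s') ^ 2 := by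
          rw [Real.rpow_sub a1]; norm_num
        have e2 : (t + ε * s) ^ (p - 2) = (t + ε * s) ^ p / (t + ε * s) ^ 2 := by
          rw [Real.rpow_sub a2]; norm_num
        have e3 : s' / (t + ε * s') ≤ s / (t + ε * s) := by
          rw [div_le_div_iff₀ a1 a2]; nlinarith
        calc (t + ε * s') ^ (p - 2) * s' ^ 2 = (t + ε * s') ^ p * (s' / (t + ε * s')) ^ 2 := by
              rw [e1, div_pow, div_mul_eq_mul_div, mul_div_assoc]
          _ ≤ (t + ε * s) ^ p * (s / (t + ε * s)) ^ 2 := by gcongr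
          _ = _ := by rw [e2, div_pow, div_mul_eq_mul_div, mul_div_assoc]
      linarith
  · push Not at h
    have e1 : (t + ε * s') ^ (p - 2) ≤ (ε * s') ^ (p - 2) :=
      Real.rpow_le_rpow_of_nonpos (by positivity) (by linarith) (by linarith)
    have e2 : s' ≤ 2 * d := by linarith
    have h2 : (2 : ℝ) ^ p ≤ 4 := by
      have := Real.rpow_le_rpow_of_exponent_le (x := 2) (by norm_num) hp2.le
      norm_num at this ⊢; exact this
    calc (t + ε * s') ^ (p - 2) * s' ^ 2 ≤ (ε * s') ^ (p - 2) * s' ^ 2 := by gcongr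
      _ = ε ^ (p - 2) * s' ^ p := by
        rw [Real.mul_rpow hε.le hs', mul_assoc, ← Real.rpow_natCast s' 2, ← Real.rpow_add hs'0]
        norm_num
      _ ≤ ε ^ (p - 2) * (2 * d) ^ p := by gcongr
      _ = 2 ^ p * (ε ^ (p - 2) * d ^ p) := by rw [Real.mul_rpow (by norm_num) hd0]; ring
      _ ≤ 4 * (ε ^ (p - 2) * d ^ p) := by gcongr
      _ ≤ _ := by linarith

/-- The left side bounds `|Dg|^p` for the excess density `g`. The gain of `ε²` comes from the ratio
`τ = ε s / m ≤ 1`: it enters at least to first order, and `τ² m^p` equals `ε² s² m^(p-2)`. -/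
theorem truncation_gradient_rpow_le {p ε s y v w m T K : ℝ} (hp1 : 1 < p) (hp2 : p < 2) (hε : 0 < ε)
    (hs : 0 ≤ s) (hy : 0 ≤ y) (hv : 0 < v) (hw : 0 ≤ w) (hvm : v ≤ m) (hsm : ε * s ≤ m)
    (hT : 0 < T) (hK : 0 ≤ K) (hb : w ^ p ≤ K * (v ^ p * T)) :
    (2 * (ε * s / m) * (ε * y) + (ε * s) ^ 2 * v / m ^ 3 * w) ^ p ≤
      (20 * K + 32) * ε ^ 2 * (s ^ 2 * m ^ (p - 2) * T + (w + ε * y) ^ (p - 2) * y ^ 2) := by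
  have hm : 0 < m := hv.trans_le hvm
  set τ := ε * s / m with hτ
  have hτ0 : 0 ≤ τ := by positivity
  have hτ1 : τ ≤ 1 := by rw [hτ, div_le_one hm]; exact hsm
  set A := (w + ε * y) ^ (p - 2) * y ^ 2 with hAdef
  have hA : 0 ≤ A := by positivity
  set H := s ^ 2 * m ^ (p - 2) * T with hHdef
  have hH : 0 ≤ H := by positivity
  have h2 : (2 : ℝ) ^ p ≤ 4 := by
    have := Real.rpow_le_rpow_of_exponent_le (x := 2) (by norm_num) hp2.le
    norm_num at this ⊢; exact this
  have e0 : τ ^ 2 * w ^ p ≤ K * (ε ^ 2 * H) := by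
    have : v ^ p ≤ m ^ p := by gcongr
    have e : m ^ (p - 2) = m ^ p / m ^ 2 := by rw [Real.rpow_sub hm]; norm_num
    calc τ ^ 2 * w ^ p ≤ τ ^ 2 * (K * (m ^ p * T)) := by gcongr; exact hb.trans (by gcongr)
      _ = _ := by rw [hHdef, hτ, e]; ring
  have hY : ((ε * s) ^ 2 * v / m ^ 3 * w) ^ p ≤ K * (ε ^ 2 * H) := by
    have e1 : (ε * s) ^ 2 * v / m ^ 3 ≤ τ ^ 2 := by
      rw [hτ, div_pow, div_le_div_iff₀ (by positivity) (by positivity)]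
      have : (ε * s) ^ 2 * v ≤ (ε * s) ^ 2 * m := by gcongr
      nlinarith [sq_nonneg m, mul_le_mul_of_nonneg_right this (sq_nonneg m)]
    calc ((ε * s) ^ 2 * v / m ^ 3 * w) ^ p ≤ (τ ^ 2 * w) ^ p := by gcongr
      _ = (τ ^ 2) ^ p * w ^ p := Real.mul_rpow (by positivity) hw
      _ ≤ τ ^ 2 * w ^ p := by
        gcongr
        exact Real.rpow_le_self_of_le_one (by positivity) (pow_le_one₀ hτ0 hτ1) hp1.le
      _ ≤ _ := e0
  have hX : (2 * τ * (ε * y)) ^ p ≤ 4 * K * (ε ^ 2 * H) + 8 * (ε ^ 2 * A) := by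
    rcases hy.eq_or_lt with rfl | hy0
    · rw [mul_zero, mul_zero, Real.zero_rpow (by linarith)]; positivity
    have hd : 0 < ε * y := by positivity
    by_cases hc : ε * y ≤ w
    · have hw0 := hd.trans_le hc
      have e1 := weight_mul_sq_le_two_mul_energy hp1 hp2 hε hy hw0 hc
      set l := ε * y / w with hl
      have hl0 : 0 ≤ l := by positivity
      have hl1 : l ≤ 1 := by rw [hl, div_le_one hw0]; exact hc
      have e2 : ε * y = l * w := by rw [hl]; field_simp
      have e3 : w ^ (p - 2) * y ^ 2 * ε ^ 2 = l ^ 2 * w ^ p := by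
        rw [hl, Real.rpow_sub hw0]; norm_num; ring
      calc (2 * τ * (ε * y)) ^ p = 2 ^ p * (τ * l) ^ p * w ^ p := by
            rw [e2, show 2 * τ * (l * w) = 2 * (τ * l) * w by ring,
              Real.mul_rpow (by positivity) hw, Real.mul_rpow (by norm_num) (by positivity)]
        _ ≤ 4 * (τ * l) * w ^ p := by
          gcongr
          exact Real.rpow_le_self_of_le_one (by positivity) (mul_le_one₀ hτ1 hl0 hl1) hp1.le
        -- Both ratios are at most one, so the power `p` of `τ l` can be lowered to `1`; the product
        -- then splits into `τ² w^p`, charged to `H`, and `l² w^p = ε² w^(p-2) y²`, charged to the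
        -- energy.
        _ ≤ 4 * (τ ^ 2 + l ^ 2) * w ^ p := by gcongr; nlinarith [sq_nonneg (τ - l)]
        _ = 4 * (τ ^ 2 * w ^ p) + 4 * ε ^ 2 * (w ^ (p - 2) * y ^ 2) := by
          linear_combination (-4) * e3
        _ ≤ 4 * (K * (ε ^ 2 * H)) + 4 * ε ^ 2 * (2 * A) := by gcongr
        _ = _ := by ring
    · push Not at hc
      have e1 := rpow_le_two_mul_energy hp1 hp2 hε hy0 hw hc.le
      have e2 : (ε * y) ^ p = ε ^ 2 * (ε ^ (p - 2) * y ^ p) := by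
        rw [Real.mul_rpow hε.le hy, Real.rpow_sub hε]; norm_num; field_simp
      calc (2 * τ * (ε * y)) ^ p ≤ (2 * 1 * (ε * y)) ^ p := by gcongr
        _ = 2 ^ p * (ε * y) ^ p := by rw [mul_one, Real.mul_rpow (by norm_num) hd.le]
        _ ≤ 4 * (ε ^ 2 * (2 * A)) := by rw [e2]; gcongr
        _ ≤ _ := by
          have : 0 ≤ 4 * K * (ε ^ 2 * H) := by positivity
          linarith
  have hsum := add_rpow_le_four_mul hp1 hp2 (show 0 ≤ 2 * τ * (ε * y) by positivity)
    (show 0 ≤ (ε * s) ^ 2 * v / m ^ 3 * w by positivity)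
  have f1 : 0 ≤ K * (ε ^ 2 * A) := by positivity
  have f2 : 0 ≤ ε ^ 2 * H := by positivity
  nlinarith

/-! ### The bubble and its weight -/

/-- The weight `1 + |x|^(p/(p-1))`. -/
noncomputable def bubbleWeight {n : ℕ} (p : ℝ) (x : Euc n) : ℝ := 1 + ‖x‖ ^ (p / (p - 1))

/-- The derivative of `bubbleWeight`. -/
noncomputable def bubbleWeightDeriv {n : ℕ} (p : ℝ) (x : Euc n) : Euc n →L[ℝ] ℝ :=
  (p / (p - 1) * ‖x‖ ^ (p / (p - 1) - 2)) • innerSL ℝ x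

theorem norm_gradient_eq {n : ℕ} (u : Euc n → ℝ) (x : Euc n) : ‖∇ u x‖ = ‖fderiv ℝ u x‖ := by
  rw [gradient, LinearIsometryEquiv.norm_map]

section Weight

variable {n : ℕ} {p a₀ : ℝ}

theorem one_lt_conj (hp1 : 1 < p) : 1 < p / (p - 1) := by
  rw [lt_div_iff₀ (by linarith)]; linarith

theorem one_le_bubbleWeight (x : Euc n) : 1 ≤ bubbleWeight p x := by
  unfold bubbleWeight
  have : 0 ≤ ‖x‖ ^ (p / (p - 1)) := by positivity
  linarith

theorem bubbleWeight_pos (x : Euc n) : 0 < bubbleWeight p x :=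
  one_pos.trans_le (one_le_bubbleWeight x)

theorem hasFDerivAt_bubbleWeight (hp1 : 1 < p) (x : Euc n) :
    HasFDerivAt (bubbleWeight p) (bubbleWeightDeriv p x) x :=
  (hasFDerivAt_norm_rpow x (one_lt_conj hp1)).const_add 1

theorem contDiff_bubbleWeight (hp1 : 1 < p) : ContDiff ℝ 1 (bubbleWeight (n := n) p) :=
  contDiff_const.add (contDiff_norm_rpow (one_lt_conj hp1))

theorem bubbleWeightDeriv_self (hp1 : 1 < p) (x : Euc n) :
    bubbleWeightDeriv p x x = p / (p - 1) * ‖x‖ ^ (p / (p - 1)) := by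
  have h := one_lt_conj hp1
  rcases eq_or_ne x 0 with rfl | hx
  · simp [Real.zero_rpow (show p / (p - 1) ≠ 0 by linarith)]
  · have hx' : 0 < ‖x‖ := norm_pos_iff.2 hx
    simp only [bubbleWeightDeriv, smul_apply, innerSL_apply_apply, smul_eq_mul,
      real_inner_self_eq_norm_sq]
    rw [Real.rpow_sub hx', mul_assoc]
    norm_num
    field_simp
    exact Or.inl trivial

theorem norm_bubbleWeightDeriv (hp1 : 1 < p) (x : Euc n) :
    ‖bubbleWeightDeriv p x‖ = p / (p - 1) * ‖x‖ ^ (p / (p - 1) - 1) := by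
  rw [← norm_fderiv_norm_id_rpow x (one_lt_conj hp1), fderiv_norm_rpow x (one_lt_conj hp1)]
  rfl

theorem rpow_conj_sub_one_le (hp1 : 1 < p) (x : Euc n) :
    ‖x‖ ^ (p / (p - 1) - 1) ≤ bubbleWeight p x := by
  have h := one_lt_conj hp1
  rcases le_total ‖x‖ 1 with h1 | h1
  · exact (Real.rpow_le_one (norm_nonneg _) h1 (by linarith)).trans (one_le_bubbleWeight x)
  · have := Real.rpow_le_rpow_of_exponent_le h1 (show p / (p - 1) - 1 ≤ p / (p - 1) by linarith)
    unfold bubbleWeight; linarith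

theorem bubble_eq (x : Euc n) :
    bubble n p a₀ x = a₀ * bubbleWeight p x ^ (-((n - p) / p)) := by
  rw [Real.rpow_neg (bubbleWeight_pos x).le]; rfl

theorem bubble_pos (ha : 0 < a₀) (x : Euc n) : 0 < bubble n p a₀ x := by
  rw [bubble_eq]; have := bubbleWeight_pos (p := p) x; positivity

theorem hasFDerivAt_bubble (hp1 : 1 < p) (x : Euc n) :
    HasFDerivAt (bubble n p a₀)
      ((-((n - p) / p) * (bubble n p a₀ x / bubbleWeight p x)) • bubbleWeightDeriv p x) x := by
  have h := ((hasFDerivAt_bubbleWeight hp1 x).rpow_const (p := -((n - p) / p))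
    (Or.inl (bubbleWeight_pos x).ne')).const_mul a₀
  have e : bubble n p a₀ = fun x => a₀ * bubbleWeight p x ^ (-((n - p) / p)) := funext bubble_eq
  rw [e]
  refine h.congr_fderiv ?_
  rw [smul_smul, Real.rpow_sub_one (bubbleWeight_pos x).ne']
  congr 1
  ring

theorem contDiff_bubble (hp1 : 1 < p) : ContDiff ℝ 1 (bubble n p a₀) := by
  have e : bubble n p a₀ = fun x => a₀ * bubbleWeight p x ^ (-((n - p) / p)) := funext bubble_eq
  rw [e]
  exact contDiff_const.mul ((contDiff_bubbleWeight hp1).rpow_const_of_ne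
    fun x => (bubbleWeight_pos x).ne')

theorem norm_gradient_bubble (hp1 : 1 < p) (hpn : p < n) (ha : 0 < a₀) (x : Euc n) :
    ‖∇ (bubble n p a₀) x‖ =
      (n - p) / (p - 1) * bubble n p a₀ x * (‖x‖ ^ (p / (p - 1) - 1) / bubbleWeight p x) := by
  have hN := bubbleWeight_pos (p := p) x
  have hv := bubble_pos (p := p) ha x
  have h1 : 0 < p - 1 := by linarith
  have h2 : 0 < (n : ℝ) - p := by linarith
  rw [norm_gradient_eq, (hasFDerivAt_bubble hp1 x).fderiv, norm_smul, norm_bubbleWeightDeriv hp1,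
    norm_mul, norm_neg, Real.norm_of_nonneg (by positivity), Real.norm_of_nonneg (by positivity)]
  field_simp

theorem norm_rpow_mul_bubbleWeight_le (hp1 : 1 < p) (x : Euc n) :
    ‖x‖ ^ p * bubbleWeight p x ^ (1 - p) ≤ 1 := by
  have hN := bubbleWeight_pos (p := p) x
  have h1 : 0 < p - 1 := by linarith
  rw [show 1 - p = -(p - 1) by ring, Real.rpow_neg hN.le, ← div_eq_mul_inv, div_le_one (by positivity)]
  calc ‖x‖ ^ p = (‖x‖ ^ (p / (p - 1))) ^ (p - 1) := by
        rw [← Real.rpow_mul (norm_nonneg _), div_mul_cancel₀ _ h1.ne']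
    _ ≤ _ := by
      gcongr
      unfold bubbleWeight; linarith

theorem bubbleWeight_rpow_le_one (hp1 : 1 < p) (x : Euc n) :
    bubbleWeight p x ^ (1 - p) ≤ 1 :=
  Real.rpow_le_one_of_one_le_of_nonpos (one_le_bubbleWeight x) (by linarith)

theorem norm_gradient_bubble_rpow (hp1 : 1 < p) (hpn : p < n) (ha : 0 < a₀) (s : ℝ) (x : Euc n) :
    ‖∇ (bubble n p a₀) x‖ ^ s = ((n - p) / (p - 1)) ^ s * bubble n p a₀ x ^ s *
      (‖x‖ ^ (p / (p - 1) - 1) / bubbleWeight p x) ^ s := by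
  have hN := bubbleWeight_pos (p := p) x
  have hv := bubble_pos (p := p) ha x
  have h1 : 0 < p - 1 := by linarith
  have h2 : 0 < (n : ℝ) - p := by linarith
  rw [norm_gradient_bubble hp1 hpn ha, Real.mul_rpow (by positivity) (by positivity),
    Real.mul_rpow (by positivity) (by positivity)]

/-- Since `|Dv|` is a constant times `v |x|^(p/(p-1)-1) / N`, all powers of `v` cancel and the
remaining factors are at most one. This is hypothesis `hb` of `cross_term_le` with `ρ = 1`. -/
theorem weight_balance_one (hp1 : 1 < p) (hp2 : p < 2) (hpn : p < n) (ha : 0 < a₀) (x : Euc n) :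
    bubble n p a₀ x ^ (p - 2) * bubbleWeight p x ^ (1 - p) * ‖∇ (bubble n p a₀) x‖ ^ (2 - p) ≤
      ((n - p) / (p - 1)) ^ (2 - p) := by
  have hN := bubbleWeight_pos (p := p) x
  have hv := bubble_pos (p := p) ha x
  have h1 : 0 < p - 1 := by linarith
  have h2 : 0 < (n : ℝ) - p := by linarith
  rw [norm_gradient_bubble_rpow hp1 hpn ha]
  have e : bubble n p a₀ x ^ (p - 2) * bubble n p a₀ x ^ (2 - p) = 1 := by
    rw [← Real.rpow_add hv]; norm_num
  have h3 : ‖x‖ ^ (p / (p - 1) - 1) / bubbleWeight p x ≤ 1 := by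
    rw [div_le_one hN]; exact rpow_conj_sub_one_le hp1 x
  have h4 : (‖x‖ ^ (p / (p - 1) - 1) / bubbleWeight p x) ^ (2 - p) ≤ 1 :=
    Real.rpow_le_one (by positivity) h3 (by linarith)
  calc _ = ((n - p) / (p - 1)) ^ (2 - p) * (bubble n p a₀ x ^ (p - 2) * bubble n p a₀ x ^ (2 - p)) *
        (bubbleWeight p x ^ (1 - p) * (‖x‖ ^ (p / (p - 1) - 1) / bubbleWeight p x) ^ (2 - p)) := by ring
    _ ≤ ((n - p) / (p - 1)) ^ (2 - p) * 1 * (1 * 1) := by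
      rw [e]; gcongr; exact bubbleWeight_rpow_le_one hp1 x
    _ = _ := by ring

/-- The case `ρ = |x|`. The exponents match exactly, because `2 + (p/(p-1) - 1)(2-p) = p/(p-1)`:
what remains is `|x|^(p/(p-1)) / N ≤ 1`. -/
theorem weight_balance_norm (hp1 : 1 < p) (hp2 : p < 2) (hpn : p < n) (ha : 0 < a₀) (x : Euc n) :
    ‖x‖ ^ 2 * bubble n p a₀ x ^ (p - 2) * bubbleWeight p x ^ (1 - p) *
      ‖∇ (bubble n p a₀) x‖ ^ (2 - p) ≤ ((n - p) / (p - 1)) ^ (2 - p) := by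
  have hN := bubbleWeight_pos (p := p) x
  have hv := bubble_pos (p := p) ha x
  have h1 : 0 < p - 1 := by linarith
  have h2 : 0 < (n : ℝ) - p := by linarith
  rcases eq_or_ne x 0 with rfl | hx
  · simp; positivity
  have hx' : 0 < ‖x‖ := norm_pos_iff.2 hx
  rw [norm_gradient_bubble_rpow hp1 hpn ha]
  have e : bubble n p a₀ x ^ (p - 2) * bubble n p a₀ x ^ (2 - p) = 1 := by
    rw [← Real.rpow_add hv]; norm_num
  have e2 : ‖x‖ ^ 2 * (bubbleWeight p x ^ (1 - p) *
      (‖x‖ ^ (p / (p - 1) - 1) / bubbleWeight p x) ^ (2 - p)) =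
      ‖x‖ ^ (p / (p - 1)) / bubbleWeight p x := by
    rw [Real.div_rpow (by positivity) hN.le, ← Real.rpow_mul hx'.le, ← Real.rpow_natCast ‖x‖ 2]
    have a1 : ‖x‖ ^ (((2 : ℕ) : ℝ)) * ‖x‖ ^ ((p / (p - 1) - 1) * (2 - p)) = ‖x‖ ^ (p / (p - 1)) := by
      rw [← Real.rpow_add hx']; congr 1; push_cast; field_simp; ring
    have a2 : bubbleWeight p x ^ (1 - p) / bubbleWeight p x ^ (2 - p) = (bubbleWeight p x)⁻¹ := by
      rw [← Real.rpow_sub hN, ← Real.rpow_neg_one]; congr 1; ring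
    calc _ = (‖x‖ ^ (((2 : ℕ) : ℝ)) * ‖x‖ ^ ((p / (p - 1) - 1) * (2 - p))) *
          (bubbleWeight p x ^ (1 - p) / bubbleWeight p x ^ (2 - p)) := by ring
      _ = _ := by rw [a1, a2]; exact (div_eq_mul_inv _ _).symm
  have e3 : ‖x‖ ^ (p / (p - 1)) / bubbleWeight p x ≤ 1 := by
    rw [div_le_one hN]; unfold bubbleWeight; linarith
  calc _ = ((n - p) / (p - 1)) ^ (2 - p) * (bubble n p a₀ x ^ (p - 2) * bubble n p a₀ x ^ (2 - p)) *
        (‖x‖ ^ 2 * (bubbleWeight p x ^ (1 - p) *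
      (‖x‖ ^ (p / (p - 1) - 1) / bubbleWeight p x) ^ (2 - p))) := by ring
    _ ≤ ((n - p) / (p - 1)) ^ (2 - p) * 1 * 1 := by rw [e, e2]; gcongr
    _ = _ := by ring

theorem norm_gradient_bubble_rpow_le (hp1 : 1 < p) (hpn : p < n) (ha : 0 < a₀) (x : Euc n) :
    ‖∇ (bubble n p a₀) x‖ ^ p ≤
      ((n - p) / (p - 1)) ^ p * (bubble n p a₀ x ^ p * bubbleWeight p x ^ (1 - p)) := by
  have hN := bubbleWeight_pos (p := p) x
  have hv := bubble_pos (p := p) ha x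
  have h1 : 0 < p - 1 := by linarith
  have h2 : 0 < (n : ℝ) - p := by linarith
  rw [norm_gradient_bubble_rpow hp1 hpn ha, mul_assoc]
  gcongr
  rw [Real.div_rpow (by positivity) hN.le, ← Real.rpow_mul (norm_nonneg _), Real.rpow_sub hN,
    Real.rpow_one]
  gcongr
  rw [show (p / (p - 1) - 1) * p = p / (p - 1) by field_simp; ring]
  unfold bubbleWeight; linarith

theorem norm_gradient_bubble_rpow_le_weight (hp1 : 1 < p) (hpn : p < n) (ha : 0 < a₀) (x : Euc n) :
    ‖∇ (bubble n p a₀) x‖ ^ p ≤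
      ((n - p) / (p - 1)) ^ p * a₀ ^ p * bubbleWeight p x ^ (1 - (n : ℝ)) := by
  have hN := bubbleWeight_pos (p := p) x
  refine (norm_gradient_bubble_rpow_le hp1 hpn ha x).trans (le_of_eq ?_)
  rw [bubble_eq, Real.mul_rpow ha.le (by positivity), ← Real.rpow_mul hN.le, mul_assoc, mul_assoc,
    ← Real.rpow_add hN]
  congr 3
  field_simp
  ring

/-- Rests on `v^(q-p) = a₀^(q-p) N^(-p)` with `q = p*`. The weight of the limit integral thus decays
faster by a factor `1/N` than the Hardy weight `v^(p-2) N^(1-p)`; this factor supplies the tightness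
at infinity. -/
theorem bubble_rpow_sobolevExp (hp1 : 1 < p) (hpn : p < n) (ha : 0 < a₀) (x : Euc n) :
    bubble n p a₀ x ^ (sobolevExp n p - 2) * bubbleWeight p x =
      a₀ ^ (sobolevExp n p - p) * (bubble n p a₀ x ^ (p - 2) * bubbleWeight p x ^ (1 - p)) := by
  have hN := bubbleWeight_pos (p := p) x
  have hv := bubble_pos (p := p) ha x
  have h2 : (n : ℝ) - p ≠ 0 := by linarith
  have e : bubble n p a₀ x ^ (sobolevExp n p - 2) =
      bubble n p a₀ x ^ (sobolevExp n p - p) * bubble n p a₀ x ^ (p - 2) := by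
    rw [← Real.rpow_add hv]; congr 1; ring
  have e2 : bubble n p a₀ x ^ (sobolevExp n p - p) =
      a₀ ^ (sobolevExp n p - p) * bubbleWeight p x ^ (-p) := by
    rw [bubble_eq, Real.mul_rpow ha.le (by positivity), ← Real.rpow_mul hN.le]
    congr 2
    unfold sobolevExp
    field_simp
    ring
  rw [e, e2, show 1 - p = -p + 1 by ring, Real.rpow_add_one hN.ne']
  ring

theorem one_add_norm_rpow_le_bubbleWeight (hp1 : 1 < p) (x : Euc n) :
    (1 + ‖x‖) ^ (p / (p - 1)) ≤ 2 ^ (p / (p - 1)) * bubbleWeight p x := by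
  have h := one_lt_conj hp1
  unfold bubbleWeight
  have h0 : 0 ≤ ‖x‖ ^ (p / (p - 1)) := by positivity
  rcases le_total ‖x‖ 1 with h1 | h1
  · calc (1 + ‖x‖) ^ (p / (p - 1)) ≤ 2 ^ (p / (p - 1)) := by gcongr; linarith
      _ ≤ _ := by
        have : (0 : ℝ) ≤ 2 ^ (p / (p - 1)) := by positivity
        nlinarith
  · calc (1 + ‖x‖) ^ (p / (p - 1)) ≤ (2 * ‖x‖) ^ (p / (p - 1)) := by gcongr; linarith
      _ = 2 ^ (p / (p - 1)) * ‖x‖ ^ (p / (p - 1)) := Real.mul_rpow (by norm_num) (norm_nonneg _)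
      _ ≤ _ := by gcongr; linarith

/-- The decay exponent `(n-1) p/(p-1)` exceeds the dimension precisely because `p < n`. -/
theorem integrable_bubbleWeight_rpow (hp1 : 1 < p) (hpn : p < n) :
    Integrable (fun x : Euc n => bubbleWeight p x ^ (1 - (n : ℝ))) := by
  have h := one_lt_conj hp1
  have hn : (1 : ℝ) < n := hp1.trans hpn
  have hint : Integrable (fun x : Euc n => (1 + ‖x‖) ^ (-(p / (p - 1) * (n - 1)))) := by
    apply integrable_one_add_norm
    rw [finrank_euclideanSpace_fin, div_mul_eq_mul_div, lt_div_iff₀ (by linarith)]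
    nlinarith
  refine (hint.const_mul ((2 ^ (p / (p - 1))) ^ ((n : ℝ) - 1))).mono' ?_ ?_
  · have : Continuous (fun x : Euc n => bubbleWeight p x ^ (1 - (n : ℝ))) :=
      (contDiff_bubbleWeight hp1).continuous.rpow_const fun x => Or.inl (bubbleWeight_pos x).ne'
    exact this.aestronglyMeasurable
  · refine Eventually.of_forall fun x => ?_
    have hN := bubbleWeight_pos (p := p) x
    rw [Real.norm_of_nonneg (by positivity)]
    have h1 := one_add_norm_rpow_le_bubbleWeight hp1 x
    have h2 : ((1 + ‖x‖) ^ (p / (p - 1))) ^ ((n : ℝ) - 1) ≤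
        (2 ^ (p / (p - 1)) * bubbleWeight p x) ^ ((n : ℝ) - 1) := by
      gcongr
    rw [Real.mul_rpow (by positivity) hN.le, ← Real.rpow_mul (by positivity)] at h2
    rw [Real.rpow_neg (by positivity), show 1 - (n : ℝ) = -(n - 1) by ring, Real.rpow_neg hN.le,
      ← div_eq_mul_inv, inv_eq_one_div, div_le_div_iff₀ (by positivity) (by positivity), one_mul]
    exact h2

end Weight

/-! ### Densities -/

/-- The quantity `v² + ε² s²`. -/
noncomputable def bubbleMod (n : ℕ) (p a₀ ε s : ℝ) (x : Euc n) : ℝ :=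
  bubble n p a₀ x ^ 2 + (ε * s) ^ 2

/-- The density of the Hardy type functional, a smooth version of
`|s|² (v + ε |s|)^(p-2) (1 + |x|^(p/(p-1)))^(1-p)`. -/
noncomputable def hardyDensity (n : ℕ) (p a₀ ε s : ℝ) (x : Euc n) : ℝ :=
  s ^ 2 * bubbleMod n p a₀ ε s x ^ ((p - 2) / 2) * bubbleWeight p x ^ (1 - p)

/-- A smooth substitute for the excess `(ε |s| - v)₊`. -/
noncomputable def excessDensity (n : ℕ) (p a₀ ε s : ℝ) (x : Euc n) : ℝ :=
  (ε * s) ^ 2 * bubbleMod n p a₀ ε s x ^ (-(1 / 2) : ℝ)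

/-- The density `(|Dv| + ε y)^(p-2) y²` of the energy. -/
noncomputable def energyDensity (n : ℕ) (p a₀ ε y : ℝ) (x : Euc n) : ℝ :=
  (‖∇ (bubble n p a₀) x‖ + ε * y) ^ (p - 2) * y ^ 2

section Densities

variable {n : ℕ} {p a₀ ε : ℝ}

theorem bubbleMod_pos (ha : 0 < a₀) (s : ℝ) (x : Euc n) : 0 < bubbleMod n p a₀ ε s x := by
  have := bubble_pos (p := p) ha x
  unfold bubbleMod; positivity

theorem bubble_le_sqrt_bubbleMod (s : ℝ) (x : Euc n) :
    bubble n p a₀ x ≤ √(bubbleMod n p a₀ ε s x) :=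
  Real.le_sqrt_of_sq_le (by unfold bubbleMod; nlinarith [sq_nonneg (ε * s)])

theorem mul_abs_le_sqrt_bubbleMod (s : ℝ) (x : Euc n) :
    ε * |s| ≤ √(bubbleMod n p a₀ ε s x) :=
  Real.le_sqrt_of_sq_le (by
    unfold bubbleMod; rw [mul_pow, mul_pow, sq_abs]; nlinarith [sq_nonneg (bubble n p a₀ x)])

theorem bubbleMod_rpow_half (ha : 0 < a₀) (s t : ℝ) (x : Euc n) :
    bubbleMod n p a₀ ε s x ^ (t / 2) = √(bubbleMod n p a₀ ε s x) ^ t := by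
  rw [Real.sqrt_eq_rpow, ← Real.rpow_mul (bubbleMod_pos ha s x).le]; congr 1; ring

theorem hardyDensity_nonneg (ha : 0 < a₀) (s : ℝ) (x : Euc n) : 0 ≤ hardyDensity n p a₀ ε s x := by
  have := bubbleMod_pos (p := p) (ε := ε) ha s x
  have := bubbleWeight_pos (p := p) x
  unfold hardyDensity; positivity

theorem excessDensity_nonneg (ha : 0 < a₀) (s : ℝ) (x : Euc n) :
    0 ≤ excessDensity n p a₀ ε s x := by
  have := bubbleMod_pos (p := p) (ε := ε) ha s x
  unfold excessDensity; positivity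

theorem energyDensity_nonneg (hε : 0 < ε) {y : ℝ} (hy : 0 ≤ y) (x : Euc n) :
    0 ≤ energyDensity n p a₀ ε y x := by
  unfold energyDensity; positivity

variable {u : Euc n → ℝ} {u' : Euc n →L[ℝ] ℝ} {x : Euc n}

theorem hasFDerivAt_bubbleMod (hp1 : 1 < p) (hu : HasFDerivAt u u' x) :
    HasFDerivAt (fun x => bubbleMod n p a₀ ε (u x) x)
      ((2 * bubble n p a₀ x) • fderiv ℝ (bubble n p a₀) x + (2 * ε ^ 2 * u x) • u') x := by
  have h1 := ((hasFDerivAt_bubble (a₀ := a₀) hp1 x).differentiableAt.hasFDerivAt.pow 2).add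
    ((hu.const_mul ε).pow 2)
  refine h1.congr_fderiv ?_
  ext y
  simp
  ring

/-- The coefficients are arranged around the ratios `(εu)²/M` and `v²/M`, which lie in `[0,1]`. The
derivatives of `v` and of `N` are collected into one multiple of `DN`, as `v` is a power of `N`. -/
theorem hasFDerivAt_hardyDensity (hp1 : 1 < p) (ha : 0 < a₀) (hu : HasFDerivAt u u' x) :
    HasFDerivAt (fun x => hardyDensity n p a₀ ε (u x) x)
      ((u x * bubbleMod n p a₀ ε (u x) x ^ ((p - 2) / 2) * bubbleWeight p x ^ (1 - p) *
          (2 + (p - 2) * ((ε * u x) ^ 2 / bubbleMod n p a₀ ε (u x) x))) • u' +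
        (hardyDensity n p a₀ ε (u x) x / bubbleWeight p x *
          ((2 - p) * ((n - p) / p) * (bubble n p a₀ x ^ 2 / bubbleMod n p a₀ ε (u x) x) - (p - 1))) •
            bubbleWeightDeriv p x) x := by
  have hM := bubbleMod_pos (p := p) (ε := ε) ha (u x) x
  have hN := bubbleWeight_pos (p := p) x
  have h1 := ((hu.pow 2).mul ((hasFDerivAt_bubbleMod (ε := ε) (a₀ := a₀) hp1 hu).rpow_const
    (p := (p - 2) / 2) (Or.inl hM.ne'))).mul ((hasFDerivAt_bubbleWeight hp1 x).rpow_const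
    (p := 1 - p) (Or.inl hN.ne'))
  refine h1.congr_fderiv ?_
  rw [(hasFDerivAt_bubble hp1 x).fderiv, Real.rpow_sub_one hM.ne', Real.rpow_sub_one hN.ne']
  ext y
  simp only [hardyDensity, Pi.mul_apply, smul_add, smul_smul,
    add_apply, smul_apply, smul_eq_mul]
  generalize bubbleMod n p a₀ ε (u x) x ^ ((p - 2) / 2) = A
  generalize bubbleMod n p a₀ ε (u x) x = B at *
  generalize bubbleWeight p x ^ (1 - p) = C
  generalize bubbleWeight p x = D at *
  have : p ≠ 0 := by linarith
  field_simp
  push_cast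
  ring

theorem hasFDerivAt_excessDensity (hp1 : 1 < p) (ha : 0 < a₀) (hu : HasFDerivAt u u' x) :
    HasFDerivAt (fun x => excessDensity n p a₀ ε (u x) x)
      ((bubbleMod n p a₀ ε (u x) x ^ (-(1 / 2) : ℝ) * ε ^ 2 * u x *
          (2 - (ε * u x) ^ 2 / bubbleMod n p a₀ ε (u x) x)) • u' -
        (excessDensity n p a₀ ε (u x) x * bubble n p a₀ x / bubbleMod n p a₀ ε (u x) x) •
            fderiv ℝ (bubble n p a₀) x) x := by
  have hM := bubbleMod_pos (p := p) (ε := ε) ha (u x) x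
  have h1 := ((hu.const_mul ε).pow 2).mul
    ((hasFDerivAt_bubbleMod (ε := ε) (a₀ := a₀) hp1 hu).rpow_const
    (p := (-(1 / 2) : ℝ)) (Or.inl hM.ne'))
  refine h1.congr_fderiv ?_
  rw [Real.rpow_sub_one hM.ne']
  ext y
  simp only [excessDensity, smul_add, smul_smul, add_apply, sub_apply,
    smul_apply, smul_eq_mul]
  generalize bubbleMod n p a₀ ε (u x) x ^ (-(1 / 2) : ℝ) = A
  generalize bubbleMod n p a₀ ε (u x) x = B at *
  field_simp
  push_cast
  ring

theorem contDiff_bubbleMod (hp1 : 1 < p) (hu : ContDiff ℝ 1 u) :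
    ContDiff ℝ 1 (fun x => bubbleMod n p a₀ ε (u x) x) :=
  ((contDiff_bubble hp1).pow 2).add ((contDiff_const.mul hu).pow 2)

theorem contDiff_hardyDensity (hp1 : 1 < p) (ha : 0 < a₀) (hu : ContDiff ℝ 1 u) :
    ContDiff ℝ 1 (fun x => hardyDensity n p a₀ ε (u x) x) :=
  ((hu.pow 2).mul ((contDiff_bubbleMod hp1 hu).rpow_const_of_ne
    fun x => (bubbleMod_pos ha _ x).ne')).mul ((contDiff_bubbleWeight hp1).rpow_const_of_ne
    fun x => (bubbleWeight_pos x).ne')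

theorem contDiff_excessDensity (hp1 : 1 < p) (ha : 0 < a₀) (hu : ContDiff ℝ 1 u) :
    ContDiff ℝ 1 (fun x => excessDensity n p a₀ ε (u x) x) :=
  ((contDiff_const.mul hu).pow 2).mul ((contDiff_bubbleMod hp1 hu).rpow_const_of_ne
    fun x => (bubbleMod_pos ha _ x).ne')

theorem hasCompactSupport_hardyDensity (hu : HasCompactSupport u) :
    HasCompactSupport (fun x => hardyDensity n p a₀ ε (u x) x) :=
  hu.mono' ((Function.support_subset_iff'.2 fun x hx => by
    simp [hardyDensity, image_eq_zero_of_notMem_tsupport hx]))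

theorem hasCompactSupport_excessDensity (hu : HasCompactSupport u) :
    HasCompactSupport (fun x => excessDensity n p a₀ ε (u x) x) :=
  hu.mono' ((Function.support_subset_iff'.2 fun x hx => by
    simp [excessDensity, image_eq_zero_of_notMem_tsupport hx]))

end Densities

/-! ### A priori estimates for test functions -/

/-- The field `f(x) x` has compact support and divergence `n f + Df·x`, so the integral of that
divergence vanishes. -/
theorem integral_fderiv_apply_self {n : ℕ} {f : Euc n → ℝ} (hf : ContDiff ℝ 1 f)
    (hc : HasCompactSupport f) : ∫ x, fderiv ℝ f x x = -(n * ∫ x, f x) := by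
  have hfd : Continuous (fderiv ℝ f) := hf.continuous_fderiv one_ne_zero
  have hd : ∀ i : Fin n, ∀ x : Euc n,
      HasFDerivAt (fun x : Euc n => x i) (EuclideanSpace.proj i : Euc n →L[ℝ] ℝ) x := fun i x =>
    (EuclideanSpace.proj i : Euc n →L[ℝ] ℝ).hasFDerivAt
  have hcs : ∀ i : Fin n, HasCompactSupport
      (fun x : Euc n => fderiv ℝ f x (EuclideanSpace.single i (1 : ℝ))) := fun i =>
    (hc.fderiv (𝕜 := ℝ)).comp_left (g := fun l : Euc n →L[ℝ] ℝ => l (EuclideanSpace.single i 1)) rfl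
  have hcont : ∀ i : Fin n, Continuous
      (fun x : Euc n => fderiv ℝ f x (EuclideanSpace.single i (1 : ℝ))) := fun i =>
    hfd.clm_apply continuous_const
  have hpr : ∀ i : Fin n, Continuous (fun x : Euc n => x i) := fun i =>
    (EuclideanSpace.proj i : Euc n →L[ℝ] ℝ).continuous
  have hint : ∀ i : Fin n, Integrable
      (fun x : Euc n => x i * fderiv ℝ f x (EuclideanSpace.single i (1 : ℝ))) := fun i =>
    ((hpr i).mul (hcont i)).integrable_of_hasCompactSupport ((hcs i).mul_left)
  have hi : ∀ i : Fin n, ∫ x : Euc n, x i * fderiv ℝ f x (EuclideanSpace.single i (1 : ℝ)) =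
      -∫ x, f x := by
    intro i
    have e : ∀ x : Euc n, fderiv ℝ (fun x : Euc n => x i) x (EuclideanSpace.single i (1 : ℝ)) = 1 := by
      intro x
      rw [(hd i x).fderiv]; simp
    rw [integral_mul_fderiv_eq_neg_fderiv_mul_of_integrable]
    · simp only [e, one_mul]
    · simp only [e, one_mul]; exact hf.continuous.integrable_of_hasCompactSupport hc
    · exact hint i
    · exact ((hpr i).mul hf.continuous).integrable_of_hasCompactSupport hc.mul_left
    · exact fun x _ => (hd i x).differentiableAt
    · exact fun x _ => hf.differentiable one_ne_zero x
  have hsum : ∀ x : Euc n, fderiv ℝ f x x =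
      ∑ i, x i * fderiv ℝ f x (EuclideanSpace.single i (1 : ℝ)) := by
    intro x
    have hx : x = ∑ i, x i • EuclideanSpace.single i (1 : ℝ) := by
      ext j; simp [Finset.sum_apply, Pi.single_apply]
    conv_lhs => rw [hx, map_sum]
    simp only [map_smul, smul_eq_mul]
    rw [← hx]
  simp_rw [hsum]
  rw [integral_finsetSum _ fun i _ => hint i]
  simp [hi]

section Estimates

variable {n : ℕ} {p a₀ : ℝ}

/-- The constant relating `|Dv|` and `v`. -/
noncomputable def gradientConst (n : ℕ) (p : ℝ) : ℝ := (n - p) / (p - 1)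

theorem gradientConst_pos (hp1 : 1 < p) (hpn : p < n) : 0 < gradientConst n p := by
  unfold gradientConst; exact div_pos (by linarith) (by linarith)

/-- The constant in the pointwise bound of the cross term. -/
noncomputable def crossConst (n : ℕ) (p δ : ℝ) : ℝ :=
  2 * gradientConst n p ^ (2 - p) / δ + 2 * δ ^ (1 - p)

theorem crossConst_nonneg (hp1 : 1 < p) (hpn : p < n) {δ : ℝ} (hδ : 0 < δ) :
    0 ≤ crossConst n p δ := by
  have := gradientConst_pos hp1 hpn
  unfold crossConst; positivity

theorem hardyDensity_cross_le (hp1 : 1 < p) (hp2 : p < 2) (hpn : p < n) (ha : 0 < a₀) {ε : ℝ}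
    (hε : 0 < ε) {δ : ℝ} (hδ : 0 < δ) (s : ℝ) {y : ℝ} (hy : 0 ≤ y) (x : Euc n) {ρ : ℝ}
    (hρ : ρ = 1 ∨ ρ = ‖x‖) :
    |s| * bubbleMod n p a₀ ε s x ^ ((p - 2) / 2) * bubbleWeight p x ^ (1 - p) * (ρ * y) ≤
      δ * hardyDensity n p a₀ ε s x + crossConst n p δ * energyDensity n p a₀ ε y x := by
  have hN := bubbleWeight_pos (p := p) x
  have hK := gradientConst_pos hp1 hpn
  have := cross_term_le (p := p) (ε := ε) (s := |s|) (y := y) (v := bubble n p a₀ x)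
    (w := ‖∇ (bubble n p a₀) x‖) (m := √(bubbleMod n p a₀ ε s x)) (T := bubbleWeight p x ^ (1 - p))
    (ρ := ρ) (K := gradientConst n p ^ (2 - p)) (δ := δ) hp1 hp2 hε (abs_nonneg s) hy
    (bubble_pos ha x) (norm_nonneg _) (bubble_le_sqrt_bubbleMod s x)
    (mul_abs_le_sqrt_bubbleMod s x) (by positivity)
    (by rcases hρ with rfl | rfl <;> positivity) hδ (by positivity)
    (by
      rcases hρ with rfl | rfl
      · simpa [gradientConst] using weight_balance_one hp1 hp2 hpn ha x
      · exact weight_balance_norm hp1 hp2 hpn ha x)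
    (by
      rcases hρ with rfl | rfl
      · simpa using bubbleWeight_rpow_le_one hp1 x
      · exact norm_rpow_mul_bubbleWeight_le hp1 x)
  rw [← bubbleMod_rpow_half ha, sq_abs] at this
  exact this

theorem sq_div_bubbleMod_mem {ε : ℝ} (ha : 0 < a₀) (s : ℝ) (x : Euc n) :
    (ε * s) ^ 2 / bubbleMod n p a₀ ε s x ∈ Icc (0 : ℝ) 1 := by
  have hM := bubbleMod_pos (p := p) (ε := ε) ha s x
  refine ⟨by positivity, ?_⟩
  rw [div_le_one hM]
  unfold bubbleMod; nlinarith [sq_nonneg (bubble n p a₀ x)]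

theorem bubble_sq_div_bubbleMod_mem {ε : ℝ} (ha : 0 < a₀) (s : ℝ) (x : Euc n) :
    bubble n p a₀ x ^ 2 / bubbleMod n p a₀ ε s x ∈ Icc (0 : ℝ) 1 := by
  have hM := bubbleMod_pos (p := p) (ε := ε) ha s x
  refine ⟨by positivity, ?_⟩
  rw [div_le_one hM]
  unfold bubbleMod; nlinarith [sq_nonneg (ε * s)]

theorem abs_hardyDensity_coeff_le {ε : ℝ} (hp1 : 1 < p) (hp2 : p < 2) (ha : 0 < a₀) (s : ℝ)
    (x : Euc n) :
    |s * bubbleMod n p a₀ ε s x ^ ((p - 2) / 2) * bubbleWeight p x ^ (1 - p) *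
      (2 + (p - 2) * ((ε * s) ^ 2 / bubbleMod n p a₀ ε s x))| ≤
    2 * (|s| * bubbleMod n p a₀ ε s x ^ ((p - 2) / 2) * bubbleWeight p x ^ (1 - p)) := by
  have hM := bubbleMod_pos (p := p) (ε := ε) ha s x
  have hN := bubbleWeight_pos (p := p) x
  obtain ⟨h0, h1⟩ := sq_div_bubbleMod_mem (p := p) (ε := ε) ha s x
  rw [abs_mul, abs_mul, abs_mul, abs_of_pos (Real.rpow_pos_of_pos hM _),
    abs_of_pos (Real.rpow_pos_of_pos hN _), mul_comm]
  gcongr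
  rw [abs_le]
  constructor <;> nlinarith

/-- Hardy inequality by testing with the field `h(x) x`. Radially, `N^(1-p)` costs at most `p h`,
the contribution of `v` has a favourable sign since `v` decreases and `(p-2)/2 < 0`, and the term
with `Du` is controlled by `cross_term_le`. What is left is `(n-p) h`, with `n - p > 0`. -/
theorem lintegral_hardyDensity_le (hp1 : 1 < p) (hp2 : p < 2) (hpn : p < n) (ha : 0 < a₀) :
    ∃ C : NNReal, ∀ ε : ℝ, 0 < ε → ∀ u : Euc n → ℝ, IsTest u →
      ∫⁻ x, ENNReal.ofReal (hardyDensity n p a₀ ε (u x) x) ≤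
        C * ∫⁻ x, ENNReal.ofReal (energyDensity n p a₀ ε ‖∇ u x‖ x) := by
  have hnp : 0 < (n : ℝ) - p := by linarith
  -- The identity gives `2δ ∫ h ≤ ∫ T`, while the cross term contributes only `δ ∫ h`, so one copy
  -- survives absorption.
  set δ := ((n : ℝ) - p) / 4 with hδdef
  have hδ : 0 < δ := by positivity
  have hC := crossConst_nonneg hp1 hpn hδ
  refine ⟨Real.toNNReal (crossConst n p δ / δ), fun ε hε u ⟨hu, huc⟩ => ?_⟩
  have hu1 : ContDiff ℝ 1 u := hu.of_le (by simp)
  have hud : ∀ x, HasFDerivAt u (fderiv ℝ u x) x := fun x =>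
    (hu1.differentiable one_ne_zero x).hasFDerivAt
  set h := fun x => hardyDensity n p a₀ ε (u x) x with hh
  have hh1 : ContDiff ℝ 1 h := contDiff_hardyDensity hp1 ha hu1
  have hhc : HasCompactSupport h := hasCompactSupport_hardyDensity huc
  have hhi : Integrable h := hh1.continuous.integrable_of_hasCompactSupport hhc
  set T := fun x : Euc n => |u x| * bubbleMod n p a₀ ε (u x) x ^ ((p - 2) / 2) *
    bubbleWeight p x ^ (1 - p) * (‖x‖ * ‖fderiv ℝ u x‖) with hT
  have hTc : Continuous T := by
    refine ((hu1.continuous.abs.mul ((contDiff_bubbleMod hp1 hu1).continuous.rpow_const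
      fun x => Or.inl (bubbleMod_pos ha _ x).ne')).mul
      ((contDiff_bubbleWeight hp1).continuous.rpow_const
      fun x => Or.inl (bubbleWeight_pos x).ne')).mul (continuous_norm.mul ?_)
    exact (hu1.continuous_fderiv one_ne_zero).norm
  have hTs : HasCompactSupport T := huc.mono' (Function.support_subset_iff'.2 fun x hx => by
    simp [hT, image_eq_zero_of_notMem_tsupport hx])
  have hTi : Integrable T := hTc.integrable_of_hasCompactSupport hTs
  have hT0 : ∀ x, 0 ≤ T x := fun x => by
    have := bubbleMod_pos (p := p) (ε := ε) ha (u x) x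
    have := bubbleWeight_pos (p := p) x
    simp only [hT]; positivity
  have hh0 : ∀ x, 0 ≤ h x := fun x => hardyDensity_nonneg ha _ x
  have hder : Continuous fun x => fderiv ℝ h x x :=
    (hh1.continuous_fderiv one_ne_zero).clm_apply continuous_id
  have hderc : HasCompactSupport fun x => fderiv ℝ h x x :=
    (hhc.fderiv (𝕜 := ℝ)).mono (Function.support_subset_iff'.2 fun x hx => by
      rw [Function.notMem_support.1 hx]; rfl)
  have key : ∀ x, (n - p) * h x - 2 * T x ≤ n * h x + fderiv ℝ h x x := by
    intro x
    have hN := bubbleWeight_pos (p := p) x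
    rw [(hasFDerivAt_hardyDensity hp1 ha (hud x)).fderiv]
    simp only [add_apply, smul_apply, smul_eq_mul]
    rw [bubbleWeightDeriv_self hp1]
    have b1 := abs_hardyDensity_coeff_le (ε := ε) hp1 hp2 ha (u x) x
    have b2 : |fderiv ℝ u x x| ≤ ‖x‖ * ‖fderiv ℝ u x‖ := by
      rw [mul_comm]; exact (fderiv ℝ u x).le_opNorm x
    obtain ⟨c0, c1⟩ := bubble_sq_div_bubbleMod_mem (p := p) (ε := ε) ha (u x) x
    set A := u x * bubbleMod n p a₀ ε (u x) x ^ ((p - 2) / 2) * bubbleWeight p x ^ (1 - p) *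
      (2 + (p - 2) * ((ε * u x) ^ 2 / bubbleMod n p a₀ ε (u x) x))
    have b3 : -(2 * T x) ≤ A * fderiv ℝ u x x := by
      have : |A * fderiv ℝ u x x| ≤ 2 * T x := by
        rw [abs_mul]
        calc _ ≤ 2 * (|u x| * bubbleMod n p a₀ ε (u x) x ^ ((p - 2) / 2) *
              bubbleWeight p x ^ (1 - p)) * (‖x‖ * ‖fderiv ℝ u x‖) := by
              have := bubbleMod_pos (p := p) (ε := ε) ha (u x) x
              gcongr
          _ = _ := by simp only [hT]; ring
      exact (abs_le.1 this).1
    have b4 : -(p * h x) ≤ h x / bubbleWeight p x *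
        ((2 - p) * ((n - p) / p) * (bubble n p a₀ x ^ 2 / bubbleMod n p a₀ ε (u x) x) - (p - 1)) *
        (p / (p - 1) * ‖x‖ ^ (p / (p - 1))) := by
      have hp0 : 0 < p - 1 := by linarith
      -- The discarded nonnegative term is the contribution of the radially decreasing `v`.
      have d1 : -(p - 1) ≤ (2 - p) * ((n - p) / p) *
          (bubble n p a₀ x ^ 2 / bubbleMod n p a₀ ε (u x) x) - (p - 1) := by
        have : 0 ≤ (2 - p) * ((n - p) / p) *
          (bubble n p a₀ x ^ 2 / bubbleMod n p a₀ ε (u x) x) :=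
          mul_nonneg (mul_nonneg (by linarith) (div_nonneg hnp.le (by linarith))) c0
        linarith
      have d2 : ‖x‖ ^ (p / (p - 1)) ≤ bubbleWeight p x := by unfold bubbleWeight; linarith
      have d3 : 0 ≤ h x / bubbleWeight p x := div_nonneg (hh0 x) hN.le
      have d4 : 0 ≤ p / (p - 1) * ‖x‖ ^ (p / (p - 1)) := by positivity
      calc -(p * h x) = -(h x / bubbleWeight p x * (p - 1) * (p / (p - 1) * bubbleWeight p x)) := by
            field_simp
        _ ≤ -(h x / bubbleWeight p x * (p - 1) * (p / (p - 1) * ‖x‖ ^ (p / (p - 1)))) := by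
          gcongr
        _ = h x / bubbleWeight p x * (-(p - 1)) * (p / (p - 1) * ‖x‖ ^ (p / (p - 1))) := by ring
        _ ≤ _ := by gcongr
    have e : h x = hardyDensity n p a₀ ε (u x) x := rfl
    rw [e] at b4 ⊢
    linarith
  have hI : (n - p) * ∫ x, h x ≤ 2 * ∫ x, T x := by
    have := integral_mono ((hhi.const_mul ((n : ℝ) - p)).sub (hTi.const_mul 2))
      ((hhi.const_mul (n : ℝ)).add (hder.integrable_of_hasCompactSupport hderc)) key
    simp only [Pi.sub_apply, Pi.add_apply] at this
    rw [integral_sub (hhi.const_mul _) (hTi.const_mul _),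
      integral_add (hhi.const_mul _) (hder.integrable_of_hasCompactSupport hderc),
      integral_fderiv_apply_self hh1 hhc] at this
    simp only [integral_const_mul] at this
    linarith
  have hI2 : 2 * δ * ∫ x, h x ≤ ∫ x, T x := by rw [hδdef]; linarith
  have hI3 : ENNReal.ofReal (2 * δ) * ∫⁻ x, ENNReal.ofReal (h x) ≤ ∫⁻ x, ENNReal.ofReal (T x) := by
    rw [← ofReal_integral_eq_lintegral_ofReal hhi (Eventually.of_forall hh0),
      ← ofReal_integral_eq_lintegral_ofReal hTi (Eventually.of_forall hT0),
      ← ENNReal.ofReal_mul (by positivity)]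
    exact ENNReal.ofReal_le_ofReal hI2
  set H := ∫⁻ x, ENNReal.ofReal (h x) with hH
  set E := ∫⁻ x, ENNReal.ofReal (energyDensity n p a₀ ε ‖∇ u x‖ x) with hE
  have hHfin : H ≠ ⊤ := hhi.lintegral_lt_top.ne
  have hTle : ∫⁻ x, ENNReal.ofReal (T x) ≤
      ENNReal.ofReal δ * H + ENNReal.ofReal (crossConst n p δ) * E := by
    rw [hH, hE, ← lintegral_const_mul' _ _ ENNReal.ofReal_ne_top,
      ← lintegral_const_mul' _ _ ENNReal.ofReal_ne_top, ← lintegral_add_left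
      ((hh1.continuous.measurable.ennreal_ofReal).const_mul _)]
    refine lintegral_mono fun x => ?_
    rw [← ENNReal.ofReal_mul hδ.le, ← ENNReal.ofReal_mul hC,
      ← ENNReal.ofReal_add (mul_nonneg hδ.le (hh0 x))
        (mul_nonneg hC (energyDensity_nonneg hε (norm_nonneg _) x))]
    refine ENNReal.ofReal_le_ofReal ?_
    rw [norm_gradient_eq]
    exact hardyDensity_cross_le hp1 hp2 hpn ha hε hδ (u x) (norm_nonneg _) x (Or.inr rfl)
  -- Absorption requires `∫ h < ∞`, which compact support provides; hence the proof for test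
  -- functions before any passage to limits.
  have hfin : ENNReal.ofReal δ * H ≠ ⊤ := ENNReal.mul_ne_top ENNReal.ofReal_ne_top hHfin
  have h2 : ENNReal.ofReal δ * H ≤ ENNReal.ofReal (crossConst n p δ) * E := by
    have h3 := hI3.trans hTle
    rw [show (2 : ℝ) * δ = δ + δ by ring, ENNReal.ofReal_add hδ.le hδ.le, add_mul] at h3
    exact (ENNReal.add_le_add_iff_left hfin).1 h3
  have hδ' : ENNReal.ofReal δ ≠ 0 := by simpa using hδ
  rw [mul_comm, ← ENNReal.le_div_iff_mul_le (Or.inl hδ') (Or.inl ENNReal.ofReal_ne_top)] at h2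
  refine h2.trans (le_of_eq ?_)
  change _ = ENNReal.ofReal (crossConst n p δ / δ) * E
  rw [ENNReal.ofReal_div_of_pos hδ, ENNReal.mul_div_right_comm]

/-- The term with `Du` is the cross term with `ρ = 1` and `δ = 1`; the term with `DN` is at most a
multiple of `h` because `|DN| ≤ C N`. -/
theorem enorm_fderiv_hardyDensity_le (hp1 : 1 < p) (hp2 : p < 2) (hpn : p < n) (ha : 0 < a₀) :
    ∃ C : NNReal, ∀ ε : ℝ, 0 < ε → ∀ u : Euc n → ℝ, IsTest u → ∀ x,
      ‖fderiv ℝ (fun x => hardyDensity n p a₀ ε (u x) x) x‖ₑ ≤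
        C * (ENNReal.ofReal (hardyDensity n p a₀ ε (u x) x) +
          ENNReal.ofReal (energyDensity n p a₀ ε ‖∇ u x‖ x)) := by
  have hnp : 0 < (n : ℝ) - p := by linarith
  have hp0 : 0 < p - 1 := by linarith
  have hC := crossConst_nonneg hp1 hpn one_pos
  set B := ((2 - p) * ((n - p) / p) + (p - 1)) * (p / (p - 1)) with hB
  have hB0 : 0 ≤ B := by
    have : 0 < 2 - p := by linarith
    positivity
  refine ⟨Real.toNNReal (2 + B + 2 * crossConst n p 1), fun ε hε u ⟨hu, huc⟩ x => ?_⟩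
  have hu1 : ContDiff ℝ 1 u := hu.of_le (by simp)
  have hud : HasFDerivAt u (fderiv ℝ u x) x := (hu1.differentiable one_ne_zero x).hasFDerivAt
  have hN := bubbleWeight_pos (p := p) x
  have hM := bubbleMod_pos (p := p) (ε := ε) ha (u x) x
  have hh0 := hardyDensity_nonneg (p := p) (ε := ε) ha (u x) x
  have he0 := energyDensity_nonneg (n := n) (p := p) (a₀ := a₀) hε (norm_nonneg (∇ u x)) x
  rw [(hasFDerivAt_hardyDensity hp1 ha hud).fderiv, ← ENNReal.ofReal_add hh0 he0,
    ← ofReal_norm]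
  change _ ≤ ENNReal.ofReal _ * _
  rw [← ENNReal.ofReal_mul (by positivity)]
  refine ENNReal.ofReal_le_ofReal ?_
  refine (norm_add_le _ _).trans ?_
  rw [norm_smul, norm_smul, norm_bubbleWeightDeriv hp1, Real.norm_eq_abs, Real.norm_eq_abs]
  have b1 := abs_hardyDensity_coeff_le (ε := ε) hp1 hp2 ha (u x) x
  have b2 := hardyDensity_cross_le hp1 hp2 hpn ha hε one_pos (u x) (norm_nonneg (∇ u x)) x
    (Or.inl rfl)
  obtain ⟨c0, c1⟩ := bubble_sq_div_bubbleMod_mem (p := p) (ε := ε) ha (u x) x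
  have b3 := mul_le_mul_of_nonneg_right b1 (norm_nonneg (fderiv ℝ u x))
  have b4 : |hardyDensity n p a₀ ε (u x) x / bubbleWeight p x *
        ((2 - p) * ((n - p) / p) * (bubble n p a₀ x ^ 2 / bubbleMod n p a₀ ε (u x) x) - (p - 1))| *
        (p / (p - 1) * ‖x‖ ^ (p / (p - 1) - 1)) ≤ B * hardyDensity n p a₀ ε (u x) x := by
    have d1 : |(2 - p) * ((n - p) / p) * (bubble n p a₀ x ^ 2 / bubbleMod n p a₀ ε (u x) x) -
        (p - 1)| ≤ (2 - p) * ((n - p) / p) + (p - 1) := by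
      have e0 : 0 ≤ (2 - p) * ((n - p) / p) :=
        mul_nonneg (by linarith) (div_nonneg hnp.le (by linarith))
      have e1 := mul_le_mul_of_nonneg_left c1 e0
      have e2 := mul_nonneg e0 c0
      rw [abs_le]; constructor <;> linarith
    have d2 := rpow_conj_sub_one_le hp1 x
    rw [abs_mul, abs_of_nonneg (div_nonneg hh0 hN.le)]
    calc _ ≤ hardyDensity n p a₀ ε (u x) x / bubbleWeight p x *
          ((2 - p) * ((n - p) / p) + (p - 1)) * (p / (p - 1) * bubbleWeight p x) := by gcongr
      _ = _ := by rw [hB]; field_simp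
  rw [one_mul, norm_gradient_eq] at b2
  rw [norm_gradient_eq] at he0 ⊢
  have b5 := mul_nonneg hC hh0
  have b6 := mul_nonneg hB0 he0
  nlinarith

/-- Sobolev inequality in `W^{1,1}` applied to `h` itself, with `∫ h` already bounded by the energy.
The integrability above `L¹` excludes concentration of `h`. -/
theorem eLpNorm_hardyDensity_le (hp1 : 1 < p) (hp2 : p < 2) (hpn : p < n) (hn : 2 ≤ n)
    (ha : 0 < a₀) :
    ∃ C : NNReal, ∀ ε : ℝ, 0 < ε → ∀ u : Euc n → ℝ, IsTest u →
      eLpNorm (fun x => hardyDensity n p a₀ ε (u x) x) (ENNReal.ofReal (n / (n - 1))) volume ≤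
        C * ∫⁻ x, ENNReal.ofReal (energyDensity n p a₀ ε ‖∇ u x‖ x) := by
  obtain ⟨C₁, h1⟩ := lintegral_hardyDensity_le hp1 hp2 hpn ha
  obtain ⟨C₂, h2⟩ := enorm_fderiv_hardyDensity_le hp1 hp2 hpn ha
  set r : NNReal := Real.toNNReal ((n : ℝ) / (n - 1)) with hr
  have hn' : (2 : ℝ) ≤ n := by exact_mod_cast hn
  have hconj : NNReal.HolderConjugate (Module.finrank ℝ (Euc n)) r := by
    rw [finrank_euclideanSpace_fin, ← NNReal.holderConjugate_coe_iff, hr,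
      Real.coe_toNNReal _ (div_nonneg (by linarith) (by linarith))]
    rw [NNReal.coe_natCast, Real.holderConjugate_iff]
    refine ⟨by linarith, ?_⟩
    have : (n : ℝ) - 1 ≠ 0 := by linarith
    field_simp
    ring
  refine ⟨eLpNormLESNormFDerivOneConst (volume : Measure (Euc n)) r * (C₂ * (C₁ + 1)),
    fun ε hε u hu => ?_⟩
  have hu1 : ContDiff ℝ 1 u := hu.1.of_le (by simp)
  have hh1 : ContDiff ℝ 1 (fun x => hardyDensity n p a₀ ε (u x) x) := contDiff_hardyDensity hp1 ha hu1
  have := eLpNorm_le_eLpNorm_fderiv_one volume hh1 (hasCompactSupport_hardyDensity hu.2) hconj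
  refine this.trans ?_
  push_cast
  rw [mul_assoc, mul_assoc]
  gcongr
  rw [eLpNorm_one_eq_lintegral_enorm]
  refine (lintegral_mono (h2 ε hε u hu)).trans ?_
  rw [lintegral_const_mul' _ _ ENNReal.coe_ne_top, lintegral_add_left
    (hh1.continuous.measurable.ennreal_ofReal), add_mul, one_mul]
  gcongr
  exact h1 ε hε u hu

theorem enorm_fderiv_excessDensity_rpow_le (hp1 : 1 < p) (hp2 : p < 2) (hpn : p < n) (ha : 0 < a₀) :
    ∃ C : NNReal, ∀ ε : ℝ, 0 < ε → ∀ u : Euc n → ℝ, IsTest u → ∀ x,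
      ‖fderiv ℝ (fun x => excessDensity n p a₀ ε (u x) x) x‖ₑ ^ p ≤
        C * ENNReal.ofReal (ε ^ 2) * (ENNReal.ofReal (hardyDensity n p a₀ ε (u x) x) +
          ENNReal.ofReal (energyDensity n p a₀ ε ‖∇ u x‖ x)) := by
  have hK := gradientConst_pos hp1 hpn
  refine ⟨Real.toNNReal (20 * gradientConst n p ^ p + 32), fun ε hε u ⟨hu, huc⟩ x => ?_⟩
  have hu1 : ContDiff ℝ 1 u := hu.of_le (by simp)
  have hud : HasFDerivAt u (fderiv ℝ u x) x := (hu1.differentiable one_ne_zero x).hasFDerivAt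
  have hN := bubbleWeight_pos (p := p) x
  have hv := bubble_pos (p := p) ha x
  have hM := bubbleMod_pos (p := p) (ε := ε) ha (u x) x
  have hh0 := hardyDensity_nonneg (p := p) (ε := ε) ha (u x) x
  have he0 := energyDensity_nonneg (n := n) (p := p) (a₀ := a₀) hε (norm_nonneg (∇ u x)) x
  have hb := truncation_gradient_rpow_le (p := p) (ε := ε) (s := |u x|) (y := ‖∇ u x‖)
    (v := bubble n p a₀ x) (w := ‖∇ (bubble n p a₀) x‖) (m := √(bubbleMod n p a₀ ε (u x) x))
    (T := bubbleWeight p x ^ (1 - p)) (K := gradientConst n p ^ p) hp1 hp2 hε (abs_nonneg _)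
    (norm_nonneg _) hv (norm_nonneg _) (bubble_le_sqrt_bubbleMod _ x)
    (mul_abs_le_sqrt_bubbleMod _ x) (by positivity) (by positivity)
    (norm_gradient_bubble_rpow_le hp1 hpn ha x)
  rw [(hasFDerivAt_excessDensity hp1 ha hud).fderiv, ← ENNReal.ofReal_add hh0 he0,
    ← ofReal_norm, ENNReal.ofReal_rpow_of_nonneg (norm_nonneg _) (by linarith)]
  change _ ≤ ENNReal.ofReal _ * _ * _
  rw [← ENNReal.ofReal_mul (by positivity), ← ENNReal.ofReal_mul (by positivity)]
  refine ENNReal.ofReal_le_ofReal ?_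
  rw [← bubbleMod_rpow_half ha, sq_abs] at hb
  refine le_trans ?_ hb
  refine Real.rpow_le_rpow (norm_nonneg _) ?_ (by linarith)
  refine (norm_sub_le _ _).trans ?_
  rw [norm_smul, norm_smul, Real.norm_eq_abs, Real.norm_eq_abs, norm_gradient_eq, norm_gradient_eq]
  have hm := Real.sqrt_pos.2 hM
  have hm2 := Real.sq_sqrt hM.le
  have e1 : bubbleMod n p a₀ ε (u x) x ^ (-(1 / 2) : ℝ) = 1 / √(bubbleMod n p a₀ ε (u x) x) := by
    rw [Real.rpow_neg hM.le, ← Real.sqrt_eq_rpow, one_div]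
  obtain ⟨c0, c1⟩ := sq_div_bubbleMod_mem (p := p) (ε := ε) ha (u x) x
  unfold excessDensity
  rw [e1]
  set m := √(bubbleMod n p a₀ ε (u x) x) with hmdef
  refine add_le_add ?_ (le_of_eq ?_)
  · rw [abs_mul, abs_mul, abs_mul, abs_of_pos (show 0 < 1 / m by positivity),
      abs_of_pos (show 0 < ε ^ 2 by positivity)]
    have : |2 - (ε * u x) ^ 2 / bubbleMod n p a₀ ε (u x) x| ≤ 2 := by
      rw [abs_le]; constructor <;> linarith
    calc _ ≤ 1 / m * ε ^ 2 * |u x| * 2 * ‖fderiv ℝ u x‖ := by gcongr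
      _ = _ := by ring
  · rw [abs_of_nonneg (by positivity), ← hm2, mul_pow, mul_pow, sq_abs]
    congr 1
    field_simp

/-- Sobolev inequality in `W^{1,p}` for `g`. The factor `ε²` under the power `1/p` is decisive:
raised to `p*`, it beats the factor `ε^(-2)` in the functional, since `p* > p`. -/
theorem eLpNorm_excessDensity_le (hp1 : 1 < p) (hp2 : p < 2) (hpn : p < n) (ha : 0 < a₀) :
    ∃ C : NNReal, ∀ ε : ℝ, 0 < ε → ∀ u : Euc n → ℝ, IsTest u →
      eLpNorm (fun x => excessDensity n p a₀ ε (u x) x) (ENNReal.ofReal (sobolevExp n p)) volume ≤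
        C * (ENNReal.ofReal (ε ^ 2) *
          ∫⁻ x, ENNReal.ofReal (energyDensity n p a₀ ε ‖∇ u x‖ x)) ^ (1 / p) := by
  obtain ⟨C₁, h1⟩ := lintegral_hardyDensity_le hp1 hp2 hpn ha
  obtain ⟨C₂, h2⟩ := enorm_fderiv_excessDensity_rpow_le hp1 hp2 hpn ha
  have hp0 : 0 < p := by linarith
  have hnp : 0 < (n : ℝ) - p := by linarith
  have hn0 : 0 < (n : ℝ) := by linarith
  set P : NNReal := Real.toNNReal p with hP
  have hPc : (P : ℝ) = p := Real.coe_toNNReal _ hp0.le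
  refine ⟨SNormLESNormFDerivOfEqConst ℝ (volume : Measure (Euc n)) P * (C₂ * (C₁ + 1)) ^ (1 / p),
    fun ε hε u hu => ?_⟩
  have hu1 : ContDiff ℝ 1 u := hu.1.of_le (by simp)
  have hh1 : ContDiff ℝ 1 (fun x => hardyDensity n p a₀ ε (u x) x) := contDiff_hardyDensity hp1 ha hu1
  have hg1 : ContDiff ℝ 1 (fun x => excessDensity n p a₀ ε (u x) x) :=
    contDiff_excessDensity hp1 ha hu1
  have := eLpNorm_le_eLpNorm_fderiv_of_eq (volume : Measure (Euc n)) hg1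
    (hasCompactSupport_excessDensity hu.2) (p := P) (p' := Real.toNNReal (sobolevExp n p))
    (by rw [← NNReal.coe_le_coe, hPc]; exact_mod_cast hp1.le)
    (by rw [finrank_euclideanSpace_fin]; exact_mod_cast hn0)
    (by
      rw [NNReal.coe_inv, hPc, finrank_euclideanSpace_fin, Real.coe_toNNReal _ (by unfold sobolevExp; positivity)]
      unfold sobolevExp
      field_simp)
  refine this.trans ?_
  push_cast
  rw [mul_assoc]
  gcongr
  have e : eLpNorm (fderiv ℝ (fun x => excessDensity n p a₀ ε (u x) x)) P volume =
      (∫⁻ x, ‖fderiv ℝ (fun x => excessDensity n p a₀ ε (u x) x) x‖ₑ ^ p) ^ (1 / p) := by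
    rw [eLpNorm_eq_lintegral_rpow_enorm_toReal (by simpa [hP] using hp0) ENNReal.coe_ne_top]
    simp [hPc]
  rw [e, ENNReal.coe_rpow_of_nonneg _ (by positivity), ← ENNReal.mul_rpow_of_nonneg _ _ (by positivity)]
  gcongr
  refine (lintegral_mono (h2 ε hε u hu)).trans ?_
  rw [lintegral_const_mul' _ _ (ENNReal.mul_ne_top ENNReal.coe_ne_top ENNReal.ofReal_ne_top),
    lintegral_add_left (hh1.continuous.measurable.ennreal_ofReal)]
  push_cast
  calc _ ≤ (C₂ : ℝ≥0∞) * ENNReal.ofReal (ε ^ 2) *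
        (C₁ * (∫⁻ x, ENNReal.ofReal (energyDensity n p a₀ ε ‖∇ u x‖ x)) +
          ∫⁻ x, ENNReal.ofReal (energyDensity n p a₀ ε ‖∇ u x‖ x)) := by
        gcongr; exact h1 ε hε u hu
    _ = _ := by ring

end Estimates

/-! ### The homogeneous Sobolev space -/

section HomogeneousSobolev

variable {n : ℕ} {p a₀ : ℝ}

theorem lt_sobolevExp (hp1 : 1 < p) (hpn : p < n) : p < sobolevExp n p := by
  unfold sobolevExp
  rw [lt_div_iff₀ (by linarith)]
  nlinarith

theorem continuous_gradient {u : Euc n → ℝ} (hu : IsTest u) : Continuous (∇ u) :=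
  (InnerProductSpace.toDual ℝ (Euc n)).symm.continuous.comp (hu.1.continuous_fderiv (by simp))

theorem memLp_gradient {u : Euc n → ℝ} (hu : IsTest u) (q : ℝ≥0∞) : MemLp (∇ u) q volume :=
  (continuous_gradient hu).memLp_of_hasCompactSupport
    ((hu.2.fderiv (𝕜 := ℝ)).comp_left (g := (InnerProductSpace.toDual ℝ (Euc n)).symm) (map_zero _))

theorem memLp_of_isTest {u : Euc n → ℝ} (hu : IsTest u) (q : ℝ≥0∞) : MemLp u q volume :=
  hu.1.continuous.memLp_of_hasCompactSupport hu.2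

theorem IsTest.sub {u w : Euc n → ℝ} (hu : IsTest u) (hw : IsTest w) : IsTest (fun x => u x - w x) :=
  ⟨hu.1.sub hw.1, hu.2.sub hw.2⟩

theorem IsTest.add {u w : Euc n → ℝ} (hu : IsTest u) (hw : IsTest w) : IsTest (fun x => u x + w x) :=
  ⟨hu.1.add hw.1, hu.2.add hw.2⟩

theorem IsTest.const_mul {u : Euc n → ℝ} (c : ℝ) (hu : IsTest u) : IsTest (fun x => c * u x) :=
  ⟨contDiff_const.mul hu.1, hu.2.mul_left⟩

theorem IsTest.gradient_sub {u w : Euc n → ℝ} (hu : IsTest u) (hw : IsTest w) (x : Euc n) :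
    ∇ (fun x => u x - w x) x = ∇ u x - ∇ w x := by
  rw [gradient, gradient, gradient,
    fderiv_fun_sub (hu.1.differentiable (by simp) x) (hw.1.differentiable (by simp) x), map_sub]

theorem IsTest.gradient_add {u w : Euc n → ℝ} (hu : IsTest u) (hw : IsTest w) (x : Euc n) :
    ∇ (fun x => u x + w x) x = ∇ u x + ∇ w x := by
  rw [gradient, gradient, gradient,
    fderiv_fun_add (hu.1.differentiable (by simp) x) (hw.1.differentiable (by simp) x), map_add]

theorem IsTest.gradient_const_mul {u : Euc n → ℝ} (c : ℝ) (hu : IsTest u) (x : Euc n) :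
    ∇ (fun x => c * u x) x = c • ∇ u x := by
  rw [gradient, gradient, fderiv_const_mul (hu.1.differentiable (by simp) x), map_smul]

theorem eLpNorm_le_eLpNorm_gradient (hp1 : 1 < p) (hpn : p < n) :
    ∃ C : NNReal, ∀ u : Euc n → ℝ, IsTest u →
      eLpNorm u (ENNReal.ofReal (sobolevExp n p)) volume ≤
        C * eLpNorm (∇ u) (ENNReal.ofReal p) volume := by
  have hp0 : 0 < p := by linarith
  have hnp : 0 < (n : ℝ) - p := by linarith
  have hn0 : 0 < (n : ℝ) := by linarith
  have hPc : ((Real.toNNReal p : NNReal) : ℝ) = p := Real.coe_toNNReal _ hp0.le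
  refine ⟨SNormLESNormFDerivOfEqConst ℝ (volume : Measure (Euc n)) (Real.toNNReal p),
    fun u hu => ?_⟩
  have := eLpNorm_le_eLpNorm_fderiv_of_eq (volume : Measure (Euc n))
    (hu.1.of_le (by simp) : ContDiff ℝ 1 u) hu.2
    (p := Real.toNNReal p) (p' := Real.toNNReal (sobolevExp n p))
    (by rw [← NNReal.coe_le_coe, hPc]; exact_mod_cast hp1.le)
    (by rw [finrank_euclideanSpace_fin]; exact_mod_cast hn0)
    (by
      rw [NNReal.coe_inv, hPc, finrank_euclideanSpace_fin, Real.coe_toNNReal _ (by unfold sobolevExp; positivity)]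
      unfold sobolevExp
      field_simp)
  refine this.trans (le_of_eq ?_)
  congr 1
  exact eLpNorm_congr_norm_ae (Eventually.of_forall fun x => (norm_gradient_eq u x).symm)

variable [Fact (1 < p)]

theorem HomSobolev.memLp_grad (U : HomSobolev n p) :
    MemLp (HomSobolev.grad U) (ENNReal.ofReal p) volume := Lp.memLp _

theorem HomSobolev.eLpNorm_grad (U : HomSobolev n p) :
    eLpNorm (HomSobolev.grad U) (ENNReal.ofReal p) volume = ENNReal.ofReal ‖U‖ := by
  rw [HomSobolev.grad, ← Lp.enorm_def, ofReal_norm]; rfl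

theorem HomSobolev.grad_add (U V : HomSobolev n p) :
    HomSobolev.grad (U + V) =ᵐ[volume] fun x => HomSobolev.grad U x + HomSobolev.grad V x :=
  Lp.coeFn_add _ _

theorem HomSobolev.grad_sub (U V : HomSobolev n p) :
    HomSobolev.grad (U - V) =ᵐ[volume] fun x => HomSobolev.grad U x - HomSobolev.grad V x :=
  Lp.coeFn_sub _ _

theorem HomSobolev.grad_smul (c : ℝ) (U : HomSobolev n p) :
    HomSobolev.grad (c • U) =ᵐ[volume] fun x => c • HomSobolev.grad U x :=
  Lp.coeFn_smul _ _

theorem one_le_ofReal_sobolevExp (hpn : p < n) : 1 ≤ ENNReal.ofReal (sobolevExp n p) := by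
  have h1 : 1 < p := Fact.out
  exact ENNReal.one_le_ofReal.2 (h1.trans (lt_sobolevExp h1 hpn)).le

theorem HomSobolev.Realizes.eLpNorm_le (hpn : p < n) :
    ∃ C : NNReal, ∀ (φ : Euc n → ℝ) (U : HomSobolev n p), HomSobolev.Realizes φ U →
      eLpNorm φ (ENNReal.ofReal (sobolevExp n p)) volume ≤
        C * eLpNorm (HomSobolev.grad U) (ENNReal.ofReal p) volume := by
  have hp1 : 1 < p := Fact.out
  obtain ⟨C, hC⟩ := eLpNorm_le_eLpNorm_gradient (n := n) hp1 hpn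
  refine ⟨C, fun φ U ⟨hφ, u, hu, h1, h2⟩ => ?_⟩
  have hQ := one_le_ofReal_sobolevExp (n := n) hpn
  have hP : 1 ≤ ENNReal.ofReal p := Fact.out
  have key : ∀ k, eLpNorm φ (ENNReal.ofReal (sobolevExp n p)) volume ≤
      C * (eLpNorm (fun x => ∇ (u k) x - HomSobolev.grad U x) (ENNReal.ofReal p) volume +
        eLpNorm (HomSobolev.grad U) (ENNReal.ofReal p) volume) +
      eLpNorm (fun x => u k x - φ x) (ENNReal.ofReal (sobolevExp n p)) volume := by
    intro k
    have e1 : φ = u k - fun x => u k x - φ x := by ext x; simp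
    have e2 : ∇ (u k) = (fun x => ∇ (u k) x - HomSobolev.grad U x) + HomSobolev.grad U := by
      ext x; simp
    have m1 := (memLp_of_isTest (hu k) (ENNReal.ofReal (sobolevExp n p)))
    have m2 := (memLp_gradient (hu k) (ENNReal.ofReal p))
    calc _ ≤ eLpNorm (u k) (ENNReal.ofReal (sobolevExp n p)) volume +
          eLpNorm (fun x => u k x - φ x) (ENNReal.ofReal (sobolevExp n p)) volume := by
          conv_lhs => rw [e1]
          exact eLpNorm_sub_le m1.1 (m1.sub hφ).1 hQ
      _ ≤ C * eLpNorm (∇ (u k)) (ENNReal.ofReal p) volume +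
          eLpNorm (fun x => u k x - φ x) (ENNReal.ofReal (sobolevExp n p)) volume := by
          gcongr; exact hC _ (hu k)
      _ ≤ _ := by
          gcongr
          conv_lhs => rw [e2]
          exact eLpNorm_add_le (m2.sub (HomSobolev.memLp_grad U)).1 (HomSobolev.memLp_grad U).1 hP
  have hlim := ((ENNReal.Tendsto.const_mul (a := (C : ℝ≥0∞)) (h1.add (tendsto_const_nhds
    (x := eLpNorm (HomSobolev.grad U) (ENNReal.ofReal p) volume)))
    (Or.inr ENNReal.coe_ne_top)).add h2)
  rw [zero_add, add_zero] at hlim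
  exact ge_of_tendsto' hlim key

theorem tendsto_zero_of_le_add {f a b : ℕ → ℝ≥0∞} (ha : Tendsto a atTop (𝓝 0))
    (hb : Tendsto b atTop (𝓝 0)) (h : ∀ k, f k ≤ a k + b k) : Tendsto f atTop (𝓝 0) :=
  tendsto_of_tendsto_of_tendsto_of_le_of_le tendsto_const_nhds (by simpa using ha.add hb)
    (fun _ => zero_le) h

theorem HomSobolev.Realizes.sub (hpn : p < n) {φ ψ : Euc n → ℝ} {U V : HomSobolev n p}
    (hφ : HomSobolev.Realizes φ U) (hψ : HomSobolev.Realizes ψ V) :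
    HomSobolev.Realizes (fun x => φ x - ψ x) (U - V) := by
  obtain ⟨mφ, u, hu, h1, h2⟩ := hφ
  obtain ⟨mψ, w, hw, h3, h4⟩ := hψ
  have hQ := one_le_ofReal_sobolevExp (n := n) hpn
  have hP : 1 ≤ ENNReal.ofReal p := Fact.out
  refine ⟨mφ.sub mψ, fun k x => u k x - w k x, fun k => (hu k).sub (hw k),
    tendsto_zero_of_le_add h1 h3 fun k => ?_, tendsto_zero_of_le_add h2 h4 fun k => ?_⟩
  · have e : (fun x => ∇ (fun x => u k x - w k x) x - HomSobolev.grad (U - V) x) =ᵐ[volume]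
        (fun x => ∇ (u k) x - HomSobolev.grad U x) - fun x => ∇ (w k) x - HomSobolev.grad V x := by
      filter_upwards [HomSobolev.grad_sub U V] with x hx
      rw [hx, (hu k).gradient_sub (hw k)]
      simp only [Pi.sub_apply]; abel
    rw [eLpNorm_congr_ae e]
    exact eLpNorm_sub_le ((memLp_gradient (hu k) (ENNReal.ofReal p)).sub (HomSobolev.memLp_grad U)).1
      ((memLp_gradient (hw k) (ENNReal.ofReal p)).sub (HomSobolev.memLp_grad V)).1 hP
  · have e : (fun x => u k x - w k x - (φ x - ψ x)) =
        (fun x => u k x - φ x) - fun x => w k x - ψ x := by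
      ext x; simp only [Pi.sub_apply]; ring
    rw [e]
    exact eLpNorm_sub_le ((memLp_of_isTest (hu k) _).sub mφ).1
      ((memLp_of_isTest (hw k) _).sub mψ).1 hQ

theorem HomSobolev.Realizes.add (hpn : p < n) {φ ψ : Euc n → ℝ} {U V : HomSobolev n p}
    (hφ : HomSobolev.Realizes φ U) (hψ : HomSobolev.Realizes ψ V) :
    HomSobolev.Realizes (fun x => φ x + ψ x) (U + V) := by
  obtain ⟨mφ, u, hu, h1, h2⟩ := hφ
  obtain ⟨mψ, w, hw, h3, h4⟩ := hψ
  have hQ := one_le_ofReal_sobolevExp (n := n) hpn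
  have hP : 1 ≤ ENNReal.ofReal p := Fact.out
  refine ⟨mφ.add mψ, fun k x => u k x + w k x, fun k => (hu k).add (hw k),
    tendsto_zero_of_le_add h1 h3 fun k => ?_, tendsto_zero_of_le_add h2 h4 fun k => ?_⟩
  · have e : (fun x => ∇ (fun x => u k x + w k x) x - HomSobolev.grad (U + V) x) =ᵐ[volume]
        (fun x => ∇ (u k) x - HomSobolev.grad U x) + fun x => ∇ (w k) x - HomSobolev.grad V x := by
      filter_upwards [HomSobolev.grad_add U V] with x hx
      rw [hx, (hu k).gradient_add (hw k)]
      simp only [Pi.add_apply]; abel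
    rw [eLpNorm_congr_ae e]
    exact eLpNorm_add_le ((memLp_gradient (hu k) (ENNReal.ofReal p)).sub (HomSobolev.memLp_grad U)).1
      ((memLp_gradient (hw k) (ENNReal.ofReal p)).sub (HomSobolev.memLp_grad V)).1 hP
  · have e : (fun x => u k x + w k x - (φ x + ψ x)) =
        (fun x => u k x - φ x) + fun x => w k x - ψ x := by
      ext x; simp only [Pi.add_apply]; ring
    rw [e]
    exact eLpNorm_add_le ((memLp_of_isTest (hu k) _).sub mφ).1
      ((memLp_of_isTest (hw k) _).sub mψ).1 hQ

theorem HomSobolev.Realizes.const_smul {φ : Euc n → ℝ} {U : HomSobolev n p}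
    (c : ℝ) (hφ : HomSobolev.Realizes φ U) : HomSobolev.Realizes (fun x => c * φ x) (c • U) := by
  obtain ⟨mφ, u, hu, h1, h2⟩ := hφ
  refine ⟨mφ.const_mul c, fun k x => c * u k x, fun k => (hu k).const_mul c, ?_, ?_⟩
  · have e : ∀ k, eLpNorm (fun x => ∇ (fun x => c * u k x) x - HomSobolev.grad (c • U) x)
        (ENNReal.ofReal p) volume =
        ‖c‖ₑ * eLpNorm (fun x => ∇ (u k) x - HomSobolev.grad U x) (ENNReal.ofReal p) volume := by
      intro k
      rw [← eLpNorm_const_smul]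
      refine eLpNorm_congr_ae ?_
      filter_upwards [HomSobolev.grad_smul c U] with x hx
      rw [hx, (hu k).gradient_const_mul]
      simp [smul_sub]
    simp_rw [e]
    simpa using ENNReal.Tendsto.const_mul h1 (Or.inr enorm_ne_top)
  · have e : ∀ k, eLpNorm (fun x => c * u k x - c * φ x) (ENNReal.ofReal (sobolevExp n p)) volume =
        ‖c‖ₑ * eLpNorm (fun x => u k x - φ x) (ENNReal.ofReal (sobolevExp n p)) volume := by
      intro k
      rw [← eLpNorm_const_smul]
      congr 1
      ext x
      simp [mul_sub]
    simp_rw [e]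
    simpa using ENNReal.Tendsto.const_mul h2 (Or.inr enorm_ne_top)

theorem HomSobolev.Realizes.ae_eq (hpn : p < n) {φ ψ : Euc n → ℝ} {U : HomSobolev n p}
    (hφ : HomSobolev.Realizes φ U) (hψ : HomSobolev.Realizes ψ U) : φ =ᵐ[volume] ψ := by
  obtain ⟨C, hC⟩ := HomSobolev.Realizes.eLpNorm_le (n := n) (p := p) hpn
  have h := hC _ _ (hφ.sub hpn hψ)
  rw [HomSobolev.eLpNorm_grad, sub_self, norm_zero, ENNReal.ofReal_zero, mul_zero] at h
  have hQ := one_le_ofReal_sobolevExp (n := n) (p := p) hpn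
  have h0 := (eLpNorm_eq_zero_iff (hφ.1.sub hψ.1).1 (one_pos.trans_le hQ).ne').1
    (le_antisymm h (zero_le))
  filter_upwards [h0] with x hx
  exact sub_eq_zero.1 hx

/-- By the Sobolev inequality, test functions whose gradients converge in `L^p` are Cauchy in
`L^(p*)`, which is complete. -/
theorem HomSobolev.exists_realizes (hpn : p < n) (U : HomSobolev n p) :
    ∃ φ : Euc n → ℝ, HomSobolev.Realizes φ U := by
  have hp1 : 1 < p := Fact.out
  have hQ := one_le_ofReal_sobolevExp (n := n) (p := p) hpn
  have : Fact (1 ≤ ENNReal.ofReal (sobolevExp n p)) := ⟨hQ⟩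
  have hP : 1 ≤ ENNReal.ofReal p := Fact.out
  obtain ⟨C, hC⟩ := eLpNorm_le_eLpNorm_gradient (n := n) hp1 hpn
  have hU : (U : Lp (Euc n) (ENNReal.ofReal p) (volume : Measure (Euc n))) ∈
      closure ((testGradients n p : Submodule ℝ _) : Set (Lp (Euc n) (ENNReal.ofReal p) (volume : Measure (Euc n)))) := by
    rw [← Submodule.topologicalClosure_coe]; exact U.2
  obtain ⟨G, hG, hGlim⟩ := mem_closure_iff_seq_limit.1 hU
  choose u hu huG using hG
  have hgrad : Tendsto (fun k => eLpNorm (fun x => ∇ (u k) x - HomSobolev.grad U x)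
        (ENNReal.ofReal p) volume) atTop (𝓝 0) := by
    refine ((Lp.tendsto_Lp_iff_tendsto_eLpNorm' _ _).1 hGlim).congr fun k => ?_
    refine eLpNorm_congr_ae ?_
    filter_upwards [huG k] with x hx
    rw [Pi.sub_apply, hx]; rfl
  set w : ℕ → Lp ℝ (ENNReal.ofReal (sobolevExp n p)) (volume : Measure (Euc n)) :=
    fun k => (memLp_of_isTest (hu k) _).toLp (u k) with hw
  have hcau : CauchySeq w := by
    have hGc : CauchySeq G := hGlim.cauchySeq
    rw [Metric.cauchySeq_iff'] at hGc ⊢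
    intro η hη
    obtain ⟨N, hN⟩ := hGc (η / (C + 1)) (by positivity)
    refine ⟨N, fun k hk => ?_⟩
    have e1 : edist (w k) (w N) ≤ C * edist (G k) (G N) := by
      rw [Lp.edist_toLp_toLp, Lp.edist_def]
      refine (hC _ ((hu k).sub (hu N))).trans (le_of_eq ?_)
      congr 1
      refine eLpNorm_congr_ae ?_
      filter_upwards [huG k, huG N] with x h1 h2
      rw [(hu k).gradient_sub (hu N), Pi.sub_apply, h1, h2]
    rw [edist_dist, edist_dist, ← ENNReal.ofReal_coe_nnreal, ← ENNReal.ofReal_mul C.coe_nonneg,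
      ENNReal.ofReal_le_ofReal_iff (by positivity)] at e1
    have h2 := hN k hk
    rw [lt_div_iff₀ (by positivity)] at h2
    have : 0 ≤ dist (G k) (G N) := dist_nonneg
    nlinarith [C.coe_nonneg]
  obtain ⟨φ, hφ⟩ := cauchySeq_tendsto_of_complete hcau
  refine ⟨φ, Lp.memLp φ, u, hu, hgrad, ?_⟩
  refine ((Lp.tendsto_Lp_iff_tendsto_eLpNorm' _ _).1 hφ).congr fun k => ?_
  refine eLpNorm_congr_ae ?_
  filter_upwards [(memLp_of_isTest (hu k) (ENNReal.ofReal (sobolevExp n p))).coeFn_toLp] with x hx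
  rw [Pi.sub_apply, hx]

end HomogeneousSobolev

/-! ### A priori estimates in the homogeneous Sobolev space -/

section Transfer

variable {n : ℕ} {p a₀ : ℝ}

theorem continuous_hardyDensity_left (ha : 0 < a₀) {ε : ℝ} (x : Euc n) :
    Continuous fun s => hardyDensity n p a₀ ε s x := by
  unfold hardyDensity
  refine ((continuous_pow 2).mul (Continuous.rpow_const ?_
    fun s => Or.inl (bubbleMod_pos ha s x).ne')).mul continuous_const
  unfold bubbleMod; fun_prop

theorem continuous_excessDensity_left (ha : 0 < a₀) {ε : ℝ} (x : Euc n) :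
    Continuous fun s => excessDensity n p a₀ ε s x := by
  unfold excessDensity
  refine Continuous.mul (by fun_prop) (Continuous.rpow_const ?_
    fun s => Or.inl (bubbleMod_pos ha s x).ne')
  unfold bubbleMod; fun_prop

/-- Integrate the gradient along the segment from `x` to `x + y`, exchange the integrals, and on
each slice use Hölder on the ball and translation invariance of the full `L^p` norm. -/
theorem lintegral_translate_sub_le (hp1 : 1 < p) {u : Euc n → ℝ} (hu : IsTest u) (y : Euc n)
    (R : ℝ) :
    ∫⁻ x in Metric.ball 0 R, ‖u (x + y) - u x‖ₑ ≤
      ‖y‖ₑ * (eLpNorm (∇ u) (ENNReal.ofReal p) volume *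
        volume (Metric.ball (0 : Euc n) R) ^ (1 - 1 / p)) := by
  have hp0 : 0 < p := by linarith
  have hc := continuous_gradient hu
  have hpt : ∀ x, ‖u (x + y) - u x‖ₑ ≤ ∫⁻ t in Ioc (0 : ℝ) 1, ‖y‖ₑ * ‖∇ u (x + t • y)‖ₑ := by
    intro x
    have hd : ∀ t : ℝ, HasDerivAt (fun t : ℝ => u (x + t • y)) (fderiv ℝ u (x + t • y) y) t := by
      intro t
      have h1 : HasDerivAt (fun t : ℝ => x + t • y) y t := by
        simpa using ((hasDerivAt_id t).smul_const y).const_add x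
      exact (hu.1.differentiable (by simp) _).hasFDerivAt.comp_hasDerivAt t h1
    have hci : Continuous fun t : ℝ => fderiv ℝ u (x + t • y) y :=
      ((hu.1.continuous_fderiv (by simp)).comp (by fun_prop)).clm_apply continuous_const
    have := intervalIntegral.integral_eq_sub_of_hasDerivAt (a := 0) (b := 1) (fun t _ => hd t)
      (hci.intervalIntegrable _ _)
    simp only [one_smul, zero_smul, add_zero] at this
    rw [← this, intervalIntegral.integral_of_le zero_le_one]
    refine (enorm_integral_le_lintegral_enorm _).trans (lintegral_mono fun t => ?_)
    rw [← ofReal_norm, ← ofReal_norm, ← ofReal_norm, ← ENNReal.ofReal_mul (norm_nonneg _)]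
    refine ENNReal.ofReal_le_ofReal ?_
    rw [norm_gradient_eq, mul_comm]
    exact (fderiv ℝ u (x + t • y)).le_opNorm y
  have hslice : ∀ t : ℝ, ∫⁻ x in Metric.ball 0 R, ‖∇ u (x + t • y)‖ₑ ≤
      eLpNorm (∇ u) (ENNReal.ofReal p) volume *
        volume (Metric.ball (0 : Euc n) R) ^ (1 - 1 / p) := by
    intro t
    have hct : Continuous fun x => ∇ u (x + t • y) := hc.comp (by fun_prop)
    rw [← eLpNorm_one_eq_lintegral_enorm]
    refine (eLpNorm_le_eLpNorm_mul_rpow_measure_univ (q := ENNReal.ofReal p)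
      (ENNReal.one_le_ofReal.2 hp1.le) hct.aestronglyMeasurable).trans ?_
    rw [Measure.restrict_apply_univ, ENNReal.toReal_ofReal hp0.le, ENNReal.toReal_one, div_one]
    gcongr
    refine (eLpNorm_mono_measure _ Measure.restrict_le_self).trans (le_of_eq ?_)
    have hmp := measurePreserving_add_right (volume : Measure (Euc n)) (t • y)
    exact eLpNorm_comp_measurePreserving (g := ∇ u) hc.aestronglyMeasurable hmp
  calc _ ≤ ∫⁻ x in Metric.ball 0 R, ∫⁻ t in Ioc (0 : ℝ) 1, ‖y‖ₑ * ‖∇ u (x + t • y)‖ₑ :=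
        lintegral_mono hpt
    _ = ∫⁻ t in Ioc (0 : ℝ) 1, ∫⁻ x in Metric.ball 0 R, ‖y‖ₑ * ‖∇ u (x + t • y)‖ₑ := by
        refine lintegral_lintegral_swap ?_
        have : Continuous (fun z : Euc n × ℝ => ∇ u (z.1 + z.2 • y)) := hc.comp (by fun_prop)
        exact (measurable_const.mul this.measurable.enorm).aemeasurable
    _ ≤ ∫⁻ t in Ioc (0 : ℝ) 1, ‖y‖ₑ * (eLpNorm (∇ u) (ENNReal.ofReal p) volume *
        volume (Metric.ball (0 : Euc n) R) ^ (1 - 1 / p)) := by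
        refine lintegral_mono fun t => ?_
        rw [lintegral_const_mul' _ _ enorm_ne_top]
        gcongr
        exact hslice t
    _ = _ := by simp

variable [Fact (1 < p)]

/-- For fixed `ε` the energy is stable under `L^p` convergence of gradients: the approximants have
energy at most `4 + o(1)`, hence at most `5` after a shift of the index. The extraction gives a.e.
convergence as well. -/
theorem HomSobolev.Realizes.exists_approx (hp2 : p < 2) (hpn : p < n) {ε : ℝ} (hε : 0 < ε)
    {φ : Euc n → ℝ} {U : HomSobolev n p} (hφ : HomSobolev.Realizes φ U)
    (hE : ∫⁻ x, ENNReal.ofReal (energyDensity n p a₀ ε ‖HomSobolev.grad U x‖ x) ≤ 1) :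
    ∃ u : ℕ → Euc n → ℝ, (∀ k, IsTest (u k)) ∧
      (∀ᵐ x, Tendsto (fun k => u k x) atTop (𝓝 (φ x))) ∧
      ∀ k, ∫⁻ x, ENNReal.ofReal (energyDensity n p a₀ ε ‖∇ (u k) x‖ x) ≤ 5 := by
  have hp1 : 1 < p := Fact.out
  have hp0 : 0 < p := by linarith
  obtain ⟨mφ, u, hu, h1, h2⟩ := hφ
  have hQ := one_le_ofReal_sobolevExp (n := n) (p := p) hpn
  set c := ENNReal.ofReal (4 * ε ^ (p - 2)) with hc
  have hlim : Tendsto (fun k => c * eLpNorm (fun x => ∇ (u k) x - HomSobolev.grad U x)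
      (ENNReal.ofReal p) volume ^ p) atTop (𝓝 0) := by
    have := ENNReal.Tendsto.const_mul (a := c) (h1.ennrpow_const p) (Or.inr ENNReal.ofReal_ne_top)
    simpa [ENNReal.zero_rpow_of_pos hp0] using this
  have hb : ∀ k, ∫⁻ x, ENNReal.ofReal (energyDensity n p a₀ ε ‖∇ (u k) x‖ x) ≤
      4 + c * eLpNorm (fun x => ∇ (u k) x - HomSobolev.grad U x) (ENNReal.ofReal p) volume ^ p := by
    intro k
    have e : eLpNorm (fun x => ∇ (u k) x - HomSobolev.grad U x) (ENNReal.ofReal p) volume ^ p =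
        ∫⁻ x, ‖∇ (u k) x - HomSobolev.grad U x‖ₑ ^ p := by
      rw [eLpNorm_eq_lintegral_rpow_enorm_toReal (by simpa using hp0) ENNReal.ofReal_ne_top,
        ENNReal.toReal_ofReal hp0.le, ← ENNReal.rpow_mul]
      field_simp
      simp
    have hm : AEStronglyMeasurable (fun x => ∇ (u k) x - HomSobolev.grad U x) volume :=
      ((memLp_gradient (hu k) (ENNReal.ofReal p)).sub (HomSobolev.memLp_grad U)).1
    calc _ ≤ ∫⁻ x, (4 * ENNReal.ofReal (energyDensity n p a₀ ε ‖HomSobolev.grad U x‖ x) +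
          c * ‖∇ (u k) x - HomSobolev.grad U x‖ₑ ^ p) := by
          refine lintegral_mono fun x => ?_
          have := energy_le_four_mul_add (p := p) (ε := ε) (t := ‖∇ (bubble n p a₀) x‖)
            (s := ‖HomSobolev.grad U x‖) (s' := ‖∇ (u k) x‖)
            (d := ‖∇ (u k) x - HomSobolev.grad U x‖) hp1 hp2 hε (norm_nonneg _) (norm_nonneg _)
            (norm_nonneg _) (norm_sub_norm_le _ _) (norm_nonneg _)
          refine (ENNReal.ofReal_le_ofReal this).trans (le_of_eq ?_)
          rw [ENNReal.ofReal_add (by positivity) (by positivity)]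
          congr 1
          · rw [ENNReal.ofReal_mul (by norm_num), ENNReal.ofReal_ofNat]; rfl
          · rw [hc, ← ofReal_norm, ENNReal.ofReal_rpow_of_nonneg (norm_nonneg _) hp0.le,
              ← ENNReal.ofReal_mul (by positivity), mul_assoc]
      _ = 4 * (∫⁻ x, ENNReal.ofReal (energyDensity n p a₀ ε ‖HomSobolev.grad U x‖ x)) +
          c * ∫⁻ x, ‖∇ (u k) x - HomSobolev.grad U x‖ₑ ^ p := by
          rw [lintegral_add_right' _ ((hm.enorm.pow_const p).const_mul c),
            lintegral_const_mul' _ _ (by norm_num), lintegral_const_mul' _ _ ENNReal.ofReal_ne_top]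
      _ ≤ _ := by
          rw [e]
          gcongr
          calc _ ≤ (4 : ℝ≥0∞) * 1 := by gcongr
            _ = 4 := mul_one _
  have hev : ∀ᶠ k in atTop, ∫⁻ x, ENNReal.ofReal (energyDensity n p a₀ ε ‖∇ (u k) x‖ x) ≤ 5 := by
    filter_upwards [hlim.eventually (eventually_le_nhds (show (0 : ℝ≥0∞) < 1 by norm_num))] with k hk
    refine (hb k).trans ?_
    calc _ ≤ (4 : ℝ≥0∞) + 1 := by gcongr
      _ = 5 := by norm_num
  obtain ⟨s, hs, hae⟩ := (tendstoInMeasure_of_tendsto_eLpNorm (one_pos.trans_le hQ).ne'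
    (fun k => (memLp_of_isTest (hu k) (ENNReal.ofReal (sobolevExp n p))).1) mφ.1
    (by exact h2)).exists_seq_tendsto_ae
  obtain ⟨K, hK⟩ := eventually_atTop.1 hev
  refine ⟨fun k => u (s (k + K)), fun k => hu _, ?_, fun k => hK _ ?_⟩
  · filter_upwards [hae] with x hx
    exact hx.comp (tendsto_add_atTop_nat K)
  · exact le_trans (Nat.le_add_left _ _) hs.le_apply

/-- The densities are continuous in the value of the function, so they converge a.e. along the
approximation, and `L^r` norms are lower semicontinuous under a.e. convergence. The constant does
not depend on `ε`, although the approximating sequence does. -/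
theorem HomSobolev.Realizes.apriori (hp2 : p < 2) (hpn : p < n) (hn : 2 ≤ n) (ha : 0 < a₀) :
    ∃ C : NNReal, ∀ ε : ℝ, 0 < ε → ∀ (φ : Euc n → ℝ) (U : HomSobolev n p),
      HomSobolev.Realizes φ U →
      ∫⁻ x, ENNReal.ofReal (energyDensity n p a₀ ε ‖HomSobolev.grad U x‖ x) ≤ 1 →
      ∫⁻ x, ENNReal.ofReal (hardyDensity n p a₀ ε (φ x) x) ≤ C ∧
      eLpNorm (fun x => hardyDensity n p a₀ ε (φ x) x) (ENNReal.ofReal (n / (n - 1))) volume ≤ C ∧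
      eLpNorm (fun x => excessDensity n p a₀ ε (φ x) x) (ENNReal.ofReal (sobolevExp n p)) volume ≤
        C * ENNReal.ofReal (ε ^ 2) ^ (1 / p) := by
  have hp1 : 1 < p := Fact.out
  have hp0 : 0 < p := by linarith
  obtain ⟨C₁, h1⟩ := lintegral_hardyDensity_le hp1 hp2 hpn ha
  obtain ⟨C₂, h2⟩ := eLpNorm_hardyDensity_le hp1 hp2 hpn hn ha
  obtain ⟨C₃, h3⟩ := eLpNorm_excessDensity_le hp1 hp2 hpn ha
  refine ⟨C₁ * 5 + C₂ * 5 + C₃ * 5 ^ (1 / p), fun ε hε φ U hφ hE => ?_⟩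
  obtain ⟨u, hu, hae, hb⟩ := hφ.exists_approx hp2 hpn hε hE
  have hu1 : ∀ k, ContDiff ℝ 1 (u k) := fun k => (hu k).1.of_le (by simp)
  have hh : ∀ᵐ x, Tendsto (fun k => hardyDensity n p a₀ ε (u k x) x) atTop
      (𝓝 (hardyDensity n p a₀ ε (φ x) x)) := by
    filter_upwards [hae] with x hx
    exact ((continuous_hardyDensity_left ha x).tendsto _).comp hx
  have hg : ∀ᵐ x, Tendsto (fun k => excessDensity n p a₀ ε (u k x) x) atTop
      (𝓝 (excessDensity n p a₀ ε (φ x) x)) := by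
    filter_upwards [hae] with x hx
    exact ((continuous_excessDensity_left ha x).tendsto _).comp hx
  have hc1 : ((C₁ * 5 : NNReal) : ℝ≥0∞) ≤ (C₁ * 5 + C₂ * 5 + C₃ * 5 ^ (1 / p) : NNReal) := by
    rw [ENNReal.coe_le_coe, add_assoc]; exact le_self_add
  have hc2 : ((C₂ * 5 : NNReal) : ℝ≥0∞) ≤ (C₁ * 5 + C₂ * 5 + C₃ * 5 ^ (1 / p) : NNReal) := by
    rw [ENNReal.coe_le_coe, add_comm (C₁ * 5), add_assoc]; exact le_self_add
  have hc3 : ((C₃ * 5 ^ (1 / p) : NNReal) : ℝ≥0∞) ≤ (C₁ * 5 + C₂ * 5 + C₃ * 5 ^ (1 / p) : NNReal) := by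
    rw [ENNReal.coe_le_coe]; exact le_add_self
  refine ⟨?_, ?_, ?_⟩
  · have e : ∀ f : Euc n → ℝ, (∀ x, 0 ≤ f x) → eLpNorm f 1 volume = ∫⁻ x, ENNReal.ofReal (f x) := by
      intro f hf
      rw [eLpNorm_one_eq_lintegral_enorm]
      exact lintegral_congr fun x => Real.enorm_of_nonneg (hf x)
    rw [← e _ fun x => hardyDensity_nonneg ha _ x]
    refine Lp.eLpNorm_le_of_ae_tendsto (u := atTop) (Eventually.of_forall fun k => ?_) (fun k =>
      (contDiff_hardyDensity hp1 ha (hu1 k)).continuous.aestronglyMeasurable) hh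
    rw [e _ fun x => hardyDensity_nonneg ha _ x]
    refine (h1 ε hε _ (hu k)).trans (le_trans ?_ hc1)
    push_cast
    gcongr
    exact hb k
  · refine Lp.eLpNorm_le_of_ae_tendsto (u := atTop) (Eventually.of_forall fun k => ?_) (fun k =>
      (contDiff_hardyDensity hp1 ha (hu1 k)).continuous.aestronglyMeasurable) hh
    refine (h2 ε hε _ (hu k)).trans (le_trans ?_ hc2)
    push_cast
    gcongr
    exact hb k
  · refine Lp.eLpNorm_le_of_ae_tendsto (u := atTop) (Eventually.of_forall fun k => ?_) (fun k =>
      (contDiff_excessDensity hp1 ha (hu1 k)).continuous.aestronglyMeasurable) hg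
    refine (h3 ε hε _ (hu k)).trans ?_
    calc _ ≤ (C₃ : ℝ≥0∞) * (ENNReal.ofReal (ε ^ 2) * 5) ^ (1 / p) := by
          gcongr; exact hb k
      _ = ((C₃ * 5 ^ (1 / p) : NNReal) : ℝ≥0∞) * ENNReal.ofReal (ε ^ 2) ^ (1 / p) := by
          rw [ENNReal.mul_rpow_of_nonneg _ _ (by positivity)]
          push_cast
          rw [ENNReal.coe_rpow_of_nonneg _ (by positivity)]
          push_cast
          ring
      _ ≤ _ := by gcongr

theorem HomSobolev.Realizes.lintegral_translate_sub_le (hpn : p < n) {φ : Euc n → ℝ}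
    {U : HomSobolev n p} (hφ : HomSobolev.Realizes φ U) (y : Euc n) (R : ℝ) :
    ∫⁻ x in Metric.ball 0 R, ‖φ (x + y) - φ x‖ₑ ≤
      ‖y‖ₑ * (eLpNorm (HomSobolev.grad U) (ENNReal.ofReal p) volume *
        volume (Metric.ball (0 : Euc n) R) ^ (1 - 1 / p)) := by
  have hp1 : 1 < p := Fact.out
  obtain ⟨mφ, u, hu, h1, h2⟩ := hφ
  have hQ := one_le_ofReal_sobolevExp (n := n) (p := p) hpn
  have hP : 1 ≤ ENNReal.ofReal p := Fact.out
  obtain ⟨s, hs, hae⟩ := (tendstoInMeasure_of_tendsto_eLpNorm (one_pos.trans_le hQ).ne'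
    (fun k => (memLp_of_isTest (hu k) (ENNReal.ofReal (sobolevExp n p))).1) mφ.1
    (by exact h2)).exists_seq_tendsto_ae
  have hae2 : ∀ᵐ x : Euc n, Tendsto (fun k => u (s k) (x + y)) atTop (𝓝 (φ (x + y))) :=
    (measurePreserving_add_right volume y).quasiMeasurePreserving.ae hae
  have hlim : ∀ᵐ x : Euc n ∂(volume.restrict (Metric.ball 0 R)),
      Tendsto (fun k => u (s k) (x + y) - u (s k) x) atTop (𝓝 (φ (x + y) - φ x)) :=
    ae_restrict_of_ae (by filter_upwards [hae, hae2] with x h h' using h'.sub h)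
  have hmeas : ∀ k, AEStronglyMeasurable (fun x => u (s k) (x + y) - u (s k) x)
      (volume.restrict (Metric.ball 0 R)) := fun k =>
    (((hu (s k)).1.continuous.comp (continuous_id.add continuous_const)).sub
      (hu (s k)).1.continuous).aestronglyMeasurable
  have hV : volume (Metric.ball (0 : Euc n) R) ^ (1 - 1 / p) ≠ ⊤ :=
    ENNReal.rpow_ne_top_of_nonneg (sub_nonneg.2 (by rw [div_le_one (by linarith)]; exact hp1.le))
      measure_ball_lt_top.ne
  have hlim2 : Tendsto (fun k => ‖y‖ₑ *
      ((eLpNorm (fun x => ∇ (u (s k)) x - HomSobolev.grad U x) (ENNReal.ofReal p) volume +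
        eLpNorm (HomSobolev.grad U) (ENNReal.ofReal p) volume) *
        volume (Metric.ball (0 : Euc n) R) ^ (1 - 1 / p))) atTop (𝓝 (‖y‖ₑ *
      ((0 + eLpNorm (HomSobolev.grad U) (ENNReal.ofReal p) volume) *
        volume (Metric.ball (0 : Euc n) R) ^ (1 - 1 / p)))) :=
    ENNReal.Tendsto.const_mul (ENNReal.Tendsto.mul_const ((h1.comp hs.tendsto_atTop).add
      tendsto_const_nhds) (Or.inr hV)) (Or.inr enorm_ne_top)
  rw [zero_add] at hlim2
  rw [← eLpNorm_one_eq_lintegral_enorm]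
  -- Lower semicontinuity takes a bound that holds eventually; the slack `η` turns the convergence
  -- of the right-hand sides into such a bound.
  refine ENNReal.le_of_forall_pos_le_add fun η hη _ => ?_
  refine Lp.eLpNorm_le_of_ae_tendsto (u := atTop) ?_ hmeas hlim
  have hne : ‖y‖ₑ * (eLpNorm (HomSobolev.grad U) (ENNReal.ofReal p) volume *
        volume (Metric.ball (0 : Euc n) R) ^ (1 - 1 / p)) ≠ ⊤ :=
    ENNReal.mul_ne_top enorm_ne_top (ENNReal.mul_ne_top (HomSobolev.memLp_grad U).2.ne hV)
  have hlt := ENNReal.lt_add_right hne (ENNReal.coe_ne_zero.2 hη.ne')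
  filter_upwards [hlim2.eventually (eventually_le_nhds hlt)] with k hk
  refine le_trans ?_ hk
  rw [eLpNorm_one_eq_lintegral_enorm]
  refine (_root_.lintegral_translate_sub_le hp1 (hu (s k)) y R).trans ?_
  gcongr
  have e2 : ∇ (u (s k)) = (fun x => ∇ (u (s k)) x - HomSobolev.grad U x) + HomSobolev.grad U := by
    ext x; simp
  conv_lhs => rw [e2]
  exact eLpNorm_add_le ((memLp_gradient (hu _) (ENNReal.ofReal p)).sub (HomSobolev.memLp_grad U)).1
    (HomSobolev.memLp_grad U).1 hP

/-- Well defined because realizations are unique a.e., and bounded by Hölder on `B` followed by the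
Sobolev inequality. These functionals transfer weak convergence of gradients to averages of the
functions. -/
theorem HomSobolev.exists_setIntegral_functional (hpn : p < n) (B : Set (Euc n))
    (hB : volume B ≠ ⊤) :
    ∃ l : StrongDual ℝ (HomSobolev n p), ∀ (φ : Euc n → ℝ) (U : HomSobolev n p),
      HomSobolev.Realizes φ U → l U = ∫ x in B, φ x := by
  have hp1 : 1 < p := Fact.out
  have hQ := one_le_ofReal_sobolevExp (n := n) (p := p) hpn
  have hq := lt_sobolevExp hp1 hpn
  obtain ⟨C, hC⟩ := HomSobolev.Realizes.eLpNorm_le (n := n) (p := p) hpn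
  choose Φ hΦ using fun U : HomSobolev n p => HomSobolev.exists_realizes hpn U
  have hfin : IsFiniteMeasure ((volume : Measure (Euc n)).restrict B) := ⟨by simpa using hB.lt_top⟩
  have hint : ∀ U, IntegrableOn (Φ U) B := fun U =>
    ((hΦ U).1.restrict B).integrable hQ
  let L : HomSobolev n p →ₗ[ℝ] ℝ :=
    { toFun := fun U => ∫ x in B, Φ U x
      map_add' := fun U V => by
        rw [← integral_add (hint U) (hint V)]
        exact integral_congr_ae (ae_restrict_of_ae ((hΦ _).ae_eq hpn ((hΦ U).add hpn (hΦ V))))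
      map_smul' := fun c U => by
        rw [RingHom.id_apply, smul_eq_mul, ← integral_const_mul]
        exact integral_congr_ae (ae_restrict_of_ae ((hΦ _).ae_eq hpn ((hΦ U).const_smul c))) }
  set V := volume B ^ (1 - 1 / sobolevExp n p) with hVdef
  have hV : V ≠ ⊤ := ENNReal.rpow_ne_top_of_nonneg (sub_nonneg.2 (by
    rw [div_le_one (by linarith)]; linarith)) hB
  have hbound : ∀ U, ‖L U‖ ≤ (C * V.toReal) * ‖U‖ := by
    intro U
    have h1 : ‖L U‖ₑ ≤ C * ENNReal.ofReal ‖U‖ * V := by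
      refine (enorm_integral_le_lintegral_enorm _).trans ?_
      rw [← eLpNorm_one_eq_lintegral_enorm]
      refine (eLpNorm_le_eLpNorm_mul_rpow_measure_univ hQ (hint U).1).trans ?_
      rw [Measure.restrict_apply_univ, ENNReal.toReal_ofReal (by linarith), ENNReal.toReal_one,
        div_one]
      gcongr
      refine (eLpNorm_mono_measure _ Measure.restrict_le_self).trans ?_
      rw [← HomSobolev.eLpNorm_grad]
      exact hC _ _ (hΦ U)
    have h2 := ENNReal.toReal_mono (ENNReal.mul_ne_top (ENNReal.mul_ne_top ENNReal.coe_ne_top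
      ENNReal.ofReal_ne_top) hV) h1
    rw [toReal_enorm, ENNReal.toReal_mul, ENNReal.toReal_mul, ENNReal.coe_toReal,
      ENNReal.toReal_ofReal (norm_nonneg _)] at h2
    linarith
  refine ⟨L.mkContinuous _ hbound, fun φ U hφ => ?_⟩
  change ∫ x in B, Φ U x = _
  exact integral_congr_ae (ae_restrict_of_ae ((hΦ U).ae_eq hpn hφ))

end Transfer

/-! ### Weak compactness -/

/-- Sequential Banach–Alaoglu in the dual of a separable Hilbert space, carried back by the Riesz
isometry. -/
theorem exists_subseq_weak_tendsto {H : Type*} [NormedAddCommGroup H] [InnerProductSpace ℝ H]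
    [CompleteSpace H] [SecondCountableTopology H] {F : ℕ → H} {B : ℝ} (hF : ∀ i, ‖F i‖ ≤ B) :
    ∃ (s : ℕ → ℕ) (F₀ : H), StrictMono s ∧
      ∀ l : StrongDual ℝ H, Tendsto (fun k => l (F (s k))) atTop (𝓝 (l F₀)) := by
  have hc := WeakDual.isSeqCompact_closedBall (𝕜 := ℝ) (E := H) 0 B
  obtain ⟨a, -, s, hs, hlim⟩ := hc (x := fun i =>
    StrongDual.toWeakDual (InnerProductSpace.toDual ℝ H (F i))) (fun i => by
      simpa using hF i)
  refine ⟨s, (InnerProductSpace.toDual ℝ H).symm (WeakDual.toStrongDual a), hs, fun l => ?_⟩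
  have h := ((WeakDual.eval_continuous ((InnerProductSpace.toDual ℝ H).symm l)).tendsto a).comp hlim
  have e : ∀ x : H, l x = InnerProductSpace.toDual ℝ H x ((InnerProductSpace.toDual ℝ H).symm l) := by
    intro x
    rw [InnerProductSpace.toDual_apply_apply, real_inner_comm,
      InnerProductSpace.toDual_symm_apply]
  rw [e, LinearIsometryEquiv.apply_symm_apply]
  simp_rw [e]
  exact h

/-- A closed subspace is weakly closed by Hahn–Banach separation, and each functional on it extends
to the whole space, so weak convergence may be tested inside the subspace. -/
theorem Submodule.exists_weak_limit_mem {E : Type*} [NormedAddCommGroup E] [NormedSpace ℝ E]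
    (S : Submodule ℝ E) (hS : IsClosed (S : Set E)) {U : ℕ → S} {x : E}
    (h : ∀ l : StrongDual ℝ E, Tendsto (fun k => l (U k)) atTop (𝓝 (l x))) :
    ∃ V : S, ∀ l : StrongDual ℝ S, Tendsto (fun k => l (U k)) atTop (𝓝 (l V)) := by
  have hx : x ∈ S := by
    by_contra hx
    obtain ⟨f, c, hf1, hf2⟩ := geometric_hahn_banach_point_closed S.convex hS hx
    exact absurd (ge_of_tendsto' (h f) fun k => (hf2 _ (U k).2).le) (not_le.2 hf1)
  refine ⟨⟨x, hx⟩, fun l => ?_⟩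
  obtain ⟨g, hg, -⟩ := exists_extension_norm_eq S l
  simp_rw [← hg]
  exact h g

section WeakCompactness

variable {n : ℕ} {p a₀ : ℝ}

theorem continuous_norm_gradient_bubble (hp1 : 1 < p) :
    Continuous fun x => ‖∇ (bubble n p a₀) x‖ := by
  simp_rw [norm_gradient_eq]
  exact ((contDiff_bubble hp1).continuous_fderiv one_ne_zero).norm

/-- The exponent is the one with `(2-p)/(2p) + 1/2 = 1/p`, so multiplication by this function maps
`L²` to `L^p`; the claim reduces to `∫ |Dv|^p < ∞`. -/
theorem memLp_norm_gradient_bubble_rpow (hp1 : 1 < p) (hp2 : p < 2) (hpn : p < n) (ha : 0 < a₀) :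
    MemLp (fun x : Euc n => ‖∇ (bubble n p a₀) x‖ ^ ((2 - p) / 2))
      (ENNReal.ofReal (2 * p / (2 - p))) volume := by
  have h2 : 0 < 2 - p := by linarith
  have hr : 0 < 2 * p / (2 - p) := by positivity
  have hcont : Continuous fun x : Euc n => ‖∇ (bubble n p a₀) x‖ ^ ((2 - p) / 2) :=
    (continuous_norm_gradient_bubble hp1).rpow_const fun x => Or.inr (by positivity)
  have hint : Integrable (fun x : Euc n => ‖∇ (bubble n p a₀) x‖ ^ p) := by
    refine ((integrable_bubbleWeight_rpow hp1 hpn).const_mul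
      (((n - p) / (p - 1)) ^ p * a₀ ^ p)).mono' ?_ (Eventually.of_forall fun x => ?_)
    · exact ((continuous_norm_gradient_bubble hp1).rpow_const fun x =>
        Or.inr (by linarith)).aestronglyMeasurable
    · rw [Real.norm_of_nonneg (by positivity)]
      exact norm_gradient_bubble_rpow_le_weight hp1 hpn ha x
  rw [← integrable_norm_rpow_iff hcont.aestronglyMeasurable (by simpa using hr)
    ENNReal.ofReal_ne_top, ENNReal.toReal_ofReal hr.le]
  refine hint.congr (Eventually.of_forall fun x => ?_)
  simp only
  rw [Real.norm_of_nonneg (by positivity), ← Real.rpow_mul (norm_nonneg _)]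
  congr 1
  field_simp

variable [Fact (1 < p)]

-- Split the gradient according to whether `ε|DU| ≤ w`. On that set it equals `w^((2-p)/2) f`, where
-- `f = w^((p-2)/2) DU` is bounded in `L²` by the quadratic regime of the energy. Off it, the
-- `p`-growth regime gives an `L^p` norm to the power `p` of at most `2 ε^(2-p)`, which tends to
-- zero as `p < 2`. A bounded linear map sends weak limits of the `f` in `L²` to weak limits in
-- `L^p`.
set_option maxHeartbeats 800000 in
theorem HomSobolev.exists_weak_subseq (hp2 : p < 2) (hpn : p < n) (ha : 0 < a₀) {ε : ℕ → ℝ}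
    (hε : ∀ i, 0 < ε i) (hε_lim : Tendsto ε atTop (𝓝 0)) (U : ℕ → HomSobolev n p)
    (hE : ∀ i, ∫⁻ x, ENNReal.ofReal
      (energyDensity n p a₀ (ε i) ‖HomSobolev.grad (U i) x‖ x) ≤ 1) :
    ∃ s : ℕ → ℕ, StrictMono s ∧ (∃ B : ℝ, ∀ i, ‖U i‖ ≤ B) ∧ ∃ Ψ : HomSobolev n p,
      ∀ l : StrongDual ℝ (HomSobolev n p), Tendsto (fun k => l (U (s k))) atTop (𝓝 (l Ψ)) := by
  have hp1 : 1 < p := Fact.out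
  have hp0 : 0 < p := by linarith
  have h2p : 0 < 2 - p := by linarith
  set w : Euc n → ℝ := fun x => ‖∇ (bubble n p a₀) x‖ with hw
  have hwc : Continuous w := continuous_norm_gradient_bubble hp1
  have hw0 : ∀ x, 0 ≤ w x := fun x => norm_nonneg _
  have hGm : ∀ i, StronglyMeasurable (HomSobolev.grad (U i)) := fun i => Lp.stronglyMeasurable _
  set S : ℕ → Set (Euc n) := fun i => {x | ε i * ‖HomSobolev.grad (U i) x‖ ≤ w x} with hS
  have hSm : ∀ i, MeasurableSet (S i) := fun i =>
    measurableSet_le ((hGm i).norm.measurable.const_mul _) hwc.measurable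
  set f : ℕ → Euc n → Euc n := fun i =>
    (S i).indicator fun x => w x ^ ((p - 2) / 2) • HomSobolev.grad (U i) x with hf
  have hfm : ∀ i, StronglyMeasurable (f i) := fun i =>
    ((hwc.measurable.pow_const _).stronglyMeasurable.smul (hGm i)).indicator (hSm i)
  have hf2 : ∀ i x, ‖f i x‖ ^ 2 ≤ 2 * energyDensity n p a₀ (ε i) ‖HomSobolev.grad (U i) x‖ x := by
    intro i x
    have he := energyDensity_nonneg (n := n) (p := p) (a₀ := a₀) (hε i)
      (norm_nonneg (HomSobolev.grad (U i) x)) x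
    by_cases hx : x ∈ S i
    · have hx' : ε i * ‖HomSobolev.grad (U i) x‖ ≤ w x := hx
      rw [hf]
      simp only [indicator_of_mem hx]
      rw [norm_smul, mul_pow, Real.norm_of_nonneg (by have := hw0 x; positivity),
        ← Real.rpow_natCast, ← Real.rpow_mul (hw0 x)]
      rcases (hw0 x).eq_or_lt with h0 | h0
      · have : ‖HomSobolev.grad (U i) x‖ = 0 := by
          have := norm_nonneg (HomSobolev.grad (U i) x)
          have := hε i
          nlinarith
        rw [this] at he ⊢
        simpa using he
      · have := weight_mul_sq_le_two_mul_energy hp1 hp2 (hε i)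
          (norm_nonneg (HomSobolev.grad (U i) x)) h0 hx'
        rw [show (p - 2) / 2 * ((2 : ℕ) : ℝ) = p - 2 by push_cast; ring]
        exact this
    · rw [hf]
      simp only [indicator_of_notMem hx]
      simpa using he
  have hfL : ∀ i, eLpNorm (f i) 2 volume ≤ 2 := by
    intro i
    have h : eLpNorm (f i) 2 volume ^ (2 : ℝ) ≤ 2 := by
      rw [eLpNorm_eq_lintegral_rpow_enorm_toReal (by norm_num) (by norm_num), ← ENNReal.rpow_mul]
      norm_num
      calc ∫⁻ x, ‖f i x‖ₑ ^ 2 ≤ ∫⁻ x, 2 * ENNReal.ofReal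
            (energyDensity n p a₀ (ε i) ‖HomSobolev.grad (U i) x‖ x) := by
            refine lintegral_mono fun x => ?_
            rw [← ofReal_norm, ← ENNReal.ofReal_pow (norm_nonneg _)]
            refine (ENNReal.ofReal_le_ofReal (hf2 i x)).trans (le_of_eq ?_)
            rw [ENNReal.ofReal_mul (by norm_num), ENNReal.ofReal_ofNat]
        _ = 2 * ∫⁻ x, ENNReal.ofReal
            (energyDensity n p a₀ (ε i) ‖HomSobolev.grad (U i) x‖ x) :=
            lintegral_const_mul' _ _ (by norm_num)
        _ ≤ 2 * 1 := by gcongr; exact hE i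
        _ = 2 := mul_one _
    by_contra hcon
    push Not at hcon
    have h4 : (2 : ℝ≥0∞) ^ (2 : ℝ) ≤ 2 := (ENNReal.rpow_le_rpow hcon.le (by norm_num)).trans h
    norm_num at h4
  have hfMem : ∀ i, MemLp (f i) 2 volume := fun i =>
    ⟨(hfm i).aestronglyMeasurable, (hfL i).trans_lt (by norm_num)⟩
  set F : ℕ → Lp (Euc n) 2 (volume : Measure (Euc n)) := fun i => (hfMem i).toLp (f i) with hF
  have hFn : ∀ i, ‖F i‖ ≤ 2 := by
    intro i
    rw [hF, Lp.norm_toLp]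
    exact ENNReal.toReal_le_of_le_ofReal (by norm_num) (by simpa using hfL i)
  have hr1 : Fact (1 ≤ ENNReal.ofReal (2 * p / (2 - p))) := ⟨ENNReal.one_le_ofReal.2 (by
    rw [le_div_iff₀ h2p]; linarith)⟩
  have htr : ENNReal.HolderTriple (ENNReal.ofReal (2 * p / (2 - p))) 2 (ENNReal.ofReal p) := ⟨by
    rw [← ENNReal.ofReal_inv_of_pos (by positivity), ← ENNReal.ofReal_inv_of_pos hp0,
      show (2 : ℝ≥0∞)⁻¹ = ENNReal.ofReal (2⁻¹) by
        rw [ENNReal.ofReal_inv_of_pos (by norm_num), ENNReal.ofReal_ofNat],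
      ← ENNReal.ofReal_add (by positivity) (by positivity)]
    congr 1
    field_simp
    ring⟩
  set J : Lp (Euc n) 2 (volume : Measure (Euc n)) →L[ℝ]
      Lp (Euc n) (ENNReal.ofReal p) (volume : Measure (Euc n)) :=
    (ContinuousLinearMap.lsmul ℝ ℝ (E := Euc n)).holderL volume
      (ENNReal.ofReal (2 * p / (2 - p))) 2 (ENNReal.ofReal p)
      ((memLp_norm_gradient_bubble_rpow hp1 hp2 hpn ha).toLp _) with hJ
  have hJF : ∀ i, J (F i) =ᵐ[volume] (S i).indicator (HomSobolev.grad (U i)) := by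
    intro i
    have h1 := (ContinuousLinearMap.lsmul ℝ ℝ (E := Euc n)).coeFn_holder (r := ENNReal.ofReal p)
      ((memLp_norm_gradient_bubble_rpow hp1 hp2 hpn ha).toLp _) (F i)
    filter_upwards [h1, (memLp_norm_gradient_bubble_rpow hp1 hp2 hpn ha).coeFn_toLp,
      (hfMem i).coeFn_toLp] with x e1 e2 e3
    refine e1.trans ?_
    rw [e2, hF]
    simp only
    rw [e3, hf]
    simp only [ContinuousLinearMap.lsmul_apply]
    by_cases hx : x ∈ S i
    · have hx' : ε i * ‖HomSobolev.grad (U i) x‖ ≤ w x := hx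
      simp only [indicator_of_mem hx]
      -- Where `w = 0` the two powers of `w` do not cancel, but membership in `S i` forces the
      -- gradient to vanish there.
      rcases (hw0 x).eq_or_lt with h0 | h0
      · have : ‖HomSobolev.grad (U i) x‖ = 0 := by
          have := norm_nonneg (HomSobolev.grad (U i) x)
          have := hε i
          nlinarith
        rw [norm_eq_zero.1 this]; simp
      · rw [smul_smul, ← Real.rpow_add h0]
        ring_nf
        simp
    · simp only [indicator_of_notMem hx, smul_zero]
  set R : ℕ → Lp (Euc n) (ENNReal.ofReal p) (volume : Measure (Euc n)) :=
    fun i => (U i : Lp (Euc n) (ENNReal.ofReal p) (volume : Measure (Euc n))) - J (F i) with hR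
  have hRb : ∀ i, ‖R i‖ₑ ^ p ≤ ENNReal.ofReal (2 * ε i ^ (2 - p)) := by
    intro i
    have e : R i =ᵐ[volume] (S i)ᶜ.indicator (HomSobolev.grad (U i)) := by
      filter_upwards [Lp.coeFn_sub (U i : Lp (Euc n) (ENNReal.ofReal p) (volume : Measure (Euc n)))
        (J (F i)), hJF i] with x h1 h2
      rw [hR]
      simp only
      rw [h1, Pi.sub_apply, h2]
      change HomSobolev.grad (U i) x - _ = _
      by_cases hx : x ∈ S i <;> simp [hx]
    rw [Lp.enorm_def, eLpNorm_congr_ae e,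
      eLpNorm_eq_lintegral_rpow_enorm_toReal (by simpa using hp0) ENNReal.ofReal_ne_top,
      ENNReal.toReal_ofReal hp0.le, ← ENNReal.rpow_mul, one_div, inv_mul_cancel₀ hp0.ne',
      ENNReal.rpow_one]
    calc _ ≤ ∫⁻ x, ENNReal.ofReal (2 * ε i ^ (2 - p)) * ENNReal.ofReal
            (energyDensity n p a₀ (ε i) ‖HomSobolev.grad (U i) x‖ x) := by
          refine lintegral_mono fun x => ?_
          by_cases hx : x ∈ S i
          · simp [hx, ENNReal.zero_rpow_of_pos hp0]
          · have hx' : w x < ε i * ‖HomSobolev.grad (U i) x‖ := not_le.1 hx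
            have hy : 0 < ‖HomSobolev.grad (U i) x‖ := by
              by_contra hcon
              have := hw0 x
              have := hε i
              nlinarith
            rw [indicator_of_mem (mem_compl hx), ← ofReal_norm,
              ENNReal.ofReal_rpow_of_nonneg (norm_nonneg _) hp0.le,
              ← ENNReal.ofReal_mul (by have := hε i; positivity)]
            refine ENNReal.ofReal_le_ofReal ?_
            have h1 := rpow_le_two_mul_energy hp1 hp2 (hε i) hy (hw0 x) hx'.le
            have h3 : ε i ^ (2 - p) * ε i ^ (p - 2) = 1 := by
              rw [← Real.rpow_add (hε i)]; norm_num
            have h4 : 0 < ε i ^ (2 - p) := Real.rpow_pos_of_pos (hε i) _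
            calc ‖HomSobolev.grad (U i) x‖ ^ p
                = ε i ^ (2 - p) * (ε i ^ (p - 2) * ‖HomSobolev.grad (U i) x‖ ^ p) := by
                  rw [← mul_assoc, h3, one_mul]
              _ ≤ ε i ^ (2 - p) * (2 * energyDensity n p a₀ (ε i) ‖HomSobolev.grad (U i) x‖ x) := by
                  exact mul_le_mul_of_nonneg_left h1 h4.le
              _ = _ := by ring
      _ = ENNReal.ofReal (2 * ε i ^ (2 - p)) * ∫⁻ x, ENNReal.ofReal
            (energyDensity n p a₀ (ε i) ‖HomSobolev.grad (U i) x‖ x) :=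
          lintegral_const_mul' _ _ ENNReal.ofReal_ne_top
      _ ≤ ENNReal.ofReal (2 * ε i ^ (2 - p)) * 1 := by gcongr; exact hE i
      _ = _ := mul_one _
  -- The remainder tends to zero in norm, so it affects neither the boundedness nor the weak limit.
  have hR0 : Tendsto R atTop (𝓝 0) := by
    have h1 : Tendsto (fun i => 2 * ε i ^ (2 - p)) atTop (𝓝 0) := by
      have := (hε_lim.rpow_const (Or.inr h2p.le)).const_mul 2
      simpa [Real.zero_rpow h2p.ne'] using this
    have h2 : Tendsto (fun i => ‖R i‖ₑ ^ p) atTop (𝓝 0) :=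
      tendsto_of_tendsto_of_tendsto_of_le_of_le tendsto_const_nhds
        (by simpa using ENNReal.tendsto_ofReal h1) (fun _ => zero_le) hRb
    have h3 := h2.ennrpow_const p⁻¹
    simp_rw [← ENNReal.rpow_mul, mul_inv_cancel₀ hp0.ne', ENNReal.rpow_one] at h3
    rw [ENNReal.zero_rpow_of_pos (by positivity)] at h3
    rw [tendsto_iff_enorm_sub_tendsto_zero]
    simpa using h3
  have hdec : ∀ i, (U i : Lp (Euc n) (ENNReal.ofReal p) (volume : Measure (Euc n))) =
      J (F i) + R i := fun i => (add_sub_cancel _ _).symm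
  have h2top : Fact ((2 : ℝ≥0∞) ≠ ⊤) := ⟨by norm_num⟩
  obtain ⟨s, F₀, hs, hlim⟩ := exists_subseq_weak_tendsto hFn
  refine ⟨s, hs, ?_, ?_⟩
  · obtain ⟨b, hb⟩ := hR0.norm.bddAbove_range
    refine ⟨‖J‖ * 2 + b, fun i => ?_⟩
    have : ‖U i‖ = ‖J (F i) + R i‖ := by rw [← hdec]; rfl
    rw [this]
    refine (norm_add_le _ _).trans (add_le_add ?_ (hb (mem_range_self i)))
    exact (J.le_opNorm _).trans (by gcongr; exact hFn i)
  · refine Submodule.exists_weak_limit_mem (HomSobolev n p)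
      (Submodule.isClosed_topologicalClosure _) (U := fun k => U (s k)) (x := J F₀) fun l => ?_
    have h1 := hlim (l.comp J)
    have h2 := ((l.continuous.tendsto 0).comp hR0).comp hs.tendsto_atTop
    have h3 := h1.add h2
    rw [map_zero, add_zero] at h3
    refine h3.congr fun k => ?_
    rw [hdec, map_add]; rfl

end WeakCompactness

/-! ### Local strong convergence -/

/-- Choose the subsequence so that the `k`-th integral over the ball of radius `k` is at most
`2^(-k)`. The sum of the truncated functions is integrable, so its terms vanish in the limit a.e.,
and each point eventually lies in all the balls. -/
theorem ae_tendsto_zero_of_lintegral_ball {n : ℕ} {θ : ℕ → Euc n → ℝ}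
    (hm : ∀ i, AEStronglyMeasurable (θ i) volume)
    (h : ∀ R : ℝ, Tendsto (fun i => ∫⁻ x in Metric.ball 0 R, ‖θ i x‖ₑ) atTop (𝓝 0)) :
    ∃ s : ℕ → ℕ, StrictMono s ∧ ∀ᵐ x, Tendsto (fun k => θ (s k) x) atTop (𝓝 0) := by
  obtain ⟨s, hs, hb⟩ := extraction_forall_of_eventually
    (P := fun k i => ∫⁻ x in Metric.ball (0 : Euc n) k, ‖θ i x‖ₑ ≤ (2⁻¹ : ℝ≥0∞) ^ k) fun k =>
    ENNReal.tendsto_nhds_zero.1 (h k) _ (ENNReal.pow_pos (by norm_num) k)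
  refine ⟨s, hs, ?_⟩
  have hmeas : ∀ k : ℕ, AEMeasurable
      ((Metric.ball (0 : Euc n) k).indicator fun x => ‖θ (s k) x‖ₑ) volume := fun k =>
    (hm (s k)).enorm.indicator measurableSet_ball
  have hsum : ∫⁻ x, ∑' k : ℕ, (Metric.ball (0 : Euc n) k).indicator (fun x => ‖θ (s k) x‖ₑ) x ≠ ⊤ := by
    rw [lintegral_tsum hmeas]
    refine ne_top_of_le_ne_top ?_ (ENNReal.tsum_le_tsum fun k => ?_) (b := ∑' k, (2⁻¹ : ℝ≥0∞) ^ k)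
    · rw [ENNReal.tsum_geometric]; simp
    · rw [lintegral_indicator measurableSet_ball]; exact hb k
  filter_upwards [ae_lt_top' (AEMeasurable.tsum hmeas) hsum] with x hx
  have h0 := ENNReal.tendsto_atTop_zero_of_tsum_ne_top hx.ne
  rw [tendsto_zero_iff_enorm_tendsto_zero]
  obtain ⟨m, hm⟩ := exists_nat_gt ‖x‖
  refine h0.congr' ?_
  filter_upwards [eventually_ge_atTop m] with k hk
  rw [indicator_of_mem]
  rw [mem_ball_zero_iff]
  exact hm.trans_le (by exact_mod_cast hk)

section LocalConvergence

variable {n : ℕ} {p : ℝ} [Fact (1 < p)]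

theorem HomSobolev.Realizes.congr {φ ψ : Euc n → ℝ} {U : HomSobolev n p}
    (hφ : HomSobolev.Realizes φ U) (h : φ =ᵐ[volume] ψ) : HomSobolev.Realizes ψ U := by
  obtain ⟨mφ, u, hu, h1, h2⟩ := hφ
  refine ⟨(memLp_congr_ae h).1 mφ, u, hu, h1, h2.congr fun k => eLpNorm_congr_ae ?_⟩
  filter_upwards [h] with x hx
  rw [hx]

/-- For fixed `x` the inner integral is a bounded functional applied to `V i`, so it tends to zero
by weak convergence; Sobolev and Hölder bound it uniformly in `x` and `i`, so dominated convergence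
applies on the ball. -/
theorem HomSobolev.tendsto_lintegral_average (hpn : p < n) {θ : ℕ → Euc n → ℝ}
    {V : ℕ → HomSobolev n p} (hθ : ∀ i, HomSobolev.Realizes (θ i) (V i))
    (hm : ∀ i, StronglyMeasurable (θ i)) {B : ℝ} (hB : ∀ i, ‖V i‖ ≤ B)
    (hweak : ∀ l : StrongDual ℝ (HomSobolev n p), Tendsto (fun i => l (V i)) atTop (𝓝 0))
    (R δ : ℝ) :
    Tendsto (fun i => ∫⁻ x in Metric.ball 0 R, ‖∫ y in Metric.ball 0 δ, θ i (x + y)‖ₑ) atTop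
      (𝓝 0) := by
  have hp1 : 1 < p := Fact.out
  have hQ := one_le_ofReal_sobolevExp (n := n) (p := p) hpn
  have hq := lt_sobolevExp hp1 hpn
  obtain ⟨C, hC⟩ := HomSobolev.Realizes.eLpNorm_le (n := n) (p := p) hpn
  set K : ℝ≥0∞ := C * ENNReal.ofReal B *
    volume (Metric.ball (0 : Euc n) δ) ^ (1 - 1 / sobolevExp n p) with hK
  have hKtop : K ≠ ⊤ := ENNReal.mul_ne_top (ENNReal.mul_ne_top ENNReal.coe_ne_top
    ENNReal.ofReal_ne_top) (ENNReal.rpow_ne_top_of_nonneg (sub_nonneg.2 (by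
      rw [div_le_one (by linarith)]; linarith)) measure_ball_lt_top.ne)
  have hbound : ∀ i x, ‖∫ y in Metric.ball 0 δ, θ i (x + y)‖ₑ ≤ K := by
    intro i x
    have hmp := measurePreserving_add_left (volume : Measure (Euc n)) x
    refine (enorm_integral_le_lintegral_enorm _).trans ?_
    rw [← eLpNorm_one_eq_lintegral_enorm]
    refine (eLpNorm_le_eLpNorm_mul_rpow_measure_univ hQ
      ((hm i).comp_measurable (measurable_const_add x)).aestronglyMeasurable).trans ?_
    rw [Measure.restrict_apply_univ, ENNReal.toReal_ofReal (by linarith), ENNReal.toReal_one,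
      div_one]
    rw [hK]
    gcongr
    refine (eLpNorm_mono_measure _ Measure.restrict_le_self).trans ?_
    rw [eLpNorm_comp_measurePreserving (hm i).aestronglyMeasurable hmp]
    refine (hC _ _ (hθ i)).trans ?_
    rw [HomSobolev.eLpNorm_grad]
    gcongr
    exact hB i
  have hpt : ∀ x, Tendsto (fun i => ‖∫ y in Metric.ball 0 δ, θ i (x + y)‖ₑ) atTop (𝓝 0) := by
    intro x
    obtain ⟨l, hl⟩ := HomSobolev.exists_setIntegral_functional (p := p) hpn (Metric.ball x δ)
      measure_ball_lt_top.ne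
    have e : ∀ i, ∫ y in Metric.ball 0 δ, θ i (x + y) = l (V i) := by
      intro i
      have hmp := measurePreserving_add_left (volume : Measure (Euc n)) x
      rw [hl _ _ (hθ i), ← hmp.setIntegral_preimage_emb (measurableEmbedding_addLeft x) (θ i)
        (Metric.ball x δ)]
      have : (fun y => x + y) ⁻¹' Metric.ball x δ = Metric.ball 0 δ := by
        ext y; simp
      rw [this]
    simp_rw [e]
    exact tendsto_zero_iff_enorm_tendsto_zero.1 (hweak l)
  have hlim := tendsto_lintegral_of_dominated_convergence
    (μ := volume.restrict (Metric.ball (0 : Euc n) R)) (fun _ => K)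
    (F := fun i x => ‖∫ y in Metric.ball 0 δ, θ i (x + y)‖ₑ) (f := fun _ => 0)
    (fun i => by
      have : StronglyMeasurable (fun z : Euc n × Euc n => θ i (z.1 + z.2)) :=
        (hm i).comp_measurable (measurable_fst.add measurable_snd)
      exact (this.integral_prod_right (ν := volume.restrict (Metric.ball (0 : Euc n) δ))).measurable.enorm)
    (fun i => Eventually.of_forall fun x => hbound i x)
    (by
      rw [lintegral_const, Measure.restrict_apply_univ]
      exact ENNReal.mul_ne_top hKtop measure_ball_lt_top.ne)
    (Eventually.of_forall hpt)
  simpa using hlim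

/-- Local Rellich compactness by averaging: a function differs from its mean over a `δ`-ball by
`O(δ)` in local `L¹`, uniformly in `i`, by the translation estimate, while the means tend to zero
for each fixed `δ`. -/
theorem HomSobolev.tendsto_lintegral_ball (hpn : p < n) {θ : ℕ → Euc n → ℝ}
    {V : ℕ → HomSobolev n p} (hθ : ∀ i, HomSobolev.Realizes (θ i) (V i))
    (hm : ∀ i, StronglyMeasurable (θ i)) {B : ℝ} (hB : ∀ i, ‖V i‖ ≤ B)
    (hweak : ∀ l : StrongDual ℝ (HomSobolev n p), Tendsto (fun i => l (V i)) atTop (𝓝 0))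
    (R : ℝ) :
    Tendsto (fun i => ∫⁻ x in Metric.ball 0 R, ‖θ i x‖ₑ) atTop (𝓝 0) := by
  have hp1 : 1 < p := Fact.out
  have hQ := one_le_ofReal_sobolevExp (n := n) (p := p) hpn
  set K : ℝ≥0∞ := ENNReal.ofReal B * volume (Metric.ball (0 : Euc n) R) ^ (1 - 1 / p) with hK
  have hKtop : K ≠ ⊤ := ENNReal.mul_ne_top ENNReal.ofReal_ne_top
    (ENNReal.rpow_ne_top_of_nonneg (sub_nonneg.2 (by
      rw [div_le_one (by linarith)]; linarith)) measure_ball_lt_top.ne)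
  have key : ∀ (δ : NNReal), 0 < δ → ∀ i, ∫⁻ x in Metric.ball 0 R, ‖θ i x‖ₑ ≤ δ * K +
      (∫⁻ x in Metric.ball 0 R, ‖∫ y in Metric.ball 0 (δ : ℝ), θ i (x + y)‖ₑ) /
        volume (Metric.ball (0 : Euc n) δ) := by
    intro δ hδ i
    set D := Metric.ball (0 : Euc n) δ with hD
    have hD0 : volume D ≠ 0 := (Metric.measure_ball_pos _ _ hδ).ne'
    have hDt : volume D ≠ ⊤ := measure_ball_lt_top.ne
    have hDfin : IsFiniteMeasure ((volume : Measure (Euc n)).restrict D) := ⟨by simpa using hDt.lt_top⟩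
    have hsm : StronglyMeasurable (fun z : Euc n × Euc n => θ i (z.1 + z.2)) :=
      (hm i).comp_measurable (measurable_fst.add measurable_snd)
    have hdm : Measurable (fun z : Euc n × Euc n => ‖θ i (z.1 + z.2) - θ i z.1‖ₑ) :=
      (hsm.sub ((hm i).comp_measurable measurable_fst)).measurable.enorm
    have hpt : ∀ x, volume D * ‖θ i x‖ₑ ≤ (∫⁻ y in D, ‖θ i (x + y) - θ i x‖ₑ) +
        ‖∫ y in D, θ i (x + y)‖ₑ := by
      intro x
      have hint : IntegrableOn (fun y => θ i (x + y)) D := by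
        have hmp := measurePreserving_add_left (volume : Measure (Euc n)) x
        exact (((hθ i).1.comp_measurePreserving hmp).restrict D).integrable hQ
      have e : ∫ y in D, θ i x = (∫ y in D, θ i (x + y)) - ∫ y in D, (θ i (x + y) - θ i x) := by
        rw [integral_sub hint (integrable_const _)]; ring
      have e2 : ‖∫ _ in D, θ i x‖ₑ = volume D * ‖θ i x‖ₑ := by
        rw [setIntegral_const, enorm_smul, Measure.real, Real.enorm_of_nonneg ENNReal.toReal_nonneg,
          ENNReal.ofReal_toReal hDt]
      rw [← e2, e, add_comm]
      exact enorm_sub_le.trans (add_le_add le_rfl (enorm_integral_le_lintegral_enorm _))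
    have h1 : volume D * ∫⁻ x in Metric.ball 0 R, ‖θ i x‖ₑ ≤ volume D * (δ * K) +
        ∫⁻ x in Metric.ball 0 R, ‖∫ y in D, θ i (x + y)‖ₑ := by
      rw [← lintegral_const_mul' _ _ hDt]
      refine (lintegral_mono hpt).trans ?_
      rw [lintegral_add_left hdm.lintegral_prod_right']
      gcongr
      rw [lintegral_lintegral_swap hdm.aemeasurable]
      calc _ ≤ ∫⁻ y in D, δ * K := by
            refine setLIntegral_mono' measurableSet_ball fun y hy => ?_
            refine ((hθ i).lintegral_translate_sub_le hpn y R).trans ?_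
            rw [hK, HomSobolev.eLpNorm_grad]
            gcongr
            · rw [← ofReal_norm, ← ENNReal.ofReal_coe_nnreal]
              exact ENNReal.ofReal_le_ofReal (mem_ball_zero_iff.1 hy).le
            · exact hB i
        _ = _ := by rw [setLIntegral_const, mul_comm]
    rw [← ENNReal.mul_le_mul_iff_right hD0 hDt, mul_add, ENNReal.mul_div_cancel hD0 hDt]
    exact h1
  rw [ENNReal.tendsto_nhds_zero]
  intro η hη
  -- The radius is fixed before the index: `δ` makes the oscillation smaller than `η / 2` for all
  -- `i`, and only then does `i` grow.
  obtain ⟨δ, hδ, hδK⟩ := ENNReal.exists_nnreal_pos_mul_lt hKtop (ENNReal.half_pos hη.ne').ne'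
  have hlim := ENNReal.Tendsto.div_const
    (HomSobolev.tendsto_lintegral_average hpn hθ hm hB hweak R δ)
    (Or.inr (Metric.measure_ball_pos volume (0 : Euc n) hδ).ne')
  rw [ENNReal.zero_div] at hlim
  filter_upwards [ENNReal.tendsto_nhds_zero.1 hlim _ (ENNReal.half_pos hη.ne')] with i hi
  refine (key δ hδ i).trans ?_
  calc _ ≤ η / 2 + η / 2 := add_le_add hδK.le hi
    _ = η := ENNReal.add_halves η

theorem HomSobolev.exists_ae_subseq (hpn : p < n) {φ : ℕ → Euc n → ℝ} {U : ℕ → HomSobolev n p}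
    (hφ : ∀ i, HomSobolev.Realizes (φ i) (U i)) {ψ : Euc n → ℝ} {Ψ : HomSobolev n p}
    (hψ : HomSobolev.Realizes ψ Ψ) {B : ℝ} (hB : ∀ i, ‖U i‖ ≤ B)
    (hweak : ∀ l : StrongDual ℝ (HomSobolev n p), Tendsto (fun i => l (U i)) atTop (𝓝 (l Ψ))) :
    ∃ s : ℕ → ℕ, StrictMono s ∧ ∀ᵐ x, Tendsto (fun k => φ (s k) x) atTop (𝓝 (ψ x)) := by
  have hθ : ∀ i, HomSobolev.Realizes (fun x => φ i x - ψ x) (U i - Ψ) := fun i =>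
    (hφ i).sub hpn hψ
  have hae : ∀ i, (fun x => φ i x - ψ x) =ᵐ[volume] (hθ i).1.1.mk _ := fun i => (hθ i).1.1.ae_eq_mk
  obtain ⟨s, hs, hlim⟩ := ae_tendsto_zero_of_lintegral_ball
    (fun i => (hθ i).1.1.stronglyMeasurable_mk.aestronglyMeasurable)
    (HomSobolev.tendsto_lintegral_ball hpn (fun i => (hθ i).congr (hae i))
      (fun i => (hθ i).1.1.stronglyMeasurable_mk) (B := B + ‖Ψ‖)
      (fun i => (norm_sub_le _ _).trans (add_le_add (hB i) le_rfl)) (fun l => by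
        simpa using (hweak l).sub_const (l Ψ)))
  refine ⟨s, hs, ?_⟩
  filter_upwards [hlim, ae_all_iff.2 hae] with x h1 h2
  have h3 := (h1.congr fun k => (h2 (s k)).symm).add_const (ψ x)
  simpa using h3

end LocalConvergence

/-! ### Convergence of the weighted integrals -/

/-- Fatou gives the lower bound. For the upper bound `f k ≤ min (f k) g + r k`: dominated
convergence handles the minimum and the remainder costs at most `η`. The majorant `g` may depend on
`η`, which suits uniformly integrable and tight sequences. -/
theorem tendsto_lintegral_of_le_add {α : Type*} [MeasurableSpace α] {μ : Measure α}
    {f : ℕ → α → ℝ≥0∞} {f₀ : α → ℝ≥0∞} (hf : ∀ k, AEMeasurable (f k) μ)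
    (hlim : ∀ᵐ x ∂μ, Tendsto (fun k => f k x) atTop (𝓝 (f₀ x)))
    (h : ∀ η : ℝ≥0∞, 0 < η → ∃ g : α → ℝ≥0∞, Measurable g ∧ ∫⁻ x, g x ∂μ ≠ ⊤ ∧
      ∃ r : ℕ → α → ℝ≥0∞, (∀ k x, f k x ≤ g x + r k x) ∧ ∀ᶠ k in atTop, ∫⁻ x, r k x ∂μ ≤ η) :
    Tendsto (fun k => ∫⁻ x, f k x ∂μ) atTop (𝓝 (∫⁻ x, f₀ x ∂μ)) := by
  refine tendsto_of_le_liminf_of_limsup_le ?_ ?_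
  · calc ∫⁻ x, f₀ x ∂μ = ∫⁻ x, liminf (fun k => f k x) atTop ∂μ :=
          lintegral_congr_ae (by filter_upwards [hlim] with x hx using hx.liminf_eq.symm)
      _ ≤ _ := lintegral_liminf_le' hf
  · refine ENNReal.le_of_forall_pos_le_add fun η hη hfin => ?_
    have hη2 : (0 : ℝ≥0∞) < η / 2 := ENNReal.half_pos (ENNReal.coe_ne_zero.2 hη.ne')
    obtain ⟨g, hg, hgfin, r, hr, hrη⟩ := h (η / 2) hη2
    have hmin : Tendsto (fun k => ∫⁻ x, min (f k x) (g x) ∂μ) atTop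
        (𝓝 (∫⁻ x, min (f₀ x) (g x) ∂μ)) := by
      refine tendsto_lintegral_of_dominated_convergence' g (fun k => (hf k).min hg.aemeasurable)
        (fun k => Eventually.of_forall fun x => min_le_right _ _) hgfin ?_
      filter_upwards [hlim] with x hx
      exact hx.min tendsto_const_nhds
    have hlt : ∫⁻ x, min (f₀ x) (g x) ∂μ < ∫⁻ x, f₀ x ∂μ + η / 2 :=
      (lintegral_mono fun x => min_le_left _ _).trans_lt (ENNReal.lt_add_right hfin.ne hη2.ne')
    refine limsup_le_of_le (by isBoundedDefault) ?_
    filter_upwards [hmin.eventually (eventually_le_nhds hlt), hrη] with k h1 h2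
    calc ∫⁻ x, f k x ∂μ ≤ ∫⁻ x, (min (f k x) (g x) + r k x) ∂μ := by
          refine lintegral_mono fun x => ?_
          rcases le_total (f k x) (g x) with h3 | h3
          · rw [min_eq_left h3]; exact le_self_add
          · rw [min_eq_right h3]; exact hr k x
      _ = ∫⁻ x, min (f k x) (g x) ∂μ + ∫⁻ x, r k x ∂μ :=
          lintegral_add_left' ((hf k).min hg.aemeasurable) _
      _ ≤ (∫⁻ x, f₀ x ∂μ + η / 2) + η / 2 := add_le_add h1 h2
      _ = _ := by rw [add_assoc, ENNReal.add_halves]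

theorem lintegral_ofReal_rpow_eq {α : Type*} [MeasurableSpace α] {μ : Measure α} {f : α → ℝ}
    (hf : ∀ x, 0 ≤ f x) {s : ℝ} (hs : 0 < s) :
    ∫⁻ x, ENNReal.ofReal (f x ^ s) ∂μ = eLpNorm f (ENNReal.ofReal s) μ ^ s := by
  rw [eLpNorm_eq_lintegral_rpow_enorm_toReal (by simpa using hs) ENNReal.ofReal_ne_top,
    ENNReal.toReal_ofReal hs.le, ← ENNReal.rpow_mul, one_div, inv_mul_cancel₀ hs.ne',
    ENNReal.rpow_one]
  refine lintegral_congr fun x => ?_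
  rw [Real.enorm_of_nonneg (hf x), ENNReal.ofReal_rpow_of_nonneg (hf x) hs.le]

section Functional

variable {n : ℕ} {p a₀ : ℝ}

-- Where `ε|s| ≤ v`, `M` is comparable to `v²` and `bubble_rpow_sobolevExp` produces `h / N`;
-- elsewhere `M` is comparable to `(εs)²` and `ε|s| ≤ √2 g`. The free numerator `X` covers both
-- functionals of the theorem at once.
set_option maxHeartbeats 1000000 in
theorem functional_integrand_le (hp1 : 1 < p) (hp2 : p < 2) (hpn : p < n)
    (hq : sobolevExp n p ≤ 2) (ha : 0 < a₀) {ε C₁ s X : ℝ} (hε : 0 < ε) (hC : 0 ≤ C₁) (x : Euc n)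
    (hX0 : 0 ≤ X) (hX : X ≤ bubble n p a₀ x + C₁ * ε * |s|) :
    X ^ sobolevExp n p / (bubble n p a₀ x ^ 2 + |ε * s| ^ 2) * |s| ^ 2 ≤
      (1 + C₁) ^ sobolevExp n p *
        (2 * a₀ ^ (sobolevExp n p - p) * (hardyDensity n p a₀ ε s x / bubbleWeight p x) +
        2 * (ε ^ 2)⁻¹ * excessDensity n p a₀ ε s x ^ sobolevExp n p) := by
  set q := sobolevExp n p with hqdef
  have hq0 : 0 < q := by have := lt_sobolevExp hp1 hpn; linarith
  have hN := bubbleWeight_pos (p := p) x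
  have hv := bubble_pos (p := p) ha x
  have hM := bubbleMod_pos (p := p) (ε := ε) ha s x
  have hh := hardyDensity_nonneg (p := p) (ε := ε) ha s x
  have hg := excessDensity_nonneg (p := p) (ε := ε) ha s x
  have hMdef : bubbleMod n p a₀ ε s x = bubble n p a₀ x ^ 2 + (ε * s) ^ 2 := rfl
  set v := bubble n p a₀ x with hvdef
  have hσ : |ε * s| = ε * |s| := by rw [abs_mul, abs_of_pos hε]
  have hσ2 : (ε * s) ^ 2 = (ε * |s|) ^ 2 := by rw [mul_pow, mul_pow, sq_abs]
  have hCq : 0 ≤ (1 + C₁) ^ q := by positivity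
  have hterm1 : 0 ≤ 2 * a₀ ^ (q - p) * (hardyDensity n p a₀ ε s x / bubbleWeight p x) := by positivity
  have hterm2 : 0 ≤ 2 * (ε ^ 2)⁻¹ * excessDensity n p a₀ ε s x ^ q := by positivity
  rw [hσ]
  rcases le_or_gt (ε * |s|) v with hc | hc
  · have h1 : X ^ q ≤ (1 + C₁) ^ q * v ^ q := by
      rw [← Real.mul_rpow (by positivity) hv.le]
      refine Real.rpow_le_rpow hX0 (hX.trans ?_) hq0.le
      nlinarith
    have h2 : X ^ q / (v ^ 2 + (ε * |s|) ^ 2) * |s| ^ 2 ≤ (1 + C₁) ^ q * (v ^ (q - 2) * s ^ 2) := by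
      have e : v ^ (q - 2) = v ^ q / v ^ 2 := by rw [Real.rpow_sub hv]; norm_num
      calc X ^ q / (v ^ 2 + (ε * |s|) ^ 2) * |s| ^ 2 ≤ (1 + C₁) ^ q * v ^ q / v ^ 2 * |s| ^ 2 := by
            gcongr
            nlinarith [sq_nonneg (ε * |s|)]
        _ = _ := by rw [e, sq_abs]; ring
    have h3 : v ^ (q - 2) * s ^ 2 ≤
        2 * a₀ ^ (q - p) * (hardyDensity n p a₀ ε s x / bubbleWeight p x) := by
      have e1 := bubble_rpow_sobolevExp hp1 hpn ha x
      rw [← hqdef, ← hvdef] at e1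
      have e2 : v ^ (p - 2) ≤ 2 * bubbleMod n p a₀ ε s x ^ ((p - 2) / 2) := by
        have hM2 : bubbleMod n p a₀ ε s x ≤ 2 * v ^ 2 := by
          rw [hMdef, hσ2]
          have : (ε * |s|) ^ 2 ≤ v ^ 2 := by gcongr
          linarith
        have f1 : (2 * v ^ 2) ^ ((p - 2) / 2) ≤ bubbleMod n p a₀ ε s x ^ ((p - 2) / 2) :=
          Real.rpow_le_rpow_of_nonpos hM hM2 (by linarith)
        have f2 : (2 * v ^ 2) ^ ((p - 2) / 2) = 2 ^ ((p - 2) / 2) * v ^ (p - 2) := by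
          rw [Real.mul_rpow (by norm_num) (by positivity), ← Real.rpow_natCast v 2,
            ← Real.rpow_mul hv.le]
          congr 2
          push_cast; ring
        have f3 : (1 : ℝ) / 2 ≤ 2 ^ ((p - 2) / 2) := by
          have := Real.rpow_le_rpow_of_exponent_le (x := 2) (by norm_num)
            (show (-1 : ℝ) ≤ (p - 2) / 2 by linarith)
          rw [Real.rpow_neg_one] at this
          linarith
        have f4 : 0 < v ^ (p - 2) := by positivity
        nlinarith
      rw [← mul_div_assoc, le_div_iff₀ hN]
      calc v ^ (q - 2) * s ^ 2 * bubbleWeight p x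
          = a₀ ^ (q - p) * (v ^ (p - 2) * bubbleWeight p x ^ (1 - p)) * s ^ 2 := by
            rw [← e1]; ring
        _ ≤ a₀ ^ (q - p) * (2 * bubbleMod n p a₀ ε s x ^ ((p - 2) / 2) *
              bubbleWeight p x ^ (1 - p)) * s ^ 2 := by gcongr
        _ = _ := by unfold hardyDensity; ring
    calc _ ≤ (1 + C₁) ^ q * (v ^ (q - 2) * s ^ 2) := h2
      _ ≤ _ := by gcongr; linarith
  · have hσ0 : 0 < ε * |s| := hv.trans hc
    have h1 : X ^ q ≤ (1 + C₁) ^ q * (ε * |s|) ^ q := by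
      rw [← Real.mul_rpow (by positivity) hσ0.le]
      refine Real.rpow_le_rpow hX0 (hX.trans ?_) hq0.le
      nlinarith
    have hs : 0 < |s| := by
      by_contra hcon
      nlinarith
    have h2 : X ^ q / (v ^ 2 + (ε * |s|) ^ 2) * |s| ^ 2 ≤
        (1 + C₁) ^ q * ((ε ^ 2)⁻¹ * (ε * |s|) ^ q) := by
      calc X ^ q / (v ^ 2 + (ε * |s|) ^ 2) * |s| ^ 2
          ≤ (1 + C₁) ^ q * (ε * |s|) ^ q / (ε * |s|) ^ 2 * |s| ^ 2 := by
            gcongr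
            nlinarith [sq_nonneg v]
        _ = _ := by field_simp
    have h3 : (ε * |s|) ^ q ≤ 2 * excessDensity n p a₀ ε s x ^ q := by
      have hM2 : bubbleMod n p a₀ ε s x ≤ 2 * (ε * |s|) ^ 2 := by
        rw [hMdef, hσ2]
        have : v ^ 2 ≤ (ε * |s|) ^ 2 := by gcongr
        linarith
      have hm := Real.sqrt_pos.2 hM
      have hm2 : √(bubbleMod n p a₀ ε s x) ≤ √2 * (ε * |s|) := by
        rw [← Real.sqrt_sq hσ0.le, ← Real.sqrt_mul (by norm_num)]
        exact Real.sqrt_le_sqrt hM2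
      have f1 : ε * |s| ≤ √2 * excessDensity n p a₀ ε s x := by
        unfold excessDensity
        rw [Real.rpow_neg hM.le, ← Real.sqrt_eq_rpow, hσ2, ← div_eq_mul_inv, ← mul_div_assoc,
          le_div_iff₀ hm]
        nlinarith
      have f2 : √2 ^ q ≤ 2 := by
        calc √2 ^ q ≤ √2 ^ (2 : ℝ) :=
              Real.rpow_le_rpow_of_exponent_le (Real.one_le_sqrt.2 (by norm_num)) hq
          _ = 2 := by norm_num
      calc (ε * |s|) ^ q ≤ (√2 * excessDensity n p a₀ ε s x) ^ q := by gcongr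
        _ = √2 ^ q * excessDensity n p a₀ ε s x ^ q := Real.mul_rpow (by positivity) hg
        _ ≤ _ := by gcongr
    calc _ ≤ (1 + C₁) ^ q * ((ε ^ 2)⁻¹ * (ε * |s|) ^ q) := h2
      _ ≤ (1 + C₁) ^ q * ((ε ^ 2)⁻¹ * (2 * excessDensity n p a₀ ε s x ^ q)) := by gcongr
      _ ≤ _ := by gcongr; linarith

/-- Truncation at one level `m` for both weight and height. Where `N ≥ m` the weight gains `1/m`;
where `N < m` and `h ≥ m` the higher power gains `m^(1-r)`; what remains is bounded by `m` on `{N <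
m}`, a bounded set. -/
theorem div_weight_le_truncation {h N m r : ℝ} (hh : 0 ≤ h) (hN : 1 ≤ N) (hm : 0 < m)
    (hr : 1 ≤ r) : h / N ≤ (if N < m then m else 0) + (h / m + h ^ r * m ^ (1 - r)) := by
  have h1 : 0 ≤ h / m := by positivity
  have h2 : 0 ≤ h ^ r * m ^ (1 - r) := by positivity
  have h3 : h / N ≤ h := div_le_self hh hN
  split_ifs with hc
  · rcases le_total h m with h4 | h4
    · linarith
    · have h0 : 0 < h := hm.trans_le h4
      have h5 : h ^ (1 - r) ≤ m ^ (1 - r) := Real.rpow_le_rpow_of_nonpos hm h4 (by linarith)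
      have h6 : h = h ^ r * h ^ (1 - r) := by rw [← Real.rpow_add h0]; norm_num
      have h7 : h ^ r * h ^ (1 - r) ≤ h ^ r * m ^ (1 - r) := by gcongr
      linarith
  · push Not at hc
    have : h / N ≤ h / m := by gcongr
    linarith

theorem lintegral_bubbleWeight_lt_ne_top (hp1 : 1 < p) (m : ℝ) :
    ∫⁻ x : Euc n, ENNReal.ofReal (if bubbleWeight p x < m then m else 0) ≠ ⊤ := by
  have hsub : {x : Euc n | bubbleWeight p x < m} ⊆ Metric.ball 0 m := by
    intro x hx
    have hx' : bubbleWeight p x < m := hx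
    rw [mem_ball_zero_iff]
    refine lt_of_le_of_lt ?_ hx'
    have h := one_lt_conj hp1
    rcases le_total ‖x‖ 1 with h1 | h1
    · exact h1.trans (one_le_bubbleWeight x)
    · have := Real.rpow_le_rpow_of_exponent_le h1 h.le
      rw [Real.rpow_one] at this
      unfold bubbleWeight; linarith
  refine ne_top_of_le_ne_top (b := ∫⁻ x in Metric.ball (0 : Euc n) m, ENNReal.ofReal m) ?_ ?_
  · rw [setLIntegral_const]
    exact ENNReal.mul_ne_top ENNReal.ofReal_ne_top measure_ball_lt_top.ne
  · rw [← lintegral_indicator measurableSet_ball]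
    refine lintegral_mono fun x => ?_
    split_ifs with hc
    · rw [indicator_of_mem (hsub hc)]
    · simp

/-- The integrand is bounded by an `m`-dependent integrable function plus terms whose integrals are
`O(1/m + m^(1-r))` uniformly in `k`, plus the excess term, which tends to zero with `ε`. -/
theorem tendsto_functional (hp1 : 1 < p) (hp2 : p < 2) (hpn : p < n) (hn : 2 ≤ n)
    (hq : sobolevExp n p ≤ 2) (ha : 0 < a₀) {ε : ℕ → ℝ} (hε : ∀ k, ε k ∈ Ioo (0 : ℝ) 1)
    (hε_lim : Tendsto ε atTop (𝓝 0)) {φ : ℕ → Euc n → ℝ} (hφ : ∀ k, AEMeasurable (φ k) volume)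
    {ψ : Euc n → ℝ} (hae : ∀ᵐ x, Tendsto (fun k => φ k x) atTop (𝓝 (ψ x))) {C : NNReal}
    (hb1 : ∀ k, ∫⁻ x, ENNReal.ofReal (hardyDensity n p a₀ (ε k) (φ k x) x) ≤ C)
    (hb2 : ∀ k, eLpNorm (fun x => hardyDensity n p a₀ (ε k) (φ k x) x)
      (ENNReal.ofReal (n / (n - 1))) volume ≤ C)
    (hb3 : ∀ k, eLpNorm (fun x => excessDensity n p a₀ (ε k) (φ k x) x)
      (ENNReal.ofReal (sobolevExp n p)) volume ≤ C * ENNReal.ofReal (ε k ^ 2) ^ (1 / p))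
    {C₁ : ℝ} (hC₁ : 0 ≤ C₁) {X : ℕ → Euc n → ℝ} (hXm : ∀ k, AEMeasurable (X k) volume)
    (hX0 : ∀ k x, 0 ≤ X k x) (hX : ∀ k x, X k x ≤ bubble n p a₀ x + C₁ * ε k * |φ k x|)
    (hXlim : ∀ᵐ x, Tendsto (fun k => X k x) atTop (𝓝 (bubble n p a₀ x))) :
    Tendsto (fun k => ∫⁻ x, ENNReal.ofReal (X k x ^ sobolevExp n p /
        (bubble n p a₀ x ^ 2 + |ε k * φ k x| ^ 2) * |φ k x| ^ 2)) atTop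
      (𝓝 (∫⁻ x, ENNReal.ofReal (bubble n p a₀ x ^ (sobolevExp n p - 2) * |ψ x| ^ 2))) ∧
    ∫⁻ x, ENNReal.ofReal (bubble n p a₀ x ^ (sobolevExp n p - 2) * |ψ x| ^ 2) < ⊤ := by
  set q := sobolevExp n p with hqdef
  have hp0 : 0 < p := by linarith
  have hpq : p < q := lt_sobolevExp hp1 hpn
  have hq0 : 0 < q := by linarith
  have hn' : (2 : ℝ) ≤ n := by exact_mod_cast hn
  set r : ℝ := n / (n - 1) with hrdef
  have hr1 : 1 < r := by rw [hrdef, lt_div_iff₀ (by linarith)]; linarith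
  set A : ℝ := (1 + C₁) ^ q * (2 * a₀ ^ (q - p)) with hA
  set D : ℝ := (1 + C₁) ^ q * 2 with hD
  have hA0 : 0 ≤ A := by positivity
  have hD0 : 0 ≤ D := by positivity
  set f : ℕ → Euc n → ℝ := fun k x => X k x ^ q /
    (bubble n p a₀ x ^ 2 + |ε k * φ k x| ^ 2) * |φ k x| ^ 2 with hf
  set H : ℕ → Euc n → ℝ := fun k x => hardyDensity n p a₀ (ε k) (φ k x) x with hH
  set G : ℕ → Euc n → ℝ := fun k x => excessDensity n p a₀ (ε k) (φ k x) x with hG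
  have hH0 : ∀ k x, 0 ≤ H k x := fun k x => hardyDensity_nonneg ha _ x
  have hG0 : ∀ k x, 0 ≤ G k x := fun k x => excessDensity_nonneg ha _ x
  have hfle : ∀ k x, f k x ≤ A * (H k x / bubbleWeight p x) + D * ((ε k ^ 2)⁻¹ * G k x ^ q) := by
    intro k x
    refine (functional_integrand_le hp1 hp2 hpn hq ha (hε k).1 hC₁ x (hX0 k x) (hX k x)).trans
      (le_of_eq ?_)
    simp only [hA, hD, hH, hG]
    ring
  have hMm : ∀ k, AEMeasurable (fun x => bubbleMod n p a₀ (ε k) (φ k x) x) volume := fun k =>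
    ((contDiff_bubble hp1).continuous.measurable.aemeasurable.pow_const 2).add
      (((hφ k).const_mul _).pow_const 2)
  have hHm : ∀ k, AEMeasurable (H k) volume := fun k =>
    (((hφ k).pow_const 2).mul ((hMm k).pow_const _)).mul
      ((contDiff_bubbleWeight hp1).continuous.measurable.aemeasurable.pow_const _)
  have hGm : ∀ k, AEMeasurable (G k) volume := fun k =>
    (((hφ k).const_mul _).pow_const 2).mul ((hMm k).pow_const _)
  have hfm : ∀ k, AEMeasurable (fun x => ENNReal.ofReal (f k x)) volume := by
    intro k
    have hφa : AEMeasurable (fun x => |φ k x|) volume := (hφ k).abs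
    have hφb : AEMeasurable (fun x => |ε k * φ k x|) volume := ((hφ k).const_mul _).abs
    exact ((((hXm k).pow_const q).div (((contDiff_bubble hp1).continuous.measurable.aemeasurable.pow_const 2).add
      (hφb.pow_const 2))).mul (hφa.pow_const 2)).ennreal_ofReal
  have hflim : ∀ᵐ x, Tendsto (fun k => ENNReal.ofReal (f k x)) atTop
      (𝓝 (ENNReal.ofReal (bubble n p a₀ x ^ (q - 2) * |ψ x| ^ 2))) := by
    filter_upwards [hae, hXlim] with x h1 h2
    have hv := bubble_pos (p := p) ha x
    refine ENNReal.tendsto_ofReal ?_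
    have h3 : Tendsto (fun k => bubble n p a₀ x ^ 2 + |ε k * φ k x| ^ 2) atTop
        (𝓝 (bubble n p a₀ x ^ 2 + |0 * ψ x| ^ 2)) :=
      tendsto_const_nhds.add (((hε_lim.mul h1).abs).pow 2)
    have h4 := ((h2.rpow_const (p := q) (Or.inl hv.ne')).div h3 (by positivity)).mul (h1.abs.pow 2)
    have e : bubble n p a₀ x ^ q / (bubble n p a₀ x ^ 2 + |0 * ψ x| ^ 2) * |ψ x| ^ 2 =
        bubble n p a₀ x ^ (q - 2) * |ψ x| ^ 2 := by
      rw [Real.rpow_sub hv]; norm_num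
    rw [e] at h4
    exact h4
  have hHr : ∀ k, ∫⁻ x, ENNReal.ofReal (H k x ^ r) ≤ ENNReal.ofReal ((C : ℝ) ^ r) := by
    intro k
    rw [lintegral_ofReal_rpow_eq (hH0 k) (by linarith),
      ← ENNReal.ofReal_rpow_of_nonneg C.coe_nonneg (by linarith), ENNReal.ofReal_coe_nnreal]
    exact ENNReal.rpow_le_rpow (hb2 k) (by linarith)
  -- The power `(ε²)^(q/p)` coming from the excess bound outweighs the factor `ε^(-2)`, leaving the
  -- positive exponent `q/p - 1`.
  have hGq : ∀ k, ∫⁻ x, ENNReal.ofReal ((ε k ^ 2)⁻¹ * G k x ^ q) ≤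
      ENNReal.ofReal ((C : ℝ) ^ q * (ε k ^ 2) ^ (q / p - 1)) := by
    intro k
    have hε2 : 0 < ε k ^ 2 := by have := (hε k).1; positivity
    simp_rw [ENNReal.ofReal_mul (show 0 ≤ (ε k ^ 2)⁻¹ by positivity)]
    rw [lintegral_const_mul' _ _ ENNReal.ofReal_ne_top, lintegral_ofReal_rpow_eq (hG0 k) hq0]
    have h1 : eLpNorm (G k) (ENNReal.ofReal q) volume ^ q ≤
        ENNReal.ofReal ((C : ℝ) ^ q * (ε k ^ 2) ^ (q / p)) := by
      refine (ENNReal.rpow_le_rpow (hb3 k) hq0.le).trans (le_of_eq ?_)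
      rw [ENNReal.mul_rpow_of_nonneg _ _ hq0.le, ← ENNReal.rpow_mul, ENNReal.ofReal_mul (by positivity),
        ← ENNReal.ofReal_rpow_of_nonneg C.coe_nonneg hq0.le, ENNReal.ofReal_coe_nnreal,
        ENNReal.ofReal_rpow_of_pos hε2, show 1 / p * q = q / p by ring]
    calc _ ≤ ENNReal.ofReal ((ε k ^ 2)⁻¹) * ENNReal.ofReal ((C : ℝ) ^ q * (ε k ^ 2) ^ (q / p)) := by
          gcongr
      _ = _ := by
          rw [← ENNReal.ofReal_mul (by positivity), Real.rpow_sub_one hε2.ne']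
          congr 1
          ring
  have hlim0 : Tendsto (fun k => (C : ℝ) ^ q * (ε k ^ 2) ^ (q / p - 1)) atTop (𝓝 0) := by
    have hqp : 0 < q / p - 1 := by rw [sub_pos, lt_div_iff₀ hp0]; linarith
    have h1 : Tendsto (fun k => ε k ^ 2) atTop (𝓝 0) := by simpa using hε_lim.pow 2
    have := (h1.rpow_const (Or.inr hqp.le)).const_mul ((C : ℝ) ^ q)
    simpa [Real.zero_rpow hqp.ne'] using this
  have hT : Tendsto (fun k => ∫⁻ x, ENNReal.ofReal (f k x)) atTop
      (𝓝 (∫⁻ x, ENNReal.ofReal (bubble n p a₀ x ^ (q - 2) * |ψ x| ^ 2))) := by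
    refine tendsto_lintegral_of_le_add hfm hflim fun η hη => ?_
    obtain ⟨η', hη'0, hη'⟩ : ∃ η' : ℝ, 0 < η' ∧ ENNReal.ofReal η' ≤ η := by
      obtain ⟨y, hy0, hy⟩ := ENNReal.lt_iff_exists_nnreal_btwn.1 hη
      exact ⟨y, by exact_mod_cast hy0, by simpa using hy.le⟩
    have hm : Tendsto (fun m : ℝ => A * (C / m + (C : ℝ) ^ r * m ^ (1 - r))) atTop (𝓝 0) := by
      have h1 : Tendsto (fun m : ℝ => (C : ℝ) / m) atTop (𝓝 0) := tendsto_const_nhds.div_atTop tendsto_id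
      have h2 : Tendsto (fun m : ℝ => m ^ (1 - r)) atTop (𝓝 0) := by
        rw [show 1 - r = -(r - 1) by ring]
        exact tendsto_rpow_neg_atTop (by linarith)
      have := (h1.add (h2.const_mul ((C : ℝ) ^ r))).const_mul A
      simpa using this
    -- The level `m` makes the two tail terms smaller than `η' / 2` for every `k`; the other half is
    -- left for the excess term with `k` large.
    obtain ⟨m, hm0, hmη⟩ := ((eventually_gt_atTop (0 : ℝ)).and
      (hm.eventually (eventually_le_nhds (half_pos hη'0)))).exists
    have hEm : Measurable (fun x : Euc n => if bubbleWeight p x < m then m else 0) :=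
      Measurable.ite (measurableSet_lt (contDiff_bubbleWeight hp1).continuous.measurable
        measurable_const) measurable_const measurable_const
    refine ⟨fun x => ENNReal.ofReal A * ENNReal.ofReal (if bubbleWeight p x < m then m else 0),
      hEm.ennreal_ofReal.const_mul _, ?_,
      fun k x => ENNReal.ofReal A * (ENNReal.ofReal (m⁻¹) * ENNReal.ofReal (H k x) +
        ENNReal.ofReal (m ^ (1 - r)) * ENNReal.ofReal (H k x ^ r)) +
        ENNReal.ofReal D * ENNReal.ofReal ((ε k ^ 2)⁻¹ * G k x ^ q), fun k x => ?_, ?_⟩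
    · rw [lintegral_const_mul' _ _ ENNReal.ofReal_ne_top]
      exact ENNReal.mul_ne_top ENNReal.ofReal_ne_top (lintegral_bubbleWeight_lt_ne_top hp1 m)
    · have hit : (0 : ℝ) ≤ if bubbleWeight p x < m then m else 0 := by
        split_ifs
        · exact hm0.le
        · exact le_rfl
      have hHx := hH0 k x
      have hGx : 0 ≤ (ε k ^ 2)⁻¹ * G k x ^ q := by have := hG0 k x; positivity
      have hmr : 0 < m ^ (1 - r) := by positivity
      beta_reduce
      rw [← ENNReal.ofReal_mul hA0, ← ENNReal.ofReal_mul (by positivity),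
        ← ENNReal.ofReal_mul hmr.le, ← ENNReal.ofReal_add (by positivity) (by positivity),
        ← ENNReal.ofReal_mul hA0, ← ENNReal.ofReal_mul hD0,
        ← ENNReal.ofReal_add (by positivity) (by positivity),
        ← ENNReal.ofReal_add (by positivity) (by positivity)]
      refine ENNReal.ofReal_le_ofReal ((hfle k x).trans ?_)
      have h1 := mul_le_mul_of_nonneg_left (div_weight_le_truncation hHx
        (one_le_bubbleWeight (p := p) x) hm0 hr1.le) hA0
      calc _ ≤ A * ((if bubbleWeight p x < m then m else 0) +
            (H k x / m + H k x ^ r * m ^ (1 - r))) + D * ((ε k ^ 2)⁻¹ * G k x ^ q) := by gcongr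
        _ = _ := by ring
    · have hev := (hlim0.const_mul D).eventually (eventually_le_nhds
        (show D * 0 < η' / 2 by rw [mul_zero]; linarith))
      filter_upwards [hev] with k hk
      have hHmk := (hHm k).ennreal_ofReal
      have m1 : AEMeasurable (fun x => ENNReal.ofReal m⁻¹ * ENNReal.ofReal (H k x)) volume :=
        hHmk.const_mul _
      have m2 : AEMeasurable (fun x => ENNReal.ofReal A * (ENNReal.ofReal m⁻¹ *
          ENNReal.ofReal (H k x) + ENNReal.ofReal (m ^ (1 - r)) * ENNReal.ofReal (H k x ^ r)))
          volume :=
        (m1.add ((((hHm k).pow_const r).ennreal_ofReal).const_mul _)).const_mul _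
      rw [lintegral_add_left' m2, lintegral_const_mul' _ _ ENNReal.ofReal_ne_top,
        lintegral_add_left' m1, lintegral_const_mul' _ _ ENNReal.ofReal_ne_top,
        lintegral_const_mul' _ _ ENNReal.ofReal_ne_top,
        lintegral_const_mul' _ _ ENNReal.ofReal_ne_top]
      have hb1' : ∫⁻ x, ENNReal.ofReal (H k x) ≤ ENNReal.ofReal C := by
        rw [ENNReal.ofReal_coe_nnreal]; exact hb1 k
      have hmr : 0 < m ^ (1 - r) := by positivity
      have hε2 : 0 < ε k ^ 2 := by have := (hε k).1; positivity
      calc _ ≤ ENNReal.ofReal A * (ENNReal.ofReal (m⁻¹) * ENNReal.ofReal C +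
            ENNReal.ofReal (m ^ (1 - r)) * ENNReal.ofReal ((C : ℝ) ^ r)) +
            ENNReal.ofReal D * ENNReal.ofReal ((C : ℝ) ^ q * (ε k ^ 2) ^ (q / p - 1)) := by
            gcongr
            · exact hHr k
            · exact hGq k
        _ = ENNReal.ofReal (A * (C / m + (C : ℝ) ^ r * m ^ (1 - r)) +
            D * ((C : ℝ) ^ q * (ε k ^ 2) ^ (q / p - 1))) := by
            rw [← ENNReal.ofReal_mul (by positivity), ← ENNReal.ofReal_mul hmr.le,
              ← ENNReal.ofReal_add (by positivity) (by positivity), ← ENNReal.ofReal_mul hA0,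
              ← ENNReal.ofReal_mul hD0, ← ENNReal.ofReal_add (by positivity) (by positivity)]
            congr 1
            ring
        _ ≤ ENNReal.ofReal η' := ENNReal.ofReal_le_ofReal (by linarith)
        _ ≤ η := hη'
  refine ⟨hT, ?_⟩
  -- The limit is finite because the approximating integrals are bounded uniformly in `k`; here `h /
  -- N ≤ h` and `ε < 1` suffice.
  refine lt_of_le_of_lt (le_of_tendsto' hT fun k => ?_)
    (show ENNReal.ofReal A * C + ENNReal.ofReal D * ENNReal.ofReal ((C : ℝ) ^ q) < ⊤ from ?_)
  · have hε2 : 0 < ε k ^ 2 := by have := (hε k).1; positivity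
    calc ∫⁻ x, ENNReal.ofReal (f k x) ≤ ∫⁻ x, (ENNReal.ofReal A * ENNReal.ofReal (H k x) +
          ENNReal.ofReal D * ENNReal.ofReal ((ε k ^ 2)⁻¹ * G k x ^ q)) := by
          refine lintegral_mono fun x => ?_
          have hHx := hH0 k x
          have hGx : 0 ≤ (ε k ^ 2)⁻¹ * G k x ^ q := by have := hG0 k x; positivity
          rw [← ENNReal.ofReal_mul hA0, ← ENNReal.ofReal_mul hD0,
            ← ENNReal.ofReal_add (by positivity) (by positivity)]
          refine ENNReal.ofReal_le_ofReal ((hfle k x).trans ?_)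
          gcongr
          exact div_le_self hHx (one_le_bubbleWeight x)
      _ = ENNReal.ofReal A * (∫⁻ x, ENNReal.ofReal (H k x)) +
          ENNReal.ofReal D * ∫⁻ x, ENNReal.ofReal ((ε k ^ 2)⁻¹ * G k x ^ q) := by
          rw [lintegral_add_left' ((hHm k).ennreal_ofReal.const_mul _),
            lintegral_const_mul' _ _ ENNReal.ofReal_ne_top,
            lintegral_const_mul' _ _ ENNReal.ofReal_ne_top]
      _ ≤ _ := by
          gcongr
          · exact hb1 k
          · refine (hGq k).trans (ENNReal.ofReal_le_ofReal ?_)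
            refine mul_le_of_le_one_right (by positivity) (Real.rpow_le_one hε2.le ?_ ?_)
            · exact pow_le_one₀ (hε k).1.le (hε k).2.le
            · rw [sub_nonneg, le_div_iff₀ hp0]; linarith
  · exact ENNReal.add_lt_top.2 ⟨ENNReal.mul_lt_top ENNReal.ofReal_lt_top ENNReal.coe_lt_top,
      ENNReal.mul_lt_top ENNReal.ofReal_lt_top ENNReal.ofReal_lt_top⟩

end Functional

/-! ### The main theorem -/

theorem lemma3p3 (n : ℕ) (p : ℝ) [Fact (1 < p)] (hp : p ≤ 2 * (n : ℝ) / ((n : ℝ) + 2))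
    (a₀ : ℝ) (ha₀ : 0 < a₀)
    (hv_lower : 1 / 2 ≤ eLpNorm (bubble n p a₀) (ENNReal.ofReal (sobolevExp n p)) volume)
    (hv_upper : eLpNorm (bubble n p a₀) (ENNReal.ofReal (sobolevExp n p)) volume ≤ 2)
    (ε : ℕ → ℝ) (hε : ∀ i, ε i ∈ Ioo (0 : ℝ) 1) (hε_lim : Tendsto ε atTop (𝓝 0))
    (φ : ℕ → Euc n → ℝ) (U : ℕ → HomSobolev n p)
    (hφ : ∀ i, HomSobolev.Realizes (φ i) (U i))
    (hbound : ∀ i, ∫⁻ x, ENNReal.ofReal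
      ((‖∇ (bubble n p a₀) x‖ + ε i * ‖HomSobolev.grad (U i) x‖) ^ (p - 2) *
        ‖HomSobolev.grad (U i) x‖ ^ 2) ≤ 1) :
    ∃ s : ℕ → ℕ, StrictMono s ∧
      ∃ (ψ : Euc n → ℝ) (Ψ : HomSobolev n p),
        HomSobolev.Realizes ψ Ψ ∧
        (∀ l : StrongDual ℝ (HomSobolev n p),
          Tendsto (fun k => l (U (s k))) atTop (𝓝 (l Ψ))) ∧
        MemWeightedLp 2 (fun x => bubble n p a₀ x ^ (sobolevExp n p - 2)) ψ ∧
        ∀ C₁ : ℝ, 0 ≤ C₁ →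
          Tendsto (fun k => ∫⁻ x, ENNReal.ofReal
              ((bubble n p a₀ x + C₁ * ε (s k) * |φ (s k) x|) ^ sobolevExp n p /
                (bubble n p a₀ x ^ 2 + |ε (s k) * φ (s k) x| ^ 2) * |φ (s k) x| ^ 2))
            atTop
            (𝓝 (∫⁻ x, ENNReal.ofReal
              (bubble n p a₀ x ^ (sobolevExp n p - 2) * |ψ x| ^ 2))) ∧
          Tendsto (fun k => ∫⁻ x, ENNReal.ofReal
              (|bubble n p a₀ x + C₁ * ε (s k) * φ (s k) x| ^ sobolevExp n p /
                (bubble n p a₀ x ^ 2 + |ε (s k) * φ (s k) x| ^ 2) * |φ (s k) x| ^ 2))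
            atTop
            (𝓝 (∫⁻ x, ENNReal.ofReal
              (bubble n p a₀ x ^ (sobolevExp n p - 2) * |ψ x| ^ 2))) := by
  have hp1 : 1 < p := Fact.out
  have hpmul : p * ((n : ℝ) + 2) ≤ 2 * n := (le_div_iff₀ (by positivity)).1 hp
  -- From `n + 2 < p (n + 2) ≤ 2n`; the same inequality, rearranged, gives `p < 2` and `p* ≤ 2`.
  have hn2 : (2 : ℝ) < n := by nlinarith
  have hn : 2 ≤ n := by exact_mod_cast hn2.le
  have hp2 : p < 2 := by nlinarith
  have hpn : p < n := hp2.trans hn2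
  have hq : sobolevExp n p ≤ 2 := by
    rw [sobolevExp, div_le_iff₀ (by linarith)]
    linarith
  have hvc : Continuous (bubble n p a₀) := (contDiff_bubble hp1).continuous
  obtain ⟨s₁, hs₁, ⟨B, hB⟩, Ψ, hweak⟩ :=
    HomSobolev.exists_weak_subseq hp2 hpn ha₀ (fun i => (hε i).1) hε_lim U hbound
  obtain ⟨ψ, hψ⟩ := HomSobolev.exists_realizes hpn Ψ
  obtain ⟨s₂, hs₂, hae⟩ := HomSobolev.exists_ae_subseq hpn (fun i => hφ (s₁ i)) hψ
    (fun i => hB (s₁ i)) hweak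
  obtain ⟨C, hC⟩ := HomSobolev.Realizes.apriori (p := p) hp2 hpn hn ha₀
  have hs : StrictMono (s₁ ∘ s₂) := hs₁.comp hs₂
  have hC' := fun k => hC _ (hε ((s₁ ∘ s₂) k)).1 _ _ (hφ ((s₁ ∘ s₂) k)) (hbound ((s₁ ∘ s₂) k))
  have hφm : ∀ k, AEMeasurable (φ ((s₁ ∘ s₂) k)) volume := fun k => (hφ _).1.1.aemeasurable
  have hεs : Tendsto (fun k => ε ((s₁ ∘ s₂) k)) atTop (𝓝 0) := hε_lim.comp hs.tendsto_atTop
  -- The subsequence is fixed before `C₁` appears, so one subsequence serves every `C₁` and both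
  -- numerators `X`.
  have key := fun (C₁ : ℝ) (hC₁ : 0 ≤ C₁) (X : ℕ → Euc n → ℝ) => tendsto_functional hp1 hp2 hpn hn hq ha₀
    (fun k => hε ((s₁ ∘ s₂) k)) hεs hφm hae (fun k => (hC' k).1) (fun k => (hC' k).2.1)
    (fun k => (hC' k).2.2) hC₁ (X := X)
  have habs : ∀ C₁ : ℝ, 0 ≤ C₁ →
      Tendsto (fun k => ∫⁻ x, ENNReal.ofReal
          ((bubble n p a₀ x + C₁ * ε ((s₁ ∘ s₂) k) * |φ ((s₁ ∘ s₂) k) x|) ^ sobolevExp n p /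
            (bubble n p a₀ x ^ 2 + |ε ((s₁ ∘ s₂) k) * φ ((s₁ ∘ s₂) k) x| ^ 2) *
              |φ ((s₁ ∘ s₂) k) x| ^ 2)) atTop
        (𝓝 (∫⁻ x, ENNReal.ofReal (bubble n p a₀ x ^ (sobolevExp n p - 2) * |ψ x| ^ 2))) ∧
      ∫⁻ x, ENNReal.ofReal (bubble n p a₀ x ^ (sobolevExp n p - 2) * |ψ x| ^ 2) < ⊤ := by
    intro C₁ hC₁
    refine key C₁ hC₁
      (fun k x => bubble n p a₀ x + C₁ * ε ((s₁ ∘ s₂) k) * |φ ((s₁ ∘ s₂) k) x|)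
      (fun k => hvc.measurable.aemeasurable.add ((hφm k).abs.const_mul _)) (fun k x => ?_)
      (fun k x => le_rfl) ?_
    · have := (bubble_pos (p := p) ha₀ x).le
      have := (hε ((s₁ ∘ s₂) k)).1.le
      positivity
    · filter_upwards [hae] with x hx
      simpa using ((hεs.const_mul C₁).mul hx.abs).const_add (bubble n p a₀ x)
  refine ⟨s₁ ∘ s₂, hs, ψ, Ψ, hψ, fun l => (hweak l).comp hs₂.tendsto_atTop,
    ⟨hψ.1.1.aemeasurable, ?_⟩, fun C₁ hC₁ => ⟨(habs C₁ hC₁).1, ?_⟩⟩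
  -- Membership in the weighted `L²` space does not involve `C₁`, so the value `0` is enough.
  · simpa [mul_comm] using (habs 0 le_rfl).2
  · refine (key C₁ hC₁
      (fun k x => |bubble n p a₀ x + C₁ * ε ((s₁ ∘ s₂) k) * φ ((s₁ ∘ s₂) k) x|)
      (fun k => (hvc.measurable.aemeasurable.add ((hφm k).const_mul _)).abs)
      (fun k x => abs_nonneg _) (fun k x => ?_) ?_).1
    · refine (abs_add_le _ _).trans (le_of_eq ?_)
      rw [abs_mul, abs_of_pos (bubble_pos (p := p) ha₀ x),
        abs_of_nonneg (mul_nonneg hC₁ (hε ((s₁ ∘ s₂) k)).1.le)]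
    · filter_upwards [hae] with x hx
      simpa [abs_of_pos (bubble_pos (p := p) ha₀ x)] using
        (((hεs.const_mul C₁).mul hx).const_add (bubble n p a₀ x)).abs
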